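/- **Languages.** Let $L_0=\{0,1,-,+\}$, let $L_1^*$ extend $L_0$ by unary predicates $U_{p,l}$ ($p$ prime, $l\in\mathbb Z$) and $P_m$ ($m\ge 1$), and let $L_2^*=L_1^*\cup\{<\}$. **Base theories.** An $L_1^*$-structure $(G;U,P)$ is a *model of $T_{1,\mathbb Z}^-$* if (1) $G\equiv\mathbb Z$ as $L_0$-structures; (2) $U_{p,l}=G$ for $l\le 0$ and $U_{p,l}=p^lG$ for $l>0$; (3) $1\in P_1$, and for all $a\in G$: $-a\in P_1$ iff $a\in P_1$; (4) for every prime $p$ and $a\in G$: $pa\in P_1$ iff $a\in P_1$ and $a\notin U_{p,1}$; (5) $P_m=\bigcup_{d\mid m}dP_1$ for all $m\ge1$. It is a *model of $T_{1,\mathbb Q}^-$* if (1) $G\equiv\mathbb Q$ as $L_0$-structures; (2) for every prime $p$, $U_{p,0}$ is a subgroup of $G$, and it is the set of all $a_1+a_2$ with $a_1,a_2\in P_1$ and $p^2a_1,p^2a_2\notin P_1$; (3) $p^{-l}U_{p,l}=U_{p,0}$ for $l<0$ and $U_{p,l}=p^lU_{p,0}$ for $l>0$; (4) $U_{p,0}/U_{p,1}\cong\mathbb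 Z/p\mathbb Z$ as groups; (5) $1\in P_1$, and for all $a\in G$: $-a\in P_1$ iff $a\in P_1$; (6) for every prime $p$ and $a\in G$: $pa\in P_1$ iff $a\in P_1$ and $a\notin U_{p,1}$; (7) $P_m=mP_1$ for all $m\ge1$. An $L_2^*$-structure $(G;<,U,P)$ is a *model of $T_{2,\mathbb Q}^-$* if $(G;<)\equiv(\mathbb Q;<)$ as $L_0\cup\{<\}$-structures and $(G;U,P)$ is a model of $T_{1,\mathbb Q}^-$. **Genericity.** For a prime $p$, a *$p$-condition* is a boolean combination of $L_1^*$-formulas $t\in U_{p,l}$ ($t$ a term, $l\in\mathbb Z$); it is *trivial* if it is the empty conjunction. Let $z=(z_1,\dots,z_n)$ and $z'=(z'_1,\dots,z'_{n'})$. A *special formula* is $$\psi(x,z,z')=\bigwedge_p\theta_p(x,z,z')\wedge\bigwedge_{i=1}^n(kx+z_i\in P_m)\wedge\bigwedge_{j=1}^{n'}(kx+z'_j\notin P_m),$$ where $k\in\mathbb Z\setminus\{0\}$, $m\ge1$, each $\theta_p$ is a $p$-condition, and all but finitely many $\theta_p$ are trivial. Put $$\psi_p=\theta_p(x,z,z')\wedge\bigwedge_{i=1}^n(kx+z_i\notin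 U_{p,2+v_p(m)}).$$ A *$G$-system* is a formula $\psi(x,c,c')$ with $\psi$ special and $c\in G^n$, $c'\in G^{n'}$ such that all $n+n'$ components of $c$ and $c'$ are pairwise distinct. It is *locally satisfiable* in $G$ if for every prime $p$ there is $a_p\in G$ such that $\psi_p(a_p,c,c')$ holds. A model $G$ of $T_{1,\mathbb Z}^-$ or of $T_{1,\mathbb Q}^-$ is *generic* if every locally satisfiable $G$-system has infinitely many solutions in $G$. A model $G$ of $T_{2,\mathbb Q}^-$ is *generic* if every locally satisfiable $G$-system has a solution in $\{a\in G:b<a<b'\}$ for all $b<b'$ in $G$. **Theorem (quantifier elimination).** There are an $L_1^*$-theory $T_{1,\mathbb Z}$, an $L_1^*$-theory $T_{1,\mathbb Q}$ and an $L_2^*$-theory $T_{2,\mathbb Q}$ whose models are exactly the generic models of $T_{1,\mathbb Z}^-$, of $T_{1,\mathbb Q}^-$ and of $T_{2,\mathbb Q}^-$, respectively. Any such theories $T_{1,\mathbb Z}$, $T_{1,\mathbb Q}$ and $T_{2,\mathbb Q}$ admit quantifier elimination: modulo the theory, every formula $\varphi(y_1,\dots,y_r)$, $r\ge0$, is equivalent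 to a quantifier-free formula in the same free variables. -/

import Mathlib

open FirstOrder

namespace SqfQE

/-! ### Languages -/

/-- Function symbols of the language of additive groups with a constant for `1` and a symbol for
`a ↦ -a`. -/
inductive GroupFunc : ℕ → Type
  | zero : GroupFunc 0
  | one : GroupFunc 0
  | neg : GroupFunc 1
  | add : GroupFunc 2

/-- Unary predicate symbols `U_{p,l}` (`p` prime, `l ∈ ℤ`) and `P_m` (`m ≥ 1`). -/
inductive PredRel : ℕ → Type
  | U (p : Nat.Primes) (l : ℤ) : PredRel 1
  | P (m : ℕ+) : PredRel 1

/-- The binary symbol `<`. -/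
inductive LtRel : ℕ → Type
  | lt : LtRel 2

/-- The language `L₀ = {0, 1, -, +}`. -/
def L0 : FirstOrder.Language.{0, 0} := ⟨GroupFunc, fun _ => Empty⟩

/-- The relational language of the predicates `U_{p,l}` and `P_m`. -/
def LPred : FirstOrder.Language.{0, 0} := ⟨fun _ => Empty, PredRel⟩

/-- The relational language `{<}`. -/
def LLt : FirstOrder.Language.{0, 0} := ⟨fun _ => Empty, LtRel⟩

/-- `L₀ ∪ {<}`, the language of ordered groups with a constant for `1`. -/
def L0lt : FirstOrder.Language.{0, 0} := L0.sum LLt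

/-- `L₁* = L₀ ∪ {U_{p,l}} ∪ {P_m}`. -/
def L1star : FirstOrder.Language.{0, 0} := L0.sum LPred

/-- `L₂* = L₁* ∪ {<}`. -/
def L2star : FirstOrder.Language.{0, 0} := L1star.sum LLt

/-- The symbol `U_{p,l}` of `L₁*`. -/
def symU (p : Nat.Primes) (l : ℤ) : L1star.Relations 1 := Sum.inr (PredRel.U p l)

/-! ### Structures -/

section Structures

variable {G : Type} [AddCommGroup G] [One G]

/-- An abelian group with a distinguished element `1` as an `L₀`-structure. -/
instance groupStructure : L0.Structure G where
  funMap := fun f =>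
    match f with
    | GroupFunc.zero => fun _ => 0
    | GroupFunc.one => fun _ => 1
    | GroupFunc.neg => fun x => -x 0
    | GroupFunc.add => fun x => x 0 + x 1
  RelMap := fun r => Empty.elim r

/-- Interpretation of the predicates `U_{p,l}` and `P_m` by given subsets. -/
@[reducible] def predStructure {G : Type} (U : Nat.Primes → ℤ → Set G) (P : ℕ+ → Set G) :
    LPred.Structure G where
  funMap := fun f => Empty.elim f
  RelMap := fun r =>
    match r with
    | PredRel.U p l => fun x => x 0 ∈ U p l
    | PredRel.P m => fun x => x 0 ∈ P m

/-- Interpretation of `<` by a given binary relation. -/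
@[reducible] def ltStructure {G : Type} (lt : G → G → Prop) : LLt.Structure G where
  funMap := fun f => Empty.elim f
  RelMap := fun r =>
    match r with
    | LtRel.lt => fun x => lt (x 0) (x 1)

/-- The `L₀ ∪ {<}`-structure `(G; <)`. -/
@[reducible] def structure0lt (lt : G → G → Prop) : L0lt.Structure G :=
  letI := ltStructure lt
  FirstOrder.Language.sumStructure L0 LLt G

/-- The `L₁*`-structure `(G; U, P)`. -/
@[reducible] def structure1 (U : Nat.Primes → ℤ → Set G) (P : ℕ+ → Set G) : L1star.Structure G :=
  letI := predStructure U P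
  FirstOrder.Language.sumStructure L0 LPred G

/-- The `L₂*`-structure `(G; <, U, P)`. -/
@[reducible] def structure2 (lt : G → G → Prop) (U : Nat.Primes → ℤ → Set G)
    (P : ℕ+ → Set G) : L2star.Structure G :=
  letI := structure1 U P
  letI := ltStructure lt
  FirstOrder.Language.sumStructure L1star LLt G

end Structures

/-! ### The base theories, given by their models -/

section Base

variable {G : Type} [AddCommGroup G] [One G]

/-- `(G; U, P)` is a model of the base theory over `ℤ`. -/
structure IsBaseZ (U : Nat.Primes → ℤ → Set G) (P : ℕ+ → Set G) : Prop where
  elemEquiv : L0.ElementarilyEquivalent G ℤ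
  U_nonpos : ∀ (p : Nat.Primes) (l : ℤ), l ≤ 0 → U p l = Set.univ
  U_pos : ∀ (p : Nat.Primes) (l : ℕ), 0 < l → U p l = {x | ∃ a : G, x = (p : ℕ) ^ l • a}
  one_mem : (1 : G) ∈ P 1
  neg_mem : ∀ a : G, -a ∈ P 1 ↔ a ∈ P 1
  prime_smul_mem : ∀ (p : Nat.Primes) (a : G), (p : ℕ) • a ∈ P 1 ↔ a ∈ P 1 ∧ a ∉ U p 1
  P_eq : ∀ m : ℕ+, P m = {x | ∃ d : ℕ, d ∣ (m : ℕ) ∧ ∃ a ∈ P 1, x = d • a}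

/-- `(G; U, P)` is a model of the base theory over `ℚ`. -/
structure IsBaseQ (U : Nat.Primes → ℤ → Set G) (P : ℕ+ → Set G) : Prop where
  elemEquiv : L0.ElementarilyEquivalent G ℚ
  U_zero : ∀ p : Nat.Primes, U p 0 =
    {a | ∃ a₁ a₂ : G, (a₁ ∈ P 1 ∧ (p : ℕ) ^ 2 • a₁ ∉ P 1) ∧
      (a₂ ∈ P 1 ∧ (p : ℕ) ^ 2 • a₂ ∉ P 1) ∧ a = a₁ + a₂}
  U_neg : ∀ (p : Nat.Primes) (l : ℕ), 0 < l →
    {x | ∃ a ∈ U p (-(l : ℤ)), x = (p : ℕ) ^ l • a} = U p 0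
  U_pos : ∀ (p : Nat.Primes) (l : ℕ), 0 < l →
    U p l = {x | ∃ a ∈ U p 0, x = (p : ℕ) ^ l • a}
  /-- `U_{p,0}` and `U_{p,1}` are subgroups, and `U_{p,0} / U_{p,1} ≅ ℤ / pℤ`. -/
  quotient : ∀ p : Nat.Primes, ∃ H K : AddSubgroup G,
    (H : Set G) = U p 0 ∧ (K : Set G) = U p 1 ∧ K ≤ H ∧
      Nonempty ((H ⧸ K.addSubgroupOf H) ≃+ ZMod (p : ℕ))
  one_mem : (1 : G) ∈ P 1
  neg_mem : ∀ a : G, -a ∈ P 1 ↔ a ∈ P 1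
  prime_smul_mem : ∀ (p : Nat.Primes) (a : G), (p : ℕ) • a ∈ P 1 ↔ a ∈ P 1 ∧ a ∉ U p 1
  P_eq : ∀ m : ℕ+, P m = {x | ∃ a ∈ P 1, x = (m : ℕ) • a}

/-- `(G; <, U, P)` is a model of the base theory over the ordered group `ℚ`. -/
structure IsBaseQlt (lt : G → G → Prop) (U : Nat.Primes → ℤ → Set G) (P : ℕ+ → Set G) :
    Prop where
  elemEquiv_lt : @FirstOrder.Language.ElementarilyEquivalent L0lt G ℚ (structure0lt lt)
    (structure0lt (fun a b : ℚ => a < b))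
  base : IsBaseQ U P

end Base

/-! ### Special formulas, systems and genericity -/

/-- The formula `t ∈ U_{p,l}`. -/
def memU {α : Type} (p : Nat.Primes) (l : ℤ) (t : L1star.Term α) : L1star.Formula α :=
  (symU p l).formula₁ t

/-- `p`-conditions: boolean combinations of formulas `t ∈ U_{p,l}` for the fixed prime `p`. -/
inductive IsPCondition (p : Nat.Primes) {α : Type} : L1star.Formula α → Prop
  | falsum : IsPCondition p ⊥
  | mem (t : L1star.Term α) (l : ℤ) : IsPCondition p (memU p l t)
  | imp {φ ψ : L1star.Formula α} (hφ : IsPCondition p φ) (hψ : IsPCondition p ψ) :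
      IsPCondition p (φ.imp ψ)

/-- A parameter choice `(k, m, Θ)` in the variables `x`, `z = (z_1, …, z_n)`,
`z' = (z'_1, …, z'_n')`; `⊤` is the trivial condition. -/
structure ParameterChoice (n n' : ℕ) where
  k : ℤ
  k_ne_zero : k ≠ 0
  m : ℕ+
  θ : Nat.Primes → L1star.Formula (Unit ⊕ (Fin n ⊕ Fin n'))
  isPCondition : ∀ p, IsPCondition p (θ p)
  finite_nontrivial : {p | θ p ≠ ⊤}.Finite

section Systems

variable {G : Type} [AddCommGroup G] [One G]

/-- `θ_p(a, c, c')` holds in `(G; U, P)`. -/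
def ParameterChoice.ThetaHolds {n n' : ℕ} (π : ParameterChoice n n')
    (U : Nat.Primes → ℤ → Set G) (P : ℕ+ → Set G) (c : Fin n → G) (c' : Fin n' → G)
    (p : Nat.Primes) (a : G) : Prop :=
  letI := structure1 U P
  (π.θ p).Realize (Sum.elim (fun _ => a) (Sum.elim c c'))

/-- `a` is a solution of `ψ(x, c, c')`, where `ψ` is the special formula
`⋀_p θ_p(x, z, z') ∧ ⋀_i (k x + z_i ∈ P_m) ∧ ⋀_j (k x + z'_j ∉ P_m)`. -/
def ParameterChoice.IsSolution {n n' : ℕ} (π : ParameterChoice n n')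
    (U : Nat.Primes → ℤ → Set G) (P : ℕ+ → Set G) (c : Fin n → G) (c' : Fin n' → G)
    (a : G) : Prop :=
  (∀ p, π.ThetaHolds U P c c' p a) ∧ (∀ i, π.k • a + c i ∈ P π.m) ∧
    ∀ j, π.k • a + c' j ∉ P π.m

/-- `a` satisfies `ψ_p(x, c, c')`, where `ψ_p` is the `p`-condition
`θ_p(x, z, z') ∧ ⋀_i (k x + z_i ∉ U_{p, 2 + v_p(m)})` associated to `ψ`. -/
def ParameterChoice.IsLocalSolution {n n' : ℕ} (π : ParameterChoice n n')
    (U : Nat.Primes → ℤ → Set G) (P : ℕ+ → Set G) (c : Fin n → G) (c' : Fin n' → G)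
    (p : Nat.Primes) (a : G) : Prop :=
  π.ThetaHolds U P c c' p a ∧
    ∀ i, π.k • a + c i ∉ U p (2 + (padicValNat (p : ℕ) (π.m : ℕ) : ℤ))

/-- `ψ(x, c, c')` is a `G`-system (the components of `c` and `c'` are pairwise distinct) that is
`p`-satisfiable in `G` for every prime `p`. -/
def ParameterChoice.IsLocallySatisfiableSystem {n n' : ℕ} (π : ParameterChoice n n')
    (U : Nat.Primes → ℤ → Set G) (P : ℕ+ → Set G) (c : Fin n → G) (c' : Fin n' → G) : Prop :=
  Function.Injective (Sum.elim c c') ∧ ∀ p, ∃ a, π.IsLocalSolution U P c c' p a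

/-- Every locally satisfiable `G`-system has infinitely many solutions in `G`. -/
def IsGeneric (U : Nat.Primes → ℤ → Set G) (P : ℕ+ → Set G) : Prop :=
  ∀ (n n' : ℕ) (π : ParameterChoice n n') (c : Fin n → G) (c' : Fin n' → G),
    π.IsLocallySatisfiableSystem U P c c' → {a | π.IsSolution U P c c' a}.Infinite

/-- Every locally satisfiable `G`-system has a solution in every interval of `G`. -/
def IsGenericLt (lt : G → G → Prop) (U : Nat.Primes → ℤ → Set G) (P : ℕ+ → Set G) : Prop :=
  ∀ (n n' : ℕ) (π : ParameterChoice n n') (c : Fin n → G) (c' : Fin n' → G),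
    π.IsLocallySatisfiableSystem U P c c' →
      ∀ b b' : G, lt b b' → ∃ a, lt b a ∧ lt a b' ∧ π.IsSolution U P c c' a

end Systems

/-! ### The generic models and the theories -/

/-- The `L₁*`-structure `M` is a generic model of the base theory over `ℤ`. -/
def GenericZ (M : Type) (s : L1star.Structure M) : Prop :=
  ∃ (_ : AddCommGroup M) (_ : One M) (U : Nat.Primes → ℤ → Set M) (P : ℕ+ → Set M),
    s = structure1 U P ∧ IsBaseZ U P ∧ IsGeneric U P

/-- The `L₁*`-structure `M` is a generic model of the base theory over `ℚ`. -/
def GenericQ (M : Type) (s : L1star.Structure M) : Prop :=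
  ∃ (_ : AddCommGroup M) (_ : One M) (U : Nat.Primes → ℤ → Set M) (P : ℕ+ → Set M),
    s = structure1 U P ∧ IsBaseQ U P ∧ IsGeneric U P

/-- The `L₂*`-structure `M` is a generic model of the base theory over the ordered group `ℚ`. -/
def GenericQlt (M : Type) (s : L2star.Structure M) : Prop :=
  ∃ (_ : AddCommGroup M) (_ : One M) (lt : M → M → Prop) (U : Nat.Primes → ℤ → Set M)
    (P : ℕ+ → Set M),
    s = structure2 lt U P ∧ IsBaseQlt lt U P ∧ IsGenericLt lt U P

/-- The models of the theory `T` are exactly the structures in the class `K`. -/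
def Axiomatizes {L : FirstOrder.Language.{0, 0}} (T : L.Theory) (K : ∀ M : Type, L.Structure M → Prop) :
    Prop :=
  ∀ (M : Type) [s : L.Structure M], M ⊨ T ↔ K M s

/-- `T` admits quantifier elimination. -/
def HasQE {L : FirstOrder.Language.{0, 0}} (T : L.Theory) : Prop :=
  ∀ (n : ℕ) (φ : L.Formula (Fin n)),
    ∃ ψ : L.Formula (Fin n), FirstOrder.Language.BoundedFormula.IsQF ψ ∧ FirstOrder.Language.Theory.Iff T φ ψ

end SqfQE

/-!
# Quantifier elimination for groups with valuation and square-free predicates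

A theory has quantifier elimination as soon as its models satisfy a one-point extension test
(`hasQE_of_forall_exists`): if `v` and `w` are families in models `D` and `D'` with the same
quantifier-free type, then a quantifier-free condition on `v` and one further element `c` of `D` can
be realized by `w` and some `d` in `D'`. Terms are integral linear forms, so that only conditions
on elements `k c + t` with `t` in the group generated by `1` and `v` matter.

If some `K c + t` with `K ≠ 0` vanishes, then `c` is determined by this equation, which is also
solvable in `D'` (`RootTransfer`). Otherwise the coefficients are brought to a common value `K`
and the indices of the predicates `P_m` to a common multiple `M`; this is possible by
`k x ∈ U_{p, l + v_p(k)} ↔ x ∈ U_{p,l}` and by the description of `P_m` in terms of `P_{pm}` and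
the predicates `U_{p,l}`. The condition on `c` then becomes a special system with parameters in
`D'`, together with sign conditions in the ordered case. To see that the system is locally
satisfiable one treats one prime at a time (`LocalTransfer`). Over `ℤ` every element is congruent to
an integer modulo `p ^ L`. Over `ℚ` one compares the values of the elements `K c + t`, using that
the quotients `U_{p,l} / U_{p,l+1}` are cyclic of order `p`. Genericity of `D'` yields `d`, outside
a finite set of forbidden elements or inside an interval (`PlaceTransfer`). The extension argument
itself is `exists_agreeOn`; it uses only the properties `IsRegular` shared by the models of both
base theories. Over `ℚ` the group `U_{p,0}` is closed under division by the primes `q ≠ p`, but only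
in models with enough solutions (`IsBaseQ.mem_of_smul_mem`).

The generic models form an elementary class because local satisfiability is a first-order condition:
a special formula with `n` positive conditions is automatically satisfiable at every prime
`p > n + |k| + m` with trivial `θ_p`, by the pigeonhole principle applied to multiples of one
element (`HasLayers.exists_isLocalSolution`). Only finitely many primes are left, and these do not
depend on the parameters.
-/

namespace SqfQE

open FirstOrder.Language FirstOrder.Language.Theory

/-! ### A test for quantifier elimination -/

section Criterion

variable {L : FirstOrder.Language.{0, 0}}

/-- Compactness for types, with the variables turned into new constants. -/
theorem exists_realize_of_finitely_realizable (T : L.Theory) {X : Type} (Γ : Set (L.Formula X))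
    (h : ∀ Γ₀ : Finset (L.Formula X), (Γ₀ : Set (L.Formula X)) ⊆ Γ →
      ∃ (M : ModelType.{0, 0, 0} T) (v : X → M), ∀ φ ∈ Γ₀, φ.Realize v) :
    ∃ (M : ModelType.{0, 0, 0} T) (v : X → M), ∀ φ ∈ Γ, φ.Realize v := by
  classical
  have hsat : ((L.lhomWithConstants X).onTheory T ∪ Formula.equivSentence '' Γ).IsSatisfiable := by
    rw [isSatisfiable_iff_isFinitelySatisfiable]
    intro T₀ hT₀
    obtain ⟨M, v, hv⟩ := h ((T₀.image Formula.equivSentence.symm).filter (· ∈ Γ))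
      (fun φ hφ => (Finset.mem_filter.1 (Finset.mem_coe.1 hφ)).2)
    let : (constantsOn X).Structure M := constantsOn.structure v
    have hM : M ⊨ (L.lhomWithConstants X).onTheory T := (LHom.onTheory_model _ _).2 inferInstance
    have : M ⊨ (T₀ : (L[[X]]).Theory) := by
      rw [Theory.model_iff]
      intro σ hσ
      rcases hT₀ hσ with h1 | ⟨φ, hφ, rfl⟩
      · exact Theory.realize_sentence_of_mem _ h1
      · rw [Formula.realize_equivSentence]
        refine hv φ (Finset.mem_filter.2 ⟨Finset.mem_image.2 ⟨_, hσ, by simp⟩, hφ⟩)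
    exact Model.isSatisfiable M
  obtain ⟨M⟩ := hsat
  let := (L.lhomWithConstants X).reduct M
  have hM : M ⊨ (L.lhomWithConstants X).onTheory T := M.is_model.mono Set.subset_union_left
  have hT : M ⊨ T := (LHom.onTheory_model (L.lhomWithConstants X) T).1 hM
  refine ⟨Theory.ModelType.of T M, fun a => (L.con a : M), fun φ hφ => ?_⟩
  have h1 : M ⊨ Formula.equivSentence φ :=
    M.is_model.realize_of_mem _ (Or.inr ⟨φ, hφ, rfl⟩)
  exact (Formula.realize_equivSentence M φ).1 h1

/-- If the truth of `φ` depends only on the quantifier-free type, then `φ` is equivalent to a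
quantifier-free formula: by compactness, first applied to the quantifier-free consequences of `φ`,
then to the quantifier-free type of a counterexample. -/
theorem exists_isQF_iff_of_sameType (T : L.Theory) {X : Type} (φ : L.Formula X)
    (h : ∀ (M N : ModelType.{0, 0, 0} T) (v : X → M) (w : X → N),
      (∀ ψ : L.Formula X, BoundedFormula.IsQF ψ → (ψ.Realize v ↔ ψ.Realize w)) →
        φ.Realize v → φ.Realize w) :
    ∃ ψ : L.Formula X, BoundedFormula.IsQF ψ ∧
      ∀ (M : ModelType.{0, 0, 0} T) (v : X → M), φ.Realize v ↔ ψ.Realize v := by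
  classical
  let Γ : Set (L.Formula X) := {ψ | BoundedFormula.IsQF ψ ∧
    ∀ (M : ModelType.{0, 0, 0} T) (v : X → M), φ.Realize v → ψ.Realize v}
  have hconj : ∀ Γ₀ : Finset (L.Formula X), (∀ ψ ∈ Γ₀, BoundedFormula.IsQF ψ) →
      ∃ ψ : L.Formula X, BoundedFormula.IsQF ψ ∧
      ∀ (M : ModelType.{0, 0, 0} T) (v : X → M), ψ.Realize v ↔ ∀ χ ∈ Γ₀, χ.Realize v := by
    intro Γ₀
    induction Γ₀ using Finset.induction_on with
    | empty => exact fun _ => ⟨⊤, BoundedFormula.IsQF.top, fun M v => by simp⟩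
    | insert χ s hχ ih =>
      intro hq
      obtain ⟨ψ, hψ, hr⟩ := ih fun ψ hψ => hq ψ (Finset.mem_insert_of_mem hψ)
      refine ⟨χ ⊓ ψ, (hq χ (Finset.mem_insert_self _ _)).inf hψ, fun M v => ?_⟩
      rw [Formula.realize_inf, hr]
      simp
  by_contra hno
  -- Otherwise all quantifier-free consequences of `φ` hold at some `w` at which `φ` fails.
  have key : ∃ (N : ModelType.{0, 0, 0} T) (w : X → N), ∀ ψ ∈ Γ ∪ {φ.not}, ψ.Realize w := by
    refine exists_realize_of_finitely_realizable T _ fun Γ₀ hΓ₀ => ?_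
    by_contra hcon
    push Not at hcon
    apply hno
    obtain ⟨ψ, hψ, hr⟩ := hconj (Γ₀.filter (· ∈ Γ)) fun ψ hψ => (Finset.mem_filter.1 hψ).2.1
    refine ⟨ψ, hψ, fun M v => ⟨fun hφ => (hr M v).2 fun χ hχ =>
      (Finset.mem_filter.1 hχ).2.2 M v hφ, fun hv => ?_⟩⟩
    by_contra hφ
    obtain ⟨χ, hχ, hχv⟩ := hcon M v
    rcases hΓ₀ hχ with h1 | h1
    · exact hχv ((hr M v).1 hv χ (Finset.mem_filter.2 ⟨hχ, h1⟩))
    · rw [Set.mem_singleton_iff.1 h1] at hχv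
      exact hχv ((Formula.realize_not).2 hφ)
  obtain ⟨N, w, hw⟩ := key
  have hφw : ¬ φ.Realize w := (Formula.realize_not).1 (hw _ (Or.inr rfl))
  -- Then `φ` is consistent with the quantifier-free type of `w`.
  have key2 : ∃ (M : ModelType.{0, 0, 0} T) (v : X → M),
      ∀ ψ ∈ {ψ : L.Formula X | BoundedFormula.IsQF ψ ∧ ψ.Realize w} ∪ {φ}, ψ.Realize v := by
    refine exists_realize_of_finitely_realizable T _ fun Γ₀ hΓ₀ => ?_
    by_contra hcon
    push Not at hcon
    obtain ⟨ψ, hψ, hr⟩ := hconj (Γ₀.filter fun ψ => BoundedFormula.IsQF ψ ∧ ψ.Realize w)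
      fun ψ hψ => (Finset.mem_filter.1 hψ).2.1
    have h1 : ψ.not ∈ Γ := by
      refine ⟨hψ.not, fun M v hφ => (Formula.realize_not).2 fun hv => ?_⟩
      obtain ⟨χ, hχ, hχv⟩ := hcon M v
      rcases hΓ₀ hχ with h1 | h1
      · exact hχv ((hr M v).1 hv χ (Finset.mem_filter.2 ⟨hχ, h1⟩))
      · rw [Set.mem_singleton_iff.1 h1] at hχv
        exact hχv hφ
    exact (Formula.realize_not).1 (hw _ (Or.inl h1))
      ((hr N w).2 fun χ hχ => (Finset.mem_filter.1 hχ).2.2)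
  obtain ⟨M, v, hv⟩ := key2
  refine hφw (h M N v w (fun ψ hψ => ⟨fun hψv => ?_, fun hψw => hv ψ (Or.inl ⟨hψ, hψw⟩)⟩)
    (hv φ (Or.inr rfl)))
  by_contra hψw
  exact (Formula.realize_not).1 (hv ψ.not (Or.inl ⟨hψ.not, (Formula.realize_not).2 hψw⟩)) hψv

/-- The one-point extension test for quantifier elimination. Existential quantifiers correspond to
the step from `v` to `(v, c)`; in the induction on formulas, universal quantifiers are treated by
exchanging the two models and negating the matrix. -/
theorem hasQE_of_forall_exists (T : L.Theory)
    (h : ∀ (X : Type) (M N : ModelType.{0, 0, 0} T) (v : X → M) (w : X → N),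
      (∀ ψ : L.Formula X, BoundedFormula.IsQF ψ → (ψ.Realize v ↔ ψ.Realize w)) →
        ∀ ψ : L.Formula (X ⊕ Unit), BoundedFormula.IsQF ψ →
          ∀ c : M, ψ.Realize (Sum.elim v fun _ => c) →
            ∃ d : N, ψ.Realize (Sum.elim w fun _ => d)) :
    HasQE T := by
  have main : ∀ (α : Type) (n : ℕ) (φ : L.BoundedFormula α n), ∃ ψ : L.Formula (α ⊕ Fin n),
      BoundedFormula.IsQF ψ ∧ ∀ (M : ModelType.{0, 0, 0} T) (v : α → M) (xs : Fin n → M),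
        φ.Realize v xs ↔ ψ.Realize (Sum.elim v xs) := by
    intro α n φ
    induction φ with
    | falsum => exact ⟨⊥, BoundedFormula.isQF_bot, fun M v xs => Iff.rfl⟩
    | equal t₁ t₂ =>
      refine ⟨t₁.equal t₂, (BoundedFormula.IsAtomic.equal _ _).isQF, fun M v xs => ?_⟩
      rw [Formula.realize_equal]
      exact BoundedFormula.realize_bdEqual _ _
    | rel R ts =>
      refine ⟨R.formula ts, (BoundedFormula.IsAtomic.rel _ _).isQF, fun M v xs => ?_⟩
      rw [Formula.realize_rel]
      exact Iff.rfl
    | imp φ₁ φ₂ ih₁ ih₂ =>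
      obtain ⟨ψ₁, hq₁, h₁⟩ := ih₁
      obtain ⟨ψ₂, hq₂, h₂⟩ := ih₂
      refine ⟨ψ₁.imp ψ₂, hq₁.imp hq₂, fun M v xs => ?_⟩
      rw [BoundedFormula.realize_imp, h₁, h₂, Formula.realize_imp]
    | @all n φ ih =>
      obtain ⟨ψ, hq, hψ⟩ := ih
      let g : α ⊕ Fin (n + 1) → (α ⊕ Fin n) ⊕ Unit :=
        Sum.elim (fun a => Sum.inl (Sum.inl a)) (Fin.snoc (α := fun _ => (α ⊕ Fin n) ⊕ Unit)
          (fun i => Sum.inl (Sum.inr i)) (Sum.inr ()))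
      have hψ' : ∀ (M : ModelType.{0, 0, 0} T) (v : α ⊕ Fin n → M) (c : M),
          (ψ.relabel g).Realize (Sum.elim v fun _ => c) ↔
            φ.Realize (v ∘ Sum.inl) (Fin.snoc (v ∘ Sum.inr) c) := by
        intro M v c
        rw [Formula.realize_relabel, hψ]
        have : (Sum.elim v fun _ => c) ∘ g =
            Sum.elim (v ∘ Sum.inl) (Fin.snoc (v ∘ Sum.inr) c : Fin (n + 1) → M) := by
          funext a
          rcases a with a | i
          · rfl
          · refine Fin.lastCases ?_ (fun i => ?_) i <;> simp [g]
        rw [this]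
      have hqg : BoundedFormula.IsQF (ψ.relabel g).not := by
        refine BoundedFormula.IsQF.not ?_
        exact BoundedFormula.IsQF.relabel (n := 0) hq _
      obtain ⟨χ, hχq, hχ⟩ := exists_isQF_iff_of_sameType T φ.all.toFormula
        (fun M N v w hvw hv => by
          rw [BoundedFormula.realize_toFormula, BoundedFormula.realize_all] at hv ⊢
          by_contra hcon
          push Not at hcon
          obtain ⟨d, hd⟩ := hcon
          obtain ⟨c, hc⟩ := h _ N M w v (fun ψ hψ => (hvw ψ hψ).symm) _ hqg d
            ((Formula.realize_not).2 fun h1 => hd ((hψ' N w d).1 h1))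
          exact (Formula.realize_not).1 hc ((hψ' M v c).2 (hv c)))
      refine ⟨χ, hχq, fun M v xs => ?_⟩
      rw [← hχ, BoundedFormula.realize_toFormula]
      rfl
  intro n φ
  obtain ⟨ψ, hq, hψ⟩ := main (Fin n) 0 φ
  let g : Fin n ⊕ Fin 0 → Fin n := Sum.elim id Fin.elim0
  refine ⟨ψ.relabel g, BoundedFormula.IsQF.relabel (n := 0) hq _, fun M v xs => ?_⟩
  rw [BoundedFormula.realize_iff, hψ]
  have h1 := Formula.realize_relabel (φ := ψ) (g := g) (v := v)
  rw [Formula.boundedFormula_realize_eq_realize, h1]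
  have : v ∘ g = Sum.elim v xs := by
    funext a
    rcases a with a | i
    · rfl
    · exact i.elim0
  rw [this]

end Criterion

end SqfQE

namespace SqfQE

open FirstOrder.Language

/-! ### Uniform definability -/

/-- An abelian group with a distinguished element `1`, a binary relation `<`, and subsets `U_{p,l}`
and `P_m`, with no conditions relating them. All four languages are interpreted in it; the
symbols absent from a language are ignored. -/
structure GroupData : Type 1 where
  G : Type
  [grp : AddCommGroup G]
  [one : One G]
  lt : G → G → Prop
  U : Nat.Primes → ℤ → Set G
  P : ℕ+ → Set G

attribute [instance] GroupData.grp GroupData.one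

/-- A language containing `L₀` that is interpreted in every `GroupData`. -/
class GroupLanguage (L : FirstOrder.Language.{0, 0}) where
  str : ∀ D : GroupData, L.Structure D.G
  hom : L0 →ᴸ L
  isExpansion : ∀ D : GroupData,
    @LHom.IsExpansionOn L0 L hom D.G groupStructure (str D)

instance : GroupLanguage L0 where
  str _ := groupStructure
  hom := LHom.id L0
  isExpansion _ := LHom.id_isExpansionOn _

instance : GroupLanguage L0lt where
  str D := structure0lt D.lt
  hom := LHom.sumInl
  isExpansion D := letI := ltStructure D.lt; LHom.sumInl_isExpansionOn D.G

instance : GroupLanguage L1star where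
  str D := structure1 D.U D.P
  hom := LHom.sumInl
  isExpansion D := letI := predStructure D.U D.P; LHom.sumInl_isExpansionOn D.G

instance : GroupLanguage L2star where
  str D := structure2 D.lt D.U D.P
  hom := LHom.comp LHom.sumInl LHom.sumInl
  isExpansion D :=
    letI := structure2 D.lt D.U D.P
    ⟨fun _ _ => rfl, fun r _ => r.elim⟩

/-- A language containing `L₁*` that is interpreted in every `GroupData`. -/
class PredLanguage (L : FirstOrder.Language.{0, 0}) extends GroupLanguage L where
  predHom : L1star →ᴸ L
  predIsExpansion : ∀ D : GroupData,
    @LHom.IsExpansionOn L1star L predHom D.G (structure1 D.U D.P) (str D)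

instance : PredLanguage L1star where
  predHom := LHom.id L1star
  predIsExpansion D := letI := structure1 D.U D.P; LHom.id_isExpansionOn D.G

instance : PredLanguage L2star where
  predHom := LHom.sumInl
  predIsExpansion D :=
    letI := structure1 D.U D.P
    letI := ltStructure D.lt
    LHom.sumInl_isExpansionOn D.G

/-- A language containing `<` that is interpreted in every `GroupData`. -/
class LtLanguage (L : FirstOrder.Language.{0, 0}) extends GroupLanguage L where
  ltSymbol : L.Relations 2
  relMap_ltSymbol : ∀ (D : GroupData) (x : Fin 2 → D.G),
    (str D).RelMap ltSymbol x ↔ D.lt (x 0) (x 1)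

instance : LtLanguage L0lt where
  ltSymbol := Sum.inr LtRel.lt
  relMap_ltSymbol _ _ := Iff.rfl

instance : LtLanguage L2star where
  ltSymbol := Sum.inr LtRel.lt
  relMap_ltSymbol _ _ := Iff.rfl

section Definability

variable (L : FirstOrder.Language.{0, 0}) [GroupLanguage L] {X : Type}

/-- Truth of a formula in the structure given by a `GroupData`. -/
def GroupData.Sat (D : GroupData) {L : FirstOrder.Language.{0, 0}} [GroupLanguage L]
    (φ : L.Formula X) (v : X → D.G) : Prop :=
  let := GroupLanguage.str (L := L) D
  φ.Realize v

/-- Value of a term in the structure given by a `GroupData`. -/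
def GroupData.value (D : GroupData) {L : FirstOrder.Language.{0, 0}} [GroupLanguage L]
    (t : L.Term X) (v : X → D.G) : D.G :=
  let := GroupLanguage.str (L := L) D
  t.realize v

/-- The function `f` is given by one term in all `GroupData`. -/
def TermDef (f : ∀ D : GroupData, (X → D.G) → D.G) : Prop :=
  ∃ t : L.Term X, ∀ D v, D.value t v = f D v

/-- The relation `R` is given by one formula in all `GroupData`. -/
def Def (R : ∀ D : GroupData, (X → D.G) → Prop) : Prop :=
  ∃ φ : L.Formula X, ∀ D v, D.Sat φ v ↔ R D v

/-- The relation `R` is given by one quantifier-free formula in all `GroupData`. -/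
def QFDef (R : ∀ D : GroupData, (X → D.G) → Prop) : Prop :=
  ∃ φ : L.Formula X, BoundedFormula.IsQF φ ∧ ∀ D v, D.Sat φ v ↔ R D v

variable {L}

namespace TermDef

theorem var (x : X) : TermDef L fun _ v => v x :=
  ⟨Term.var x, fun _ _ => rfl⟩

theorem zero : TermDef L (X := X) fun _ _ => 0 := by
  refine ⟨Term.func (GroupLanguage.hom.onFunction GroupFunc.zero) Fin.elim0, fun D v => ?_⟩
  let := GroupLanguage.str (L := L) D
  have := GroupLanguage.isExpansion (L := L) D
  exact LHom.map_onFunction (GroupLanguage.hom (L := L)) (M := D.G) GroupFunc.zero _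

theorem one : TermDef L (X := X) fun _ _ => 1 := by
  refine ⟨Term.func (GroupLanguage.hom.onFunction GroupFunc.one) Fin.elim0, fun D v => ?_⟩
  let := GroupLanguage.str (L := L) D
  have := GroupLanguage.isExpansion (L := L) D
  exact LHom.map_onFunction (GroupLanguage.hom (L := L)) (M := D.G) GroupFunc.one _

variable {f g : ∀ D : GroupData, (X → D.G) → D.G}

theorem neg (hf : TermDef L f) : TermDef L fun D v => -f D v := by
  obtain ⟨t, ht⟩ := hf
  refine ⟨Functions.apply₁ (GroupLanguage.hom.onFunction GroupFunc.neg) t, fun D v => ?_⟩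
  let := GroupLanguage.str (L := L) D
  have := GroupLanguage.isExpansion (L := L) D
  beta_reduce
  rw [← ht]
  refine (Term.realize_functions_apply₁).trans ?_
  exact LHom.map_onFunction (GroupLanguage.hom (L := L)) (M := D.G) GroupFunc.neg _

theorem add (hf : TermDef L f) (hg : TermDef L g) : TermDef L fun D v => f D v + g D v := by
  obtain ⟨t, ht⟩ := hf
  obtain ⟨s, hs⟩ := hg
  refine ⟨Functions.apply₂ (GroupLanguage.hom.onFunction GroupFunc.add) t s, fun D v => ?_⟩
  let := GroupLanguage.str (L := L) D
  have := GroupLanguage.isExpansion (L := L) D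
  beta_reduce
  rw [← ht, ← hs]
  refine (Term.realize_functions_apply₂).trans ?_
  exact LHom.map_onFunction (GroupLanguage.hom (L := L)) (M := D.G) GroupFunc.add _

theorem nsmul (n : ℕ) (hf : TermDef L f) : TermDef L fun D v => n • f D v := by
  induction n with
  | zero => simpa only [zero_nsmul] using zero
  | succ n ih => simpa only [succ_nsmul] using ih.add hf

theorem zsmul (n : ℤ) (hf : TermDef L f) : TermDef L fun D v => n • f D v := by
  cases n with
  | ofNat n => simpa only [Int.ofNat_eq_natCast, natCast_zsmul] using hf.nsmul n
  | negSucc n => simpa only [negSucc_zsmul] using (hf.nsmul (n + 1)).neg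

end TermDef

theorem QFDef.def {R : ∀ D : GroupData, (X → D.G) → Prop} (h : QFDef L R) : Def L R := by
  obtain ⟨φ, -, h⟩ := h
  exact ⟨φ, h⟩

theorem QFDef.eq {f g : ∀ D : GroupData, (X → D.G) → D.G} (hf : TermDef L f) (hg : TermDef L g) :
    QFDef L fun D v => f D v = g D v := by
  obtain ⟨t, ht⟩ := hf
  obtain ⟨s, hs⟩ := hg
  refine ⟨t.equal s, (BoundedFormula.IsAtomic.equal _ _).isQF, fun D v => ?_⟩
  let := GroupLanguage.str (L := L) D
  beta_reduce
  rw [← ht, ← hs]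
  exact Formula.realize_equal

theorem QFDef.lt {L : FirstOrder.Language.{0, 0}} [LtLanguage L]
    {f g : ∀ D : GroupData, (X → D.G) → D.G} (hf : TermDef L f) (hg : TermDef L g) :
    QFDef L fun D v => D.lt (f D v) (g D v) := by
  obtain ⟨t, ht⟩ := hf
  obtain ⟨s, hs⟩ := hg
  refine ⟨(LtLanguage.ltSymbol (L := L)).formula₂ t s,
    (BoundedFormula.IsAtomic.rel _ _).isQF, fun D v => ?_⟩
  let := GroupLanguage.str (L := L) D
  beta_reduce
  rw [← ht, ← hs]
  exact (Formula.realize_rel₂).trans (LtLanguage.relMap_ltSymbol D _)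

section Pred

variable {L : FirstOrder.Language.{0, 0}} [PredLanguage L]
  {f : ∀ D : GroupData, (X → D.G) → D.G}

theorem QFDef.pred (r : L1star.Relations 1) (hf : TermDef L f) :
    QFDef L fun D v => (structure1 D.U D.P).RelMap r ![f D v] := by
  obtain ⟨t, ht⟩ := hf
  refine ⟨((PredLanguage.predHom (L := L)).onRelation r).formula₁ t,
    (BoundedFormula.IsAtomic.rel _ _).isQF, fun D v => ?_⟩
  let := structure1 D.U D.P
  let := GroupLanguage.str (L := L) D
  have := PredLanguage.predIsExpansion (L := L) D
  beta_reduce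
  rw [← ht]
  refine (Formula.realize_rel₁).trans ?_
  rw [LHom.map_onRelation]
  rfl

theorem QFDef.memU (p : Nat.Primes) (l : ℤ) (hf : TermDef L f) :
    QFDef L fun D v => f D v ∈ D.U p l :=
  QFDef.pred (Sum.inr (PredRel.U p l)) hf

theorem QFDef.memP (m : ℕ+) (hf : TermDef L f) :
    QFDef L fun D v => f D v ∈ D.P m :=
  QFDef.pred (Sum.inr (PredRel.P m)) hf

end Pred

namespace Def

variable {R S : ∀ D : GroupData, (X → D.G) → Prop}

theorem congr (hR : Def L R) (h : ∀ D v, R D v ↔ S D v) : Def L S := by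
  obtain ⟨φ, hφ⟩ := hR
  exact ⟨φ, fun D v => (hφ D v).trans (h D v)⟩

theorem false : Def L (X := X) fun _ _ => False :=
  ⟨⊥, fun _ _ => Iff.rfl⟩

theorem imp (hR : Def L R) (hS : Def L S) : Def L fun D v => R D v → S D v := by
  obtain ⟨φ, hφ⟩ := hR
  obtain ⟨ψ, hψ⟩ := hS
  refine ⟨φ.imp ψ, fun D v => ?_⟩
  beta_reduce
  rw [← hφ, ← hψ]
  exact Iff.rfl

theorem not (hR : Def L R) : Def L fun D v => ¬R D v :=
  hR.imp false

theorem and (hR : Def L R) (hS : Def L S) : Def L fun D v => R D v ∧ S D v :=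
  (hR.imp hS.not).not.congr fun _ _ => by tauto

theorem iff (hR : Def L R) (hS : Def L S) : Def L fun D v => (R D v ↔ S D v) :=
  ((hR.imp hS).and (hS.imp hR)).congr fun _ _ => iff_def.symm

theorem forall_finite {κ : Type} [Finite κ] {R : κ → ∀ D : GroupData, (X → D.G) → Prop}
    (hR : ∀ k, Def L (R k)) : Def L fun D v => ∀ k, R k D v := by
  choose φ hφ using hR
  refine ⟨Formula.iInf φ, fun D v => ?_⟩
  let := GroupLanguage.str (L := L) D
  exact (Formula.realize_iInf).trans (forall_congr' fun k => hφ k D v)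

theorem exists_finite {κ : Type} [Finite κ] {R : κ → ∀ D : GroupData, (X → D.G) → Prop}
    (hR : ∀ k, Def L (R k)) : Def L fun D v => ∃ k, R k D v :=
  (forall_finite fun k => (hR k).not).not.congr fun _ _ => by push Not; rfl

theorem forall_tuple {β : Type} [Finite β] {R : ∀ D : GroupData, (X → D.G) → (β → D.G) → Prop}
    (hR : Def L (X := X ⊕ β) fun D v => R D (v ∘ Sum.inl) (v ∘ Sum.inr)) :
    Def L fun D v => ∀ w, R D v w := by
  obtain ⟨φ, hφ⟩ := hR
  refine ⟨φ.iAlls β, fun D v => ?_⟩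
  let := GroupLanguage.str (L := L) D
  refine (Formula.realize_iAlls).trans (forall_congr' fun w => ?_)
  exact hφ D (Sum.elim v w)

theorem all {R : ∀ D : GroupData, (X → D.G) → D.G → Prop}
    (hR : Def L (X := X ⊕ Unit) fun D v => R D (v ∘ Sum.inl) (v (Sum.inr ()))) :
    Def L fun D v => ∀ a, R D v a := by
  refine (forall_tuple (β := Unit) (R := fun D v w => R D v (w ())) hR).congr fun D v => ?_
  exact ⟨fun h a => h fun _ => a, fun h w => h (w ())⟩

theorem ex {R : ∀ D : GroupData, (X → D.G) → D.G → Prop}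
    (hR : Def L (X := X ⊕ Unit) fun D v => R D (v ∘ Sum.inl) (v (Sum.inr ()))) :
    Def L fun D v => ∃ a, R D v a :=
  (all (R := fun D v a => ¬R D v a) hR.not).not.congr fun _ _ => by push Not; rfl

theorem eq {f g : ∀ D : GroupData, (X → D.G) → D.G} (hf : TermDef L f) (hg : TermDef L g) :
    Def L fun D v => f D v = g D v :=
  (QFDef.eq hf hg).def

/-- Formulas of `L₁*` may be used in every language containing `L₁*`, after a substitution of
variables. -/
theorem of_formula {L : FirstOrder.Language.{0, 0}} [PredLanguage L] {Y : Type}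
    (φ : L1star.Formula Y) (g : Y → X) : Def L fun D v => D.Sat φ (v ∘ g) := by
  refine ⟨((PredLanguage.predHom (L := L)).onFormula φ).relabel g, fun D v => ?_⟩
  let := structure1 D.U D.P
  let := GroupLanguage.str (L := L) D
  have := PredLanguage.predIsExpansion (L := L) D
  exact (Formula.realize_relabel).trans (LHom.realize_onFormula _ _)

end Def

variable (L) in
/-- The property `Φ` of `GroupData` is given by a set of sentences. -/
def Elementary (Φ : GroupData → Prop) : Prop :=
  ∃ T : L.Theory, ∀ D : GroupData, (letI := GroupLanguage.str (L := L) D; D.G ⊨ T) ↔ Φ D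

namespace Elementary

theorem of_def {Φ : GroupData → Prop} (h : Def L (X := Empty) fun D _ => Φ D) :
    Elementary L Φ := by
  obtain ⟨φ, hφ⟩ := h
  refine ⟨{φ}, fun D => ?_⟩
  let := GroupLanguage.str (L := L) D
  exact Theory.model_singleton_iff.trans (hφ D default)

theorem congr {Φ Ψ : GroupData → Prop} (h : Elementary L Φ) (hΨ : ∀ D, Φ D ↔ Ψ D) :
    Elementary L Ψ := by
  obtain ⟨T, hT⟩ := h
  exact ⟨T, fun D => (hT D).trans (hΨ D)⟩

theorem and {Φ Ψ : GroupData → Prop} (h : Elementary L Φ) (h' : Elementary L Ψ) :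
    Elementary L fun D => Φ D ∧ Ψ D := by
  obtain ⟨T, hT⟩ := h
  obtain ⟨T', hT'⟩ := h'
  refine ⟨T ∪ T', fun D => ?_⟩
  let := GroupLanguage.str (L := L) D
  beta_reduce
  rw [← hT, ← hT']
  exact Theory.model_union_iff

theorem forall_index {κ : Type*} {Φ : κ → GroupData → Prop} (h : ∀ k, Elementary L (Φ k)) :
    Elementary L fun D => ∀ k, Φ k D := by
  choose T hT using h
  refine ⟨⋃ k, T k, fun D => ?_⟩
  let := GroupLanguage.str (L := L) D
  simp only [← hT, Theory.model_iff, Set.mem_iUnion]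
  exact ⟨fun h k φ hφ => h φ ⟨k, hφ⟩, fun h φ ⟨k, hφ⟩ => h k φ hφ⟩

end Elementary

end Definability

section PConditions

variable {X : Type}

/-- The relation `R` is given by one `p`-condition in all `GroupData`. -/
def PDef (p : Nat.Primes) (R : ∀ D : GroupData, (X → D.G) → Prop) : Prop :=
  ∃ φ : L1star.Formula X, IsPCondition p φ ∧ ∀ D v, D.Sat φ v ↔ R D v

namespace PDef

variable {p : Nat.Primes} {R S : ∀ D : GroupData, (X → D.G) → Prop}

theorem congr (hR : PDef p R) (h : ∀ D v, R D v ↔ S D v) : PDef p S := by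
  obtain ⟨φ, hp, hφ⟩ := hR
  exact ⟨φ, hp, fun D v => (hφ D v).trans (h D v)⟩

theorem memU {f : ∀ D : GroupData, (X → D.G) → D.G} (hf : TermDef L1star f) (l : ℤ) :
    PDef p fun D v => f D v ∈ D.U p l := by
  obtain ⟨t, ht⟩ := hf
  refine ⟨SqfQE.memU p l t, IsPCondition.mem t l, fun D v => ?_⟩
  let := structure1 D.U D.P
  beta_reduce
  rw [← ht]
  exact Formula.realize_rel₁

theorem false : PDef p (X := X) fun _ _ => False :=
  ⟨⊥, IsPCondition.falsum, fun _ _ => Iff.rfl⟩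

theorem imp (hR : PDef p R) (hS : PDef p S) : PDef p fun D v => R D v → S D v := by
  obtain ⟨φ, hp, hφ⟩ := hR
  obtain ⟨ψ, hq, hψ⟩ := hS
  refine ⟨φ.imp ψ, hp.imp hq, fun D v => ?_⟩
  beta_reduce
  rw [← hφ, ← hψ]
  exact Iff.rfl

theorem not (hR : PDef p R) : PDef p fun D v => ¬R D v :=
  hR.imp false

theorem and (hR : PDef p R) (hS : PDef p S) : PDef p fun D v => R D v ∧ S D v :=
  (hR.imp hS.not).not.congr fun _ _ => by tauto

theorem true : PDef p (X := X) fun _ _ => True :=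
  false.not.congr fun _ _ => by tauto

theorem forall_mem {κ : Type} (s : Finset κ) {R : κ → ∀ D : GroupData, (X → D.G) → Prop}
    (hR : ∀ k ∈ s, PDef p (R k)) : PDef p fun D v => ∀ k ∈ s, R k D v := by
  classical
  induction s using Finset.induction_on with
  | empty => exact true.congr fun _ _ => by simp
  | insert a s ha ih =>
    exact ((hR a (Finset.mem_insert_self _ _)).and
      (ih fun k hk => hR k (Finset.mem_insert_of_mem hk))).congr fun _ _ => by simp

end PDef

end PConditions

/-! ### Linear forms and atoms -/

section Forms

/-- Integral linear forms in the variables `X`, with a constant term; `none` stands for `1`. -/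
abbrev Form (X : Type) : Type := FreeAbelianGroup (Option X)

/-- Value of a linear form. -/
noncomputable def GroupData.eval (D : GroupData) {X : Type} (v : X → D.G) : Form X →+ D.G :=
  FreeAbelianGroup.lift fun o => o.elim 1 v

@[simp]
theorem GroupData.eval_none (D : GroupData) {X : Type} (v : X → D.G) :
    D.eval v (FreeAbelianGroup.of none) = 1 := by
  simp [GroupData.eval]

@[simp]
theorem GroupData.eval_some (D : GroupData) {X : Type} (v : X → D.G) (x : X) :
    D.eval v (FreeAbelianGroup.of (some x)) = v x := by
  simp [GroupData.eval]

/-- Substitution of linear forms for the variables of a linear form. -/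
noncomputable def Form.subst {X Y : Type} (σ : Y → Form X) : Form Y →+ Form X :=
  FreeAbelianGroup.lift fun o => o.elim (FreeAbelianGroup.of none) σ

theorem GroupData.eval_subst (D : GroupData) {X Y : Type} (σ : Y → Form X) (v : X → D.G)
    (w : Form Y) : D.eval v (Form.subst σ w) = D.eval (fun y => D.eval v (σ y)) w := by
  have : (D.eval v).comp (Form.subst σ) = D.eval (fun y => D.eval v (σ y)) := by
    ext o
    cases o <;> simp [Form.subst]
  exact DFunLike.congr_fun this w

/-- Coefficient of the last variable in a linear form. -/
noncomputable def Form.coeff {X : Type} : Form (X ⊕ Unit) →+ ℤ :=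
  FreeAbelianGroup.lift fun o => o.elim 0 (Sum.elim (fun _ => 0) fun _ => 1)

/-- The part of a linear form that does not involve the last variable. -/
noncomputable def Form.rest {X : Type} : Form (X ⊕ Unit) →+ Form X :=
  FreeAbelianGroup.lift fun o => o.elim (FreeAbelianGroup.of none)
    (Sum.elim (fun x => FreeAbelianGroup.of (some x)) fun _ => 0)

theorem GroupData.eval_elim (D : GroupData) {X : Type} (v : X → D.G) (c : D.G)
    (w : Form (X ⊕ Unit)) : D.eval (Sum.elim v fun _ => c) w =
      Form.coeff w • c + D.eval v (Form.rest w) := by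
  have : D.eval (Sum.elim v fun _ => c) =
      (zmultiplesHom D.G c).comp Form.coeff
        + (D.eval v).comp Form.rest := by
    ext o
    rcases o with _ | x | x <;> simp [Form.coeff, Form.rest]
  rw [this]
  simp

theorem TermDef.eval {L : FirstOrder.Language.{0, 0}} [GroupLanguage L] {X : Type} (w : Form X) :
    TermDef L fun D v => D.eval v w := by
  induction w using FreeAbelianGroup.induction_on with
  | zero => simpa using TermDef.zero
  | of o =>
    cases o with
    | none => simpa using TermDef.one
    | some x => simpa using TermDef.var x
  | neg o h => simpa using h.neg
  | add a b ha hb => simpa using ha.add hb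

/-- Atomic conditions on the values of linear forms. -/
inductive Atom (X : Type) : Type
  | eq (w : Form X)
  | memU (p : Nat.Primes) (l : ℤ) (w : Form X)
  | memP (m : ℕ+) (w : Form X)
  | lt (w w' : Form X)

/-- Truth of an atomic condition. -/
def Atom.Holds {X : Type} (D : GroupData) (v : X → D.G) : Atom X → Prop
  | eq w => D.eval v w = 0
  | memU p l w => D.eval v w ∈ D.U p l
  | memP m w => D.eval v w ∈ D.P m
  | lt w w' => D.lt (D.eval v w) (D.eval v w')

/-- Substitution of linear forms for the variables of an atomic condition. -/
noncomputable def Atom.subst {X Y : Type} (σ : Y → Form X) : Atom Y → Atom X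
  | eq w => eq (Form.subst σ w)
  | memU p l w => memU p l (Form.subst σ w)
  | memP m w => memP m (Form.subst σ w)
  | lt w w' => lt (Form.subst σ w) (Form.subst σ w')

theorem Atom.holds_subst {X Y : Type} (σ : Y → Form X) (D : GroupData) (v : X → D.G)
    (A : Atom Y) : (A.subst σ).Holds D v ↔ A.Holds D fun y => D.eval v (σ y) := by
  cases A <;> simp [Atom.subst, Atom.Holds, GroupData.eval_subst]

/-- A language all of whose terms are linear forms and all of whose relation symbols are atomic
conditions. -/
class LinearLanguage (L : FirstOrder.Language.{0, 0}) extends GroupLanguage L where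
  exists_form : ∀ {n : ℕ} (f : L.Functions n), ∃ w : Form (Fin n),
    ∀ (D : GroupData) (x : Fin n → D.G), (str D).funMap f x = D.eval x w
  exists_atom : ∀ {n : ℕ} (r : L.Relations n), ∃ A : Atom (Fin n),
    ∀ (D : GroupData) (x : Fin n → D.G), (str D).RelMap r x ↔ A.Holds D x

theorem exists_form_L0 {n : ℕ} (f : L0.Functions n) : ∃ w : Form (Fin n),
    ∀ (D : GroupData) (x : Fin n → D.G), groupStructure.funMap f x = D.eval x w := by
  cases f with
  | zero => exact ⟨0, fun D x => by simp; rfl⟩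
  | one => exact ⟨FreeAbelianGroup.of none, fun D x => by simp; rfl⟩
  | neg => exact ⟨-FreeAbelianGroup.of (some 0), fun D x => by simp; rfl⟩
  | add =>
    exact ⟨FreeAbelianGroup.of (some 0) + FreeAbelianGroup.of (some 1), fun D x => by simp; rfl⟩

theorem exists_atom_LPred {n : ℕ} (r : LPred.Relations n) : ∃ A : Atom (Fin n),
    ∀ (D : GroupData) (x : Fin n → D.G), (predStructure D.U D.P).RelMap r x ↔ A.Holds D x := by
  cases r with
  | U p l =>
    exact ⟨Atom.memU p l (FreeAbelianGroup.of (some 0)), fun D x => by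
      simp only [Atom.Holds, GroupData.eval_some]; rfl⟩
  | P m =>
    exact ⟨Atom.memP m (FreeAbelianGroup.of (some 0)), fun D x => by
      simp only [Atom.Holds, GroupData.eval_some]; rfl⟩

instance : LinearLanguage L1star where
  exists_form {_} f := match f with
    | Sum.inl f => exists_form_L0 f
    | Sum.inr f => f.elim
  exists_atom {_} r := match r with
    | Sum.inl r => r.elim
    | Sum.inr r => exists_atom_LPred r

instance : LinearLanguage L2star where
  exists_form {_} f := match f with
    | Sum.inl (Sum.inl f) => exists_form_L0 f
    | Sum.inl (Sum.inr f) => f.elim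
    | Sum.inr f => f.elim
  exists_atom {_} r := match r with
    | Sum.inl (Sum.inl r) => r.elim
    | Sum.inl (Sum.inr r) => exists_atom_LPred r
    | Sum.inr LtRel.lt =>
      ⟨Atom.lt (FreeAbelianGroup.of (some 0)) (FreeAbelianGroup.of (some 1)), fun D x => by
        simp only [Atom.Holds, GroupData.eval_some]; rfl⟩

variable {L : FirstOrder.Language.{0, 0}} [LinearLanguage L] {X : Type}

theorem exists_form_of_term (t : L.Term X) : ∃ w : Form X,
    ∀ (D : GroupData) (v : X → D.G), D.value t v = D.eval v w := by
  induction t with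
  | var x => exact ⟨FreeAbelianGroup.of (some x), fun D v => by simp; rfl⟩
  | func f ts ih =>
    choose σ hσ using ih
    obtain ⟨w, hw⟩ := LinearLanguage.exists_form f
    refine ⟨Form.subst σ w, fun D v => ?_⟩
    rw [D.eval_subst]
    simp only [← hσ]
    exact hw D _

/-- The truth of a quantifier-free formula depends on finitely many atomic conditions. -/
theorem exists_finset_atoms {n : ℕ} (φ : L.BoundedFormula X n) (hφ : BoundedFormula.IsQF φ) :
    ∃ s : Finset (Atom (X ⊕ Fin n)), ∀ (D D' : GroupData) (v : X ⊕ Fin n → D.G)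
      (v' : X ⊕ Fin n → D'.G), (∀ A ∈ s, A.Holds D v ↔ A.Holds D' v') →
      ((letI := GroupLanguage.str (L := L) D; φ.Realize (v ∘ Sum.inl) (v ∘ Sum.inr)) ↔
      (letI := GroupLanguage.str (L := L) D'; φ.Realize (v' ∘ Sum.inl) (v' ∘ Sum.inr))) := by
  classical
  induction hφ with
  | falsum => exact ⟨∅, fun D D' v v' _ => Iff.rfl⟩
  | of_isAtomic h =>
    cases h with
    | equal t₁ t₂ =>
      obtain ⟨w₁, h₁⟩ := exists_form_of_term t₁
      obtain ⟨w₂, h₂⟩ := exists_form_of_term t₂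
      refine ⟨{Atom.eq (w₁ - w₂)}, fun D D' v v' hs => ?_⟩
      have h3 := hs _ (Finset.mem_singleton_self _)
      simp only [Atom.Holds, map_sub, sub_eq_zero, ← h₁, ← h₂] at h3
      have e : ∀ (D : GroupData) (v : X ⊕ Fin n → D.G),
          (letI := GroupLanguage.str (L := L) D;
            (t₁.bdEqual t₂).Realize (v ∘ Sum.inl) (v ∘ Sum.inr)) ↔
          D.value t₁ v = D.value t₂ v := by
        intro D v
        let := GroupLanguage.str (L := L) D
        rw [BoundedFormula.realize_bdEqual, Sum.elim_comp_inl_inr]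
        rfl
      rw [e, e]
      exact h3
    | rel r ts =>
      obtain ⟨A, hA⟩ := LinearLanguage.exists_atom r
      choose σ hσ using fun i => exists_form_of_term (ts i)
      refine ⟨{A.subst σ}, fun D D' v v' hs => ?_⟩
      have h3 := hs _ (Finset.mem_singleton_self _)
      rw [Atom.holds_subst, Atom.holds_subst, ← hA, ← hA] at h3
      simp only [← hσ] at h3
      have e : ∀ (D : GroupData) (v : X ⊕ Fin n → D.G),
          (letI := GroupLanguage.str (L := L) D;
            (r.boundedFormula ts).Realize (v ∘ Sum.inl) (v ∘ Sum.inr)) ↔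
          (GroupLanguage.str D).RelMap r (fun i => D.value (ts i) v) := by
        intro D v
        let := GroupLanguage.str (L := L) D
        rw [BoundedFormula.realize_rel, Sum.elim_comp_inl_inr]
        rfl
      rw [e, e]
      exact h3
  | imp _ _ ih₁ ih₂ =>
    obtain ⟨s₁, h₁⟩ := ih₁
    obtain ⟨s₂, h₂⟩ := ih₂
    refine ⟨s₁ ∪ s₂, fun D D' v v' hs => ?_⟩
    have e₁ := h₁ D D' v v' fun A hA => hs A (Finset.mem_union_left _ hA)
    have e₂ := h₂ D D' v v' fun A hA => hs A (Finset.mem_union_right _ hA)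
    exact imp_congr e₁ e₂

end Forms

end SqfQE

namespace SqfQE

open FirstOrder.Language

/-! ### First-order consequences of the elementary equivalences -/

section Transfer

/-- A property of `GroupData` that one sentence defines is invariant under elementary equivalence.
-/
theorem Def.iff_of_elementarilyEquivalent {L : FirstOrder.Language.{0, 0}} [GroupLanguage L]
    {Φ : GroupData → Prop} (h : Def L (X := Empty) fun D _ => Φ D) (D D' : GroupData)
    (e : @ElementarilyEquivalent L D.G D'.G (GroupLanguage.str D) (GroupLanguage.str D')) :
    Φ D ↔ Φ D' := by
  obtain ⟨φ, hφ⟩ := h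
  beta_reduce at hφ
  rw [← hφ D default, ← hφ D' default]
  let := GroupLanguage.str (L := L) D
  let := GroupLanguage.str (L := L) D'
  exact e.realize_sentence φ

/-- A group with empty relations. -/
@[reducible] def GroupData.ofGroup (G : Type) [AddCommGroup G] [One G] : GroupData :=
  ⟨G, fun _ _ => False, fun _ _ => ∅, fun _ => ∅⟩

variable {G : Type} [AddCommGroup G] [One G]

theorem Def.iff_of_equiv {Φ : GroupData → Prop} (h : Def L0 (X := Empty) fun D _ => Φ D)
    {G' : Type} [AddCommGroup G'] [One G'] (e : L0.ElementarilyEquivalent G G') :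
    Φ (GroupData.ofGroup G) ↔ Φ (GroupData.ofGroup G') :=
  Def.iff_of_elementarilyEquivalent h (GroupData.ofGroup G) (GroupData.ofGroup G') e

theorem def_torsionFree (n : ℕ) :
    Def L0 (X := Empty) fun D _ => ∀ x : D.G, n • x = 0 → x = 0 :=
  Def.all ((Def.eq ((TermDef.var _).nsmul n) TermDef.zero).imp
    (Def.eq (TermDef.var _) TermDef.zero))

theorem def_divMod (n : ℕ) :
    Def L0 (X := Empty) fun D _ => ∀ x : D.G, ∃ y : D.G, ∃ j : Fin n,
      x = n • y + (j : ℕ) • (1 : D.G) := by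
  refine Def.all (R := fun D _ x => ∃ y : D.G, ∃ j : Fin n,
      x = n • y + (j : ℕ) • (1 : D.G)) (Def.ex (R := fun D v y => ∃ j : Fin n,
      v (Sum.inr ()) = n • y + (j : ℕ) • (1 : D.G)) (Def.exists_finite fun j => ?_))
  exact Def.eq (TermDef.var (Sum.inl (Sum.inr ())))
    (((TermDef.var _).nsmul n).add (TermDef.one.nsmul j))

theorem def_one_notMem (n : ℕ) :
    Def L0 (X := Empty) fun D _ => ∀ x : D.G, n • x ≠ (1 : D.G) :=
  Def.all (Def.not (Def.eq ((TermDef.var _).nsmul n) TermDef.one))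

theorem def_divisible (n : ℕ) :
    Def L0 (X := Empty) fun D _ => ∀ x : D.G, ∃ y : D.G, x = n • y :=
  Def.all (R := fun D _ x => ∃ y : D.G, x = n • y)
    (Def.ex (R := fun _ v y => v (Sum.inr ()) = n • y)
      (Def.eq (TermDef.var (Sum.inl (Sum.inr ()))) ((TermDef.var _).nsmul n)))

theorem torsionFree_of_equiv_int (e : L0.ElementarilyEquivalent G ℤ) (n : ℕ) (hn : n ≠ 0) (x : G)
    (hx : n • x = 0) : x = 0 :=
  (Def.iff_of_equiv (def_torsionFree n) e).2
    (fun y hy => by simpa [hn] using (smul_eq_zero.1 hy)) x hx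

theorem divMod_of_equiv_int (e : L0.ElementarilyEquivalent G ℤ) (n : ℕ) (hn : 0 < n) (x : G) :
    ∃ y : G, ∃ j : ℕ, x = n • y + j • (1 : G) := by
  obtain ⟨y, j, h⟩ := (Def.iff_of_equiv (def_divMod n) e).2 (fun (y : ℤ) => by
    have h0 : (0 : ℤ) < n := by exact_mod_cast hn
    refine ⟨y / n, ⟨(y % n).toNat, ?_⟩, ?_⟩
    · have := Int.emod_lt_of_pos y h0
      omega
    · have h1 := Int.emod_nonneg y h0.ne'
      have h2 := Int.mul_ediv_add_emod y n
      simp only [nsmul_eq_mul, mul_one]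
      rw [Int.toNat_of_nonneg h1]
      exact h2.symm) x
  exact ⟨y, j, h⟩

theorem smul_ne_one_of_equiv_int (e : L0.ElementarilyEquivalent G ℤ) (n : ℕ) (hn : 1 < n) (x : G) :
    n • x ≠ 1 :=
  (Def.iff_of_equiv (def_one_notMem n) e).2
    (fun (y : ℤ) (hy : n • y = 1) => by
      rw [nsmul_eq_mul] at hy
      have := Int.eq_one_or_neg_one_of_mul_eq_one hy
      omega) x

theorem torsionFree_of_equiv_rat (e : L0.ElementarilyEquivalent G ℚ) (n : ℕ) (hn : n ≠ 0) (x : G)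
    (hx : n • x = 0) : x = 0 :=
  (Def.iff_of_equiv (def_torsionFree n) e).2
    (fun y hy => by simpa [hn] using (smul_eq_zero.1 hy)) x hx

theorem divisible_of_equiv_rat (e : L0.ElementarilyEquivalent G ℚ) (n : ℕ) (hn : n ≠ 0) (x : G) :
    ∃ y : G, x = n • y :=
  (Def.iff_of_equiv (def_divisible n) e).2
    (fun (y : ℚ) => ⟨y / n, by
      rw [nsmul_eq_mul]; field_simp⟩) x

end Transfer

/-! ### Valuation predicates -/

section Regular

/-- The properties of the predicates `U_{p,l}` common to the two kinds of models: in a torsion-free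
group, `U_{p,l}` behaves like the set of elements of `p`-adic valuation at least `l`. -/
structure IsValued (D : GroupData) : Prop where
  torsionFree : ∀ (n : ℕ) (x : D.G), n ≠ 0 → n • x = 0 → x = 0
  zero_mem : ∀ p l, (0 : D.G) ∈ D.U p l
  add_mem : ∀ p l (x y : D.G), x ∈ D.U p l → y ∈ D.U p l → x + y ∈ D.U p l
  neg_mem : ∀ p l (x : D.G), x ∈ D.U p l → -x ∈ D.U p l
  succ_subset : ∀ p l (x : D.G), x ∈ D.U p (l + 1) → x ∈ D.U p l
  smul_self : ∀ (p : Nat.Primes) l (x : D.G), (p : ℕ) • x ∈ D.U p (l + 1) ↔ x ∈ D.U p l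
  smul_ne : ∀ (p q : Nat.Primes) l (x : D.G), p ≠ q → ((q : ℕ) • x ∈ D.U p l ↔ x ∈ D.U p l)
  exists_smul : ∀ (p : Nat.Primes) l (x : D.G), 0 < l → x ∈ D.U p l → ∃ y : D.G, x = (p : ℕ) • y

/-- The properties of the predicates `P_m` common to the two kinds of models. The last one allows
to replace `m` by any multiple of `m`. -/
structure IsRegular (D : GroupData) : Prop extends IsValued D where
  neg_mem_P : ∀ m (x : D.G), -x ∈ D.P m ↔ x ∈ D.P m
  smul_mem_P : ∀ (p : Nat.Primes) (m : ℕ+) (x : D.G), (p : ℕ) • x ∈ D.P (p * m) ↔ x ∈ D.P m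
  notMem_U : ∀ (p : Nat.Primes) (m : ℕ+) (x : D.G), x ∈ D.P m →
    x ∉ D.U p (2 + (padicValNat (p : ℕ) (m : ℕ) : ℤ))
  mem_P_iff : ∀ (p : Nat.Primes) (m : ℕ+) (x : D.G), x ∈ D.P m ↔
    x ∈ D.P (p * m) ∧ x ∉ D.U p (2 + (padicValNat (p : ℕ) (m : ℕ) : ℤ))

namespace IsValued

variable {D : GroupData} (hD : IsValued D)

include hD

theorem sub_mem (p l) {x y : D.G} (hx : x ∈ D.U p l) (hy : y ∈ D.U p l) : x - y ∈ D.U p l := by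
  rw [sub_eq_add_neg]
  exact hD.add_mem p l _ _ hx (hD.neg_mem p l _ hy)

theorem add_mem_iff (p l) {x y : D.G} (hx : x ∈ D.U p l) : x + y ∈ D.U p l ↔ y ∈ D.U p l :=
  ⟨fun h => by simpa using hD.sub_mem p l h hx, hD.add_mem p l x y hx⟩

theorem neg_mem_iff (p l) {x : D.G} : -x ∈ D.U p l ↔ x ∈ D.U p l :=
  ⟨fun h => by simpa using hD.neg_mem p l _ h, hD.neg_mem p l x⟩

theorem mem_of_le (p) {l l' : ℤ} (h : l ≤ l') {x : D.G} (hx : x ∈ D.U p l') : x ∈ D.U p l := by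
  obtain ⟨n, rfl⟩ := Int.le.dest h
  induction n with
  | zero => simpa using hx
  | succ n ih =>
    refine ih (by omega) (hD.succ_subset p _ x ?_)
    rw [show l + (n : ℤ) + 1 = l + ((n + 1 : ℕ) : ℤ) by push_cast; ring]
    exact hx

theorem nsmul_inj {n : ℕ} (hn : n ≠ 0) {x y : D.G} (h : n • x = n • y) : x = y := by
  rw [← sub_eq_zero] at h ⊢
  rw [← nsmul_sub] at h
  exact hD.torsionFree n _ hn h

theorem eq_zero_of_zsmul {r : ℤ} (hr : r ≠ 0) {x : D.G} (h : r • x = 0) : x = 0 := by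
  refine hD.torsionFree r.natAbs x (Int.natAbs_ne_zero.2 hr) ?_
  rcases Int.natAbs_eq r with e | e
  · rw [← natCast_zsmul, ← e, h]
  · rw [← natCast_zsmul, ← neg_neg ((r.natAbs : ℕ) : ℤ), ← e, neg_smul, h, neg_zero]

/-- Multiplication by `k` raises values by exactly `v_p(k)`. -/
theorem smul_mem_iff (p : Nat.Primes) (k : ℕ) (hk : k ≠ 0) : ∀ (l : ℤ) (x : D.G),
    k • x ∈ D.U p (l + padicValNat (p : ℕ) k) ↔ x ∈ D.U p l := by
  have : Fact (p : ℕ).Prime := ⟨p.2⟩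
  induction k using induction_on_primes with
  | zero => exact absurd rfl hk
  | one => intro l x; simp
  | prime_mul q a hq ih =>
    intro l x
    have ha : a ≠ 0 := fun h => hk (by simp [h])
    have : Fact q.Prime := ⟨hq⟩
    rw [padicValNat.mul hq.ne_zero ha, mul_smul, ← ih ha l x]
    by_cases hpq : (p : ℕ) = q
    · subst hpq
      rw [padicValNat_self, Nat.cast_add, Nat.cast_one, add_comm (1 : ℤ), ← add_assoc]
      exact hD.smul_self p _ _
    · rw [padicValNat_primes hpq, zero_add]
      exact hD.smul_ne p ⟨q, hq⟩ _ _ fun h => hpq (congrArg Subtype.val h)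

end IsValued

theorem IsRegular.smul_mem_P_iff {D : GroupData} (hD : IsRegular D) (k : ℕ) :
    ∀ (hk : 0 < k) (m : ℕ+) (x : D.G), k • x ∈ D.P (⟨k, hk⟩ * m) ↔ x ∈ D.P m := by
  induction k using induction_on_primes with
  | zero => exact fun hk => absurd hk (lt_irrefl _)
  | one =>
    intro hk m x
    rw [one_smul]
    exact iff_of_eq (congrArg (fun n => x ∈ D.P n) (one_mul m))
  | prime_mul q a hq ih =>
    intro hk m x
    have ha : 0 < a := Nat.pos_of_mul_pos_left hk
    rw [mul_smul, ← ih ha m x, ← hD.smul_mem_P ⟨q, hq⟩ _ (a • x)]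
    exact iff_of_eq (congrArg (fun n => q • a • x ∈ D.P n) (mul_assoc ⟨q, hq.pos⟩ ⟨a, ha⟩ m))

theorem exists_eq_smul_of_coprime {G : Type} [AddCommGroup G] {a n : ℕ} (h : a.Coprime n) {x y : G}
    (e : a • x = n • y) : ∃ z, x = n • z := by
  have h1 : (1 : ℤ) = a * a.gcdA n + n * a.gcdB n := by
    rw [← Nat.gcd_eq_gcd_ab, h]; rfl
  refine ⟨a.gcdA n • y + a.gcdB n • x, ?_⟩
  calc x = (1 : ℤ) • x := (one_smul _ _).symm
    _ = a.gcdA n • (a • x) + (n * a.gcdB n) • x := by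
      rw [h1, add_smul, mul_comm (a : ℤ), mul_smul, natCast_zsmul]
    _ = n • (a.gcdA n • y + a.gcdB n • x) := by
      rw [e, smul_add, mul_smul, natCast_zsmul, smul_comm]

/-- The elements of `P_1` are square-free with respect to `U_{p,2}`. -/
theorem notMem_U_two {D : GroupData} (hD : IsValued D)
    (hP : ∀ (p : Nat.Primes) (a : D.G), (p : ℕ) • a ∈ D.P 1 ↔ a ∈ D.P 1 ∧ a ∉ D.U p 1)
    (p : Nat.Primes) {x : D.G} (hx : x ∈ D.P 1) : x ∉ D.U p 2 := by
  intro h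
  obtain ⟨y, rfl⟩ := hD.exists_smul p 2 x (by norm_num) h
  exact ((hP p y).1 hx).2 ((hD.smul_self p 1 y).1 h)

section BaseZ

variable {D : GroupData} (h : IsBaseZ D.U D.P)

include h

/-- A uniform description of `U_{p,l}`, by the truncation of `l` at `0`. -/
theorem IsBaseZ.mem_U_iff (p : Nat.Primes) (l : ℤ) (x : D.G) :
    x ∈ D.U p l ↔ ∃ a : D.G, x = (p : ℕ) ^ l.toNat • a := by
  rcases le_or_gt l 0 with hl | hl
  · rw [h.U_nonpos p l hl, Int.toNat_of_nonpos hl]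
    simp
  · obtain ⟨n, rfl⟩ := Int.eq_ofNat_of_zero_le hl.le
    rw [h.U_pos p n (by exact_mod_cast hl)]
    rfl

theorem IsBaseZ.isValued : IsValued D where
  torsionFree n x hn := torsionFree_of_equiv_int h.elemEquiv n hn x
  zero_mem p l := (h.mem_U_iff p l 0).2 ⟨0, by simp⟩
  add_mem p l x y hx hy := by
    rw [h.mem_U_iff] at hx hy ⊢
    obtain ⟨a, rfl⟩ := hx
    obtain ⟨b, rfl⟩ := hy
    exact ⟨a + b, by rw [smul_add]⟩
  neg_mem p l x hx := by
    rw [h.mem_U_iff] at hx ⊢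
    obtain ⟨a, rfl⟩ := hx
    exact ⟨-a, by rw [smul_neg]⟩
  succ_subset p l x hx := by
    rw [h.mem_U_iff] at hx ⊢
    obtain ⟨a, rfl⟩ := hx
    refine ⟨(p : ℕ) ^ ((l + 1).toNat - l.toNat) • a, ?_⟩
    rw [← mul_smul, ← pow_add]
    congr 2
    omega
  smul_self p l x := by
    rw [h.mem_U_iff, h.mem_U_iff]
    rcases lt_or_ge l 0 with hl | hl
    · rw [Int.toNat_of_nonpos hl.le, Int.toNat_of_nonpos (by omega : l + 1 ≤ 0)]
      simp
    · rw [show (l + 1).toNat = l.toNat + 1 by omega]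
      refine exists_congr fun a => ?_
      rw [pow_succ', mul_smul]
      refine ⟨fun e => ?_, fun e => by rw [e]⟩
      rw [← sub_eq_zero, ← smul_sub] at e
      exact sub_eq_zero.1 (torsionFree_of_equiv_int h.elemEquiv _ p.2.ne_zero _ e)
  smul_ne p q l x hpq := by
    rw [h.mem_U_iff, h.mem_U_iff]
    refine ⟨fun ⟨a, ha⟩ => exists_eq_smul_of_coprime (Nat.Coprime.pow_right _ ?_) ha,
      fun ⟨a, ha⟩ => ⟨(q : ℕ) • a, by rw [ha, smul_comm]⟩⟩
    exact (Nat.coprime_primes q.2 p.2).2 fun e => hpq (Subtype.ext e.symm)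
  exists_smul p l x hl hx := by
    rw [h.mem_U_iff] at hx
    obtain ⟨a, rfl⟩ := hx
    refine ⟨(p : ℕ) ^ (l.toNat - 1) • a, ?_⟩
    rw [← mul_smul, ← pow_succ']
    congr 2
    omega

theorem IsBaseZ.mem_P_iff (m : ℕ+) (x : D.G) :
    x ∈ D.P m ↔ ∃ d : ℕ, d ∣ (m : ℕ) ∧ ∃ a ∈ D.P 1, x = d • a := by
  rw [h.P_eq m]; rfl

theorem IsBaseZ.notMem_U (p : Nat.Primes) (m : ℕ+) (x : D.G) (hx : x ∈ D.P m) :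
    x ∉ D.U p (2 + (padicValNat (p : ℕ) (m : ℕ) : ℤ)) := by
  obtain ⟨d, hd, a, ha, rfl⟩ := (h.mem_P_iff m x).1 hx
  intro hU
  have : Fact (p : ℕ).Prime := ⟨p.2⟩
  have hd0 : d ≠ 0 := fun e => m.ne_zero (Nat.eq_zero_of_zero_dvd (e ▸ hd))
  refine notMem_U_two h.isValued h.prime_smul_mem p ha
    ((h.isValued.smul_mem_iff p d hd0 2 a).1 (h.isValued.mem_of_le p ?_ hU))
  obtain ⟨e, he⟩ := hd
  rw [he, padicValNat.mul hd0 (fun e0 => m.ne_zero (by rw [he, e0, mul_zero]))]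
  omega

theorem IsBaseZ.isRegular : IsRegular D where
  toIsValued := h.isValued
  neg_mem_P m x := by
    have key : ∀ y : D.G, y ∈ D.P m → -y ∈ D.P m := by
      intro y hy
      obtain ⟨d, hd, a, ha, rfl⟩ := (h.mem_P_iff m y).1 hy
      exact (h.mem_P_iff m _).2 ⟨d, hd, -a, (h.neg_mem a).2 ha, by rw [smul_neg]⟩
    exact ⟨fun hx => by simpa using key _ hx, key x⟩
  smul_mem_P p m x := by
    constructor
    · intro hx
      obtain ⟨d, hd, a, ha, e⟩ := (h.mem_P_iff _ _).1 hx
      rw [PNat.mul_coe] at hd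
      change d ∣ (p : ℕ) * m at hd
      by_cases hpd : (p : ℕ) ∣ d
      · obtain ⟨d', rfl⟩ := hpd
        rw [mul_smul] at e
        exact (h.mem_P_iff _ _).2 ⟨d', Nat.dvd_of_mul_dvd_mul_left p.2.pos hd, a, ha,
          h.isValued.nsmul_inj p.2.ne_zero e⟩
      · have hdm : d ∣ m := ((Nat.Prime.coprime_iff_not_dvd p.2).2 hpd).symm.dvd_of_dvd_mul_left hd
        obtain ⟨b, rfl⟩ := exists_eq_smul_of_coprime
          ((Nat.Prime.coprime_iff_not_dvd p.2).2 hpd).symm e.symm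
        rw [smul_comm] at e
        exact (h.mem_P_iff _ _).2 ⟨d, hdm, b, ((h.prime_smul_mem p b).1 ha).1,
          h.isValued.nsmul_inj p.2.ne_zero e⟩
    · intro hx
      obtain ⟨d, hd, a, ha, rfl⟩ := (h.mem_P_iff _ _).1 hx
      refine (h.mem_P_iff _ _).2 ⟨p * d, ?_, a, ha, by rw [mul_smul]⟩
      rw [PNat.mul_coe]
      exact Nat.mul_dvd_mul_left _ hd
  notMem_U := h.notMem_U
  mem_P_iff p m x := by
    have : Fact (p : ℕ).Prime := ⟨p.2⟩
    constructor
    · intro hx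
      refine ⟨?_, h.notMem_U p m x hx⟩
      obtain ⟨d, hd, a, ha, rfl⟩ := (h.mem_P_iff _ _).1 hx
      refine (h.mem_P_iff _ _).2 ⟨d, ?_, a, ha, rfl⟩
      rw [PNat.mul_coe]
      exact hd.mul_left _
    · rintro ⟨hx, hU⟩
      obtain ⟨d, hd, a, ha, rfl⟩ := (h.mem_P_iff _ _).1 hx
      rw [PNat.mul_coe] at hd
      change d ∣ (p : ℕ) * m at hd
      by_cases hdm : d ∣ m
      · exact (h.mem_P_iff _ _).2 ⟨d, hdm, a, ha, rfl⟩
      have hpd : (p : ℕ) ∣ d := by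
        by_contra hpd
        exact hdm (((Nat.Prime.coprime_iff_not_dvd p.2).2 hpd).symm.dvd_of_dvd_mul_left hd)
      obtain ⟨e, rfl⟩ := hpd
      obtain ⟨f, hf⟩ := Nat.dvd_of_mul_dvd_mul_left p.2.pos hd
      -- Here `d = p e` has the same `p`-adic valuation as `p m`, and `x = d a = e (p a)`.
      have hpf : ¬(p : ℕ) ∣ f := by
        rintro ⟨g, rfl⟩
        exact hdm ⟨g, by rw [hf]; ring⟩
      have he0 : e ≠ 0 := fun e0 => m.ne_zero (by rw [hf, e0, zero_mul])
      have hf0 : f ≠ 0 := fun e0 => m.ne_zero (by rw [hf, e0, mul_zero])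
      have haU : a ∉ D.U p 1 := by
        intro haU
        refine hU ?_
        have := (h.isValued.smul_mem_iff p (p * e) (mul_ne_zero p.2.ne_zero he0) 1 a).2 haU
        rw [padicValNat.mul p.2.ne_zero he0, padicValNat_self] at this
        rw [hf, padicValNat.mul he0 hf0, padicValNat.eq_zero_of_not_dvd hpf]
        refine h.isValued.mem_of_le p ?_ this
        omega
      refine (h.mem_P_iff _ _).2 ⟨e, ⟨f, hf⟩, (p : ℕ) • a, (h.prime_smul_mem p a).2 ⟨ha, haU⟩, ?_⟩
      rw [mul_smul, smul_comm]

end BaseZ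

end Regular

end SqfQE

namespace SqfQE

open FirstOrder.Language

/-! ### Special systems -/

/-- Every locally satisfiable system has a solution. -/
def HasSolutions (D : GroupData) : Prop :=
  ∀ (n n' : ℕ) (π : ParameterChoice n n') (c : Fin n → D.G) (c' : Fin n' → D.G),
    π.IsLocallySatisfiableSystem D.U D.P c c' → ∃ a, π.IsSolution D.U D.P c c' a

/-- Special formulas can be specified by the relations that their `p`-conditions define. The
conditions are trivial outside the finite set `S`. -/
theorem exists_parameterChoice {n n' : ℕ} (k : ℤ) (hk : k ≠ 0) (m : ℕ+) (S : Finset Nat.Primes)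
    (R : Nat.Primes → ∀ D : GroupData, (Unit ⊕ (Fin n ⊕ Fin n') → D.G) → Prop)
    (hR : ∀ p ∈ S, PDef p (R p)) :
    ∃ π : ParameterChoice n n', π.k = k ∧ π.m = m ∧
      ∀ (D : GroupData) (c : Fin n → D.G) (c' : Fin n' → D.G) (p : Nat.Primes) (a : D.G),
        π.ThetaHolds D.U D.P c c' p a ↔
          (p ∈ S → R p D (Sum.elim (fun _ => a) (Sum.elim c c'))) := by
  classical
  have hex : ∀ p, ∃ φ : L1star.Formula (Unit ⊕ (Fin n ⊕ Fin n')), IsPCondition p φ ∧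
      (p ∉ S → φ = ⊤) ∧ ∀ D v, D.Sat φ v ↔ (p ∈ S → R p D v) := by
    intro p
    by_cases hp : p ∈ S
    · obtain ⟨φ, h₁, h₂⟩ := hR p hp
      exact ⟨φ, h₁, fun h => absurd hp h, fun D v => by simpa [hp] using h₂ D v⟩
    · refine ⟨⊤, IsPCondition.imp IsPCondition.falsum IsPCondition.falsum, fun _ => rfl,
        fun D v => ?_⟩
      simp only [hp, false_imp_iff, iff_true]
      exact fun h => h
  choose θ h₁ h₂ h₃ using hex
  refine ⟨⟨k, hk, m, θ, h₁, S.finite_toSet.subset fun p hp => ?_⟩, rfl, rfl,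
    fun D c c' p a => h₃ p D _⟩
  by_contra h
  exact hp (h₂ p h)

section BaseQ

variable {D : GroupData} (h : IsBaseQ D.U D.P)

include h

namespace IsBaseQ

theorem smul_inj {n : ℕ} (hn : n ≠ 0) {x y : D.G} (e : n • x = n • y) : x = y := by
  rw [← sub_eq_zero, ← nsmul_sub] at e
  exact sub_eq_zero.1 (torsionFree_of_equiv_rat h.elemEquiv n hn _ e)

theorem mem_U_natCast (p : Nat.Primes) (n : ℕ) (x : D.G) :
    x ∈ D.U p n ↔ ∃ a ∈ D.U p 0, x = (p : ℕ) ^ n • a := by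
  rcases Nat.eq_zero_or_pos n with rfl | hn
  · simp
  · rw [h.U_pos p n hn]; rfl

theorem mem_U_neg (p : Nat.Primes) (n : ℕ) (x : D.G) :
    x ∈ D.U p (-(n : ℤ)) ↔ (p : ℕ) ^ n • x ∈ D.U p 0 := by
  rcases Nat.eq_zero_or_pos n with rfl | hn
  · simp
  · rw [← h.U_neg p n hn]
    refine ⟨fun hx => ⟨x, hx, rfl⟩, ?_⟩
    rintro ⟨a, ha, e⟩
    rwa [h.smul_inj (pow_ne_zero _ p.2.ne_zero) e]

theorem smul_mem_succ (p : Nat.Primes) (l : ℤ) (x : D.G) :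
    (p : ℕ) • x ∈ D.U p (l + 1) ↔ x ∈ D.U p l := by
  rcases le_or_gt 0 l with hl | hl
  · obtain ⟨n, rfl⟩ := Int.eq_ofNat_of_zero_le hl
    rw [← Nat.cast_succ, h.mem_U_natCast, h.mem_U_natCast]
    refine exists_congr fun a => and_congr_right fun _ => ?_
    rw [pow_succ', mul_smul]
    exact ⟨fun e => h.smul_inj p.2.ne_zero e, fun e => by rw [e]⟩
  · obtain ⟨n, rfl⟩ : ∃ n : ℕ, l = -((n + 1 : ℕ) : ℤ) := ⟨(-l - 1).toNat, by omega⟩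
    rw [show -((n + 1 : ℕ) : ℤ) + 1 = -(n : ℤ) by omega, h.mem_U_neg, h.mem_U_neg, pow_succ,
      mul_smul]

theorem mem_succ_iff (p : Nat.Primes) (l : ℤ) (x : D.G) :
    x ∈ D.U p (l + 1) ↔ ∃ y ∈ D.U p l, x = (p : ℕ) • y := by
  constructor
  · intro hx
    obtain ⟨y, rfl⟩ := divisible_of_equiv_rat h.elemEquiv p p.2.ne_zero x
    exact ⟨y, (h.smul_mem_succ p l y).1 hx, rfl⟩
  · rintro ⟨y, hy, rfl⟩
    exact (h.smul_mem_succ p l y).2 hy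

theorem exists_addSubgroup (p : Nat.Primes) (l : ℤ) :
    ∃ H : AddSubgroup D.G, (H : Set D.G) = D.U p l := by
  induction l using Int.induction_on with
  | zero =>
    obtain ⟨H, -, hH, -⟩ := h.quotient p
    exact ⟨H, hH⟩
  | succ n ih =>
    obtain ⟨H, hH⟩ := ih
    refine ⟨H.map (nsmulAddMonoidHom (p : ℕ)), ?_⟩
    ext x
    rw [h.mem_succ_iff, ← hH]
    simp [eq_comm]
  | pred n ih =>
    obtain ⟨H, hH⟩ := ih
    refine ⟨H.comap (nsmulAddMonoidHom (p : ℕ)), ?_⟩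
    ext x
    rw [← h.smul_mem_succ, sub_add_cancel, ← hH]
    simp

/-- The quotient `U_{p,l} / U_{p,l+1}` is generated by the class of every element outside
`U_{p,l+1}`, and it is not trivial. -/
theorem cyclic (p : Nat.Primes) (l : ℤ) : (∃ g ∈ D.U p l, g ∉ D.U p (l + 1)) ∧
    ∀ u ∈ D.U p l, u ∉ D.U p (l + 1) → ∀ x ∈ D.U p l, ∃ j : ℤ, x - j • u ∈ D.U p (l + 1) := by
  induction l using Int.induction_on with
  | zero =>
    obtain ⟨H, K, hH, hK, hKH, ⟨e⟩⟩ := h.quotient p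
    have : Fact (p : ℕ).Prime := ⟨p.2⟩
    rw [zero_add, ← hH, ← hK]
    have hmk : ∀ x : H, e (QuotientAddGroup.mk x) = 0 ↔ (x : D.G) ∈ K := by
      intro x
      rw [map_eq_zero_iff e e.injective, QuotientAddGroup.eq_zero_iff,
        AddSubgroup.mem_addSubgroupOf]
    constructor
    · obtain ⟨x, hx⟩ := QuotientAddGroup.mk_surjective (e.symm 1)
      refine ⟨x, x.2, fun hxK => ?_⟩
      have := (hmk x).2 hxK
      rw [hx] at this
      simp at this
    · intro u hu huK x hx
      have hu0 : e (QuotientAddGroup.mk ⟨u, hu⟩) ≠ 0 := fun h0 => huK ((hmk ⟨u, hu⟩).1 h0)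
      set a := e (QuotientAddGroup.mk ⟨u, hu⟩) with ha
      set b := e (QuotientAddGroup.mk ⟨x, hx⟩) with hb
      refine ⟨((b * a⁻¹).val : ℤ), ?_⟩
      refine (hmk (⟨x, hx⟩ - ((b * a⁻¹).val : ℤ) • ⟨u, hu⟩)).1 ?_
      rw [QuotientAddGroup.mk_sub, QuotientAddGroup.mk_zsmul, map_sub, map_zsmul, ← ha, ← hb]
      simp [hu0]
  | succ n ih =>
    obtain ⟨⟨g, hg, hg'⟩, hc⟩ := ih
    refine ⟨⟨(p : ℕ) • g, (h.smul_mem_succ p _ g).2 hg,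
      fun hgp => hg' ((h.smul_mem_succ p _ g).1 hgp)⟩, fun u hu hu' x hx => ?_⟩
    obtain ⟨v, hv, rfl⟩ := (h.mem_succ_iff _ _ _).1 hu
    obtain ⟨y, hy, rfl⟩ := (h.mem_succ_iff _ _ _).1 hx
    obtain ⟨j, hj⟩ := hc v hv (fun h' => hu' ((h.smul_mem_succ p _ v).2 h')) y hy
    refine ⟨j, ?_⟩
    rw [smul_comm, ← smul_sub]
    exact (h.smul_mem_succ p _ _).2 hj
  | pred n ih =>
    obtain ⟨⟨g, hg, hg'⟩, hc⟩ := ih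
    generalize hl : -(n : ℤ) - 1 = l at *
    have hl' : -(n : ℤ) = l + 1 := by omega
    rw [hl'] at hg hg' hc
    obtain ⟨y, hy, rfl⟩ := (h.mem_succ_iff _ _ _).1 hg
    refine ⟨⟨y, hy, fun h' => hg' ((h.smul_mem_succ p _ y).2 h')⟩, fun u hu hu' x hx => ?_⟩
    obtain ⟨j, hj⟩ := hc _ ((h.smul_mem_succ p _ u).2 hu)
      (fun h' => hu' ((h.smul_mem_succ p _ u).1 h')) _ ((h.smul_mem_succ p _ x).2 hx)
    refine ⟨j, ?_⟩
    rw [smul_comm, ← smul_sub] at hj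
    exact (h.smul_mem_succ p _ _).1 hj

theorem succ_subset (p : Nat.Primes) (l : ℤ) (x : D.G) (hx : x ∈ D.U p (l + 1)) : x ∈ D.U p l := by
  obtain ⟨y, hy, rfl⟩ := (h.mem_succ_iff _ _ _).1 hx
  obtain ⟨H, hH⟩ := h.exists_addSubgroup p l
  rw [← hH] at hy ⊢
  exact H.nsmul_mem hy _

theorem notMem_U_two {p : Nat.Primes} {x : D.G} (hx : x ∈ D.P 1) : x ∉ D.U p 2 := by
  intro hU
  obtain ⟨y, hy, rfl⟩ := (h.mem_succ_iff p 1 x).1 hU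
  exact ((h.prime_smul_mem p y).1 hx).2 hy

/-- In a model with enough solutions, `U_{p,0}` is closed under division by the primes `q ≠ p`.
Otherwise there is a square-free `b ∉ U_{p,0}` with `q b ∈ U_{p,0}` that is moreover in general
position at `q`, and the axioms for `p b`, `p² b` and `p² q b` contradict each other. -/
theorem mem_of_smul_mem (hs : HasSolutions D) (p q : Nat.Primes) (hpq : p ≠ q) (g : D.G)
    (hg : (q : ℕ) • g ∈ D.U p 0) : g ∈ D.U p 0 := by
  classical
  by_contra hg'
  obtain ⟨π, hk, hm, hθ⟩ := exists_parameterChoice (n := 1) (n' := 0) 1 one_ne_zero 1 {p, q}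
    (fun r D v => if r = p then ¬v (Sum.inl ()) ∈ D.U r 0 ∧ (q : ℕ) • v (Sum.inl ()) ∈ D.U r 0
      else ¬(p : ℕ) ^ 2 • v (Sum.inl ()) ∈ D.U r 1) (fun r _ => by
        split_ifs
        · exact (PDef.memU (TermDef.var _) _).not.and (PDef.memU ((TermDef.var _).nsmul _) _)
        · exact (PDef.memU ((TermDef.var _).nsmul _) _).not)
  have hsat : π.IsLocallySatisfiableSystem D.U D.P (fun _ => 0) Fin.elim0 := by
    refine ⟨Function.Injective.sumElim (Function.injective_of_subsingleton _)
      (Function.injective_of_subsingleton _) fun _ b => b.elim0, fun r => ?_⟩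
    simp only [ParameterChoice.IsLocalSolution, hθ, hk, hm]
    by_cases hrp : r = p
    · subst hrp
      refine ⟨g, fun _ => ?_, fun _ hU => hg' ?_⟩
      · simpa using ⟨hg', hg⟩
      · have h2 : g ∈ D.U r (0 + 1 + 1) := by simpa using hU
        exact h.succ_subset _ _ _ (h.succ_subset _ _ _ h2)
    · obtain ⟨u, hu, hu'⟩ := (h.cyclic r 0).1
      refine ⟨u, fun hr => ?_, fun _ hU => hu' ?_⟩
      · obtain rfl : r = q := by simpa [hrp] using hr
        simp only [hrp, if_false, Sum.elim_inl]
        intro hU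
        obtain ⟨H, hH⟩ := h.exists_addSubgroup r 1
        have h1 : (r : ℕ) • u ∈ D.U r 1 := (h.smul_mem_succ r 0 u).2 hu
        rw [zero_add] at hu'
        rw [← hH] at hU h1 hu'
        have hcop : IsCoprime (((p : ℕ) ^ 2 : ℕ) : ℤ) ((r : ℕ) : ℤ) := by
          rw [Nat.isCoprime_iff_coprime]
          exact Nat.Coprime.pow_left _
            ((Nat.coprime_primes p.2 r.2).2 fun e => hrp (Subtype.ext e.symm))
        obtain ⟨a, b, hab⟩ := hcop
        refine hu' ?_
        have : u = a • ((p : ℕ) ^ 2 • u) + b • ((r : ℕ) • u) := by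
          rw [← natCast_zsmul, ← natCast_zsmul, ← mul_smul, ← mul_smul, ← add_smul, hab, one_smul]
        rw [this]
        exact H.add_mem (H.zsmul_mem hU _) (H.zsmul_mem h1 _)
      · have h2 : u ∈ D.U r (0 + 1 + 1) := by simpa using hU
        exact h.succ_subset _ _ _ h2
  obtain ⟨b, hb, hbP, -⟩ := hs _ _ π _ _ hsat
  simp only [hθ] at hb
  have hbp := hb p (by simp)
  have hbq := hb q (by simp)
  simp only [Sum.elim_inl, if_true, hpq.symm, if_false] at hbp hbq
  have hb1 : b ∈ D.P 1 := by
    have := hbP 0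
    rw [hk, hm] at this
    simpa using this
  have h2 : (p : ℕ) • b ∈ D.P 1 :=
    (h.prime_smul_mem p b).2 ⟨hb1, fun hU => hbp.1 (h.succ_subset p 0 b hU)⟩
  have h3 : (p : ℕ) ^ 2 • b ∈ D.P 1 := by
    rw [pow_two, mul_smul]
    exact (h.prime_smul_mem p _).2 ⟨h2, fun hU => hbp.1 ((h.smul_mem_succ p 0 b).1 hU)⟩
  have h4 : (q : ℕ) • (p : ℕ) ^ 2 • b ∈ D.P 1 := (h.prime_smul_mem q _).2 ⟨h3, hbq⟩
  rw [smul_comm] at h4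
  refine h.notMem_U_two (p := p) h4 ?_
  rw [pow_two, mul_smul]
  exact (h.smul_mem_succ p 1 _).2 ((h.smul_mem_succ p 0 _).2 hbp.2)

theorem isValued (hs : HasSolutions D) : IsValued D where
  torsionFree n x hn := torsionFree_of_equiv_rat h.elemEquiv n hn x
  zero_mem p l := by
    obtain ⟨H, hH⟩ := h.exists_addSubgroup p l
    rw [← hH]
    exact H.zero_mem
  add_mem p l x y hx hy := by
    obtain ⟨H, hH⟩ := h.exists_addSubgroup p l
    rw [← hH] at hx hy ⊢
    exact H.add_mem hx hy
  neg_mem p l x hx := by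
    obtain ⟨H, hH⟩ := h.exists_addSubgroup p l
    rw [← hH] at hx ⊢
    exact H.neg_mem hx
  succ_subset := h.succ_subset
  smul_self := h.smul_mem_succ
  smul_ne p q l x hpq := by
    constructor
    · intro hx
      induction l using Int.induction_on generalizing x with
      | zero => exact h.mem_of_smul_mem hs p q hpq x hx
      | succ n ih =>
        obtain ⟨z, rfl⟩ := divisible_of_equiv_rat h.elemEquiv p p.2.ne_zero x
        rw [smul_comm, h.smul_mem_succ] at hx
        rw [h.smul_mem_succ]
        exact ih z hx
      | pred n ih =>
        rw [← h.smul_mem_succ, sub_add_cancel] at hx ⊢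
        rw [smul_comm] at hx
        exact ih _ hx
    · intro hx
      obtain ⟨H, hH⟩ := h.exists_addSubgroup p l
      rw [← hH] at hx ⊢
      exact H.nsmul_mem hx _
  exists_smul p l x _ _ := divisible_of_equiv_rat h.elemEquiv p p.2.ne_zero x

theorem mem_P_smul_iff (m : ℕ+) (a : D.G) : (m : ℕ) • a ∈ D.P m ↔ a ∈ D.P 1 := by
  rw [h.P_eq m]
  refine ⟨fun ⟨b, hb, e⟩ => ?_, fun ha => ⟨a, ha, rfl⟩⟩
  rwa [h.smul_inj m.ne_zero e]

theorem isRegular (hs : HasSolutions D) : IsRegular D := by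
  have hV := h.isValued hs
  have hdiv : ∀ (m : ℕ+) (x : D.G), ∃ y, x = (m : ℕ) • y :=
    fun m x => divisible_of_equiv_rat h.elemEquiv m m.ne_zero x
  have hmul : ∀ (p : Nat.Primes) (m : ℕ+) (y : D.G),
      (p : ℕ) • (m : ℕ) • y ∈ D.P (p * m) ↔ y ∈ D.P 1 := by
    intro p m y
    rw [← h.mem_P_smul_iff (p * m), PNat.mul_coe, mul_smul]
    rfl
  refine ⟨hV, fun m x => ?_, fun p m x => ?_, fun p m x hx => ?_, fun p m x => ?_⟩
  · obtain ⟨y, rfl⟩ := hdiv m x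
    rw [← smul_neg, h.mem_P_smul_iff, h.mem_P_smul_iff, h.neg_mem]
  · obtain ⟨y, rfl⟩ := hdiv m x
    rw [hmul, h.mem_P_smul_iff]
  · obtain ⟨y, rfl⟩ := hdiv m x
    rw [h.mem_P_smul_iff] at hx
    rw [hV.smul_mem_iff p m m.ne_zero 2]
    exact h.notMem_U_two hx
  · obtain ⟨y, rfl⟩ := hdiv m x
    obtain ⟨z, rfl⟩ := divisible_of_equiv_rat h.elemEquiv p p.2.ne_zero y
    rw [h.mem_P_smul_iff, hV.smul_mem_iff p m m.ne_zero 2, smul_comm, hmul, h.prime_smul_mem]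
    refine and_congr_right fun _ => not_congr ?_
    exact (h.smul_mem_succ p 1 z).symm

end IsBaseQ

end BaseQ

end SqfQE

namespace SqfQE

open FirstOrder.Language

/-! ### Extending partial isomorphisms by one element -/

section Core

/-- Two parametrizations `α`, `β` of subgroups containing `1` by the same group `F` satisfy the
same atomic conditions; that is, they give an isomorphism of the substructures `α(F)` and
`β(F)`. -/
structure SameAtoms (D D' : GroupData) {F : Type} [AddCommGroup F] (α : F →+ D.G)
    (β : F →+ D'.G) : Prop where
  one : ∃ e : F, α e = 1 ∧ β e = 1
  eq_iff : ∀ t, α t = 0 ↔ β t = 0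
  memU_iff : ∀ p l t, α t ∈ D.U p l ↔ β t ∈ D'.U p l
  memP_iff : ∀ m t, α t ∈ D.P m ↔ β t ∈ D'.P m
  lt_iff : ∀ s t, D.lt (α s) (α t) ↔ D'.lt (β s) (β t)

variable {D D' : GroupData} {F : Type} [AddCommGroup F] {α : F →+ D.G} {β : F →+ D'.G}

/-- Solvability of `K x + t = 0` transfers from `D` to `D'`. -/
def RootTransfer (α : F →+ D.G) (β : F →+ D'.G) : Prop :=
  ∀ (K : ℕ), K ≠ 0 → ∀ t : F, (∃ c, K • c + α t = 0) → ∃ d, K • d + β t = 0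

/-- For every prime `p`, finitely many conditions on the membership of `K x + t` in `U_{p,l}` that
are realized in `D` are realized in `D'`. -/
def LocalTransfer (α : F →+ D.G) (β : F →+ D'.G) : Prop :=
  ∀ (p : Nat.Primes) (K : ℕ), K ≠ 0 → ∀ (c : D.G) (S : Finset F) (Q : Finset ℤ),
    ∃ d : D'.G, ∀ t ∈ S, ∀ l ∈ Q, K • c + α t ∈ D.U p l ↔ K • d + β t ∈ D'.U p l

/-- If no `K c + t` vanishes, then locally satisfiable systems have solutions `d` in `D'` such that
no `K d + t` vanishes and these elements have the same signs as the `K c + t`. -/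
def PlaceTransfer (α : F →+ D.G) (β : F →+ D'.G) : Prop :=
  ∀ (n n' : ℕ) (π : ParameterChoice n n') (z : Fin n → D'.G) (z' : Fin n' → D'.G),
    π.IsLocallySatisfiableSystem D'.U D'.P z z' →
    ∀ (K : ℕ), K ≠ 0 → ∀ (c : D.G) (S : Finset F), (∀ t ∈ S, K • c + α t ≠ 0) →
      ∃ d, π.IsSolution D'.U D'.P z z' d ∧ ∀ t ∈ S, K • d + β t ≠ 0 ∧
        (D.lt 0 (K • c + α t) ↔ D'.lt 0 (K • d + β t)) ∧
        (D.lt 0 (-(K • c + α t)) ↔ D'.lt 0 (-(K • d + β t)))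

/-- The properties of `<` that hold in ordered groups and for the empty relation. -/
structure IsInvariantLt (D : GroupData) : Prop where
  sub_iff : ∀ a b, D.lt a b ↔ D.lt 0 (b - a)
  smul_iff : ∀ (n : ℕ) a, n ≠ 0 → (D.lt 0 (n • a) ↔ D.lt 0 a)

/-- The elements `y` and `y'` satisfy the same atomic conditions from finite lists. -/
structure AgreeOn (Q : Finset (Nat.Primes × ℤ)) (M : Finset ℕ+) (y : D.G) (y' : D'.G) : Prop where
  eq_iff : y = 0 ↔ y' = 0
  memU_iff : ∀ q ∈ Q, (y ∈ D.U q.1 q.2 ↔ y' ∈ D'.U q.1 q.2)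
  memP_iff : ∀ m ∈ M, (y ∈ D.P m ↔ y' ∈ D'.P m)
  lt_iff : D.lt 0 y ↔ D'.lt 0 y'

/-- The parameters of a system have to be pairwise distinct, so one element of each fibre of `f` in
`S` is chosen. -/
theorem exists_fin_representatives {F G : Type} (S : Finset F) (f : F → G) :
    ∃ (n : ℕ) (τ : Fin n → F), (∀ i, τ i ∈ S) ∧ Function.Injective (f ∘ τ) ∧
      ∀ t ∈ S, ∃ i, f (τ i) = f t := by
  classical
  have h : ∀ i : S.image f, ∃ t ∈ S, f t = i := fun i => Finset.mem_image.1 i.2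
  choose τ hτ hf using h
  let e := (S.image f).equivFin
  refine ⟨(S.image f).card, fun i => τ (e.symm i), fun i => hτ _, fun i j hij => ?_, fun t ht => ?_⟩
  · simp only [Function.comp_apply, hf] at hij
    exact e.symm.injective (Subtype.ext hij)
  · exact ⟨e ⟨f t, Finset.mem_image_of_mem f ht⟩, by simp [hf]⟩

theorem PDef.iff_const {X : Type} {p : Nat.Primes} {R : ∀ D : GroupData, (X → D.G) → Prop}
    (hR : PDef p R) (a : Prop) : PDef p fun D v => (a ↔ R D v) := by
  by_cases ha : a
  · exact hR.congr fun D v => by simp [ha]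
  · exact hR.not.congr fun D v => by simp [ha]

/-- The case of a common coefficient `K` and a common index `M`. All parameters of the conditions
on `U_{p,l}` are made parameters of conditions on `P_M`, so that the type of `c` is given by a
special system; this system is locally satisfied by `c`. -/
theorem exists_solution_of_common (hD : IsRegular D) (hs : SameAtoms D D' α β)
    (hloc : LocalTransfer α β) (hplace : PlaceTransfer α β)
    (K : ℕ) (hK : K ≠ 0) (M : ℕ+) (c : D.G) (S : Finset F) (Q : Finset (Nat.Primes × ℤ))
    (hne : ∀ t ∈ S, K • c + α t ≠ 0) :
    ∃ d : D'.G, ∀ t ∈ S, K • d + β t ≠ 0 ∧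
        (D.lt 0 (K • c + α t) ↔ D'.lt 0 (K • d + β t)) ∧
        (D.lt 0 (-(K • c + α t)) ↔ D'.lt 0 (-(K • d + β t))) ∧
        (K • c + α t ∈ D.P M ↔ K • d + β t ∈ D'.P M) ∧
        ∀ q ∈ Q, (K • c + α t ∈ D.U q.1 q.2 ↔ K • d + β t ∈ D'.U q.1 q.2) := by
  classical
  have hαβ : ∀ {s t : F}, β s = β t → α s = α t := by
    intro s t h
    rw [← sub_eq_zero, ← map_sub] at h ⊢
    exact (hs.eq_iff _).2 h
  obtain ⟨n, τ, hτS, hτi, hτ⟩ :=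
    exists_fin_representatives (S.filter fun t => K • c + α t ∈ D.P M) β
  obtain ⟨n', τ', hτS', hτi', hτ'⟩ :=
    exists_fin_representatives (S.filter fun t => K • c + α t ∉ D.P M) β
  simp only [Finset.mem_filter] at hτS hτS' hτ hτ'
  set σ : Fin n ⊕ Fin n' → F := Sum.elim τ τ' with hσ
  have hσS : ∀ i, σ i ∈ S := by
    rintro (i | i)
    · exact (hτS i).1
    · exact (hτS' i).1
  have hσ' : ∀ t ∈ S, ∃ i, β (σ i) = β t := by
    intro t ht
    by_cases hP : K • c + α t ∈ D.P M
    · obtain ⟨i, hi⟩ := hτ t ⟨ht, hP⟩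
      exact ⟨Sum.inl i, hi⟩
    · obtain ⟨i, hi⟩ := hτ' t ⟨ht, hP⟩
      exact ⟨Sum.inr i, hi⟩
  obtain ⟨π, hk, hm, hθ⟩ := exists_parameterChoice (n := n) (n' := n') (K : ℤ)
    (by exact_mod_cast hK) M (Q.image Prod.fst)
    (fun p D₁ v => ∀ i ∈ (Finset.univ : Finset (Fin n ⊕ Fin n')),
      ∀ l ∈ (Q.filter fun q => q.1 = p).image Prod.snd,
      (K • c + α (σ i) ∈ D.U p l ↔ K • v (Sum.inl ()) + v (Sum.inr i) ∈ D₁.U p l))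
    (fun p _ => PDef.forall_mem _ fun i _ => PDef.forall_mem _ fun l _ =>
      (PDef.memU (((TermDef.var _).nsmul K).add (TermDef.var _)) l).iff_const _)
  -- The system has solutions at `p` by transfer of the conditions satisfied by `c`, which include
  -- `K c + t ∉ U_{p, 2 + v_p(M)}` for all `t` with `K c + t ∈ P_M`.
  have helim : ∀ i, (Sum.elim (β ∘ τ) (β ∘ τ') : Fin n ⊕ Fin n' → D'.G) i = β (σ i) := by
    rintro (i | i) <;> rfl
  have hsat : π.IsLocallySatisfiableSystem D'.U D'.P (β ∘ τ) (β ∘ τ') := by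
    refine ⟨hτi.sumElim hτi' fun i j hij => (hτS' j).2 ?_, fun p => ?_⟩
    · rw [← hαβ hij]
      exact (hτS i).2
    · obtain ⟨d, hd⟩ := hloc p K hK c S
        (insert (2 + (padicValNat (p : ℕ) (M : ℕ) : ℤ))
          ((Q.filter fun q => q.1 = p).image Prod.snd))
      refine ⟨d, (hθ _ _ _ _ _).2 fun _ i _ l hl => ?_, fun i => ?_⟩
      · simp only [Sum.elim_inl, Sum.elim_inr, helim]
        exact hd _ (hσS i) l (Finset.mem_insert_of_mem hl)
      · rw [hk, hm, natCast_zsmul]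
        exact fun hU => hD.notMem_U p M _ (hτS i).2
          ((hd _ (hτS i).1 _ (Finset.mem_insert_self _ _)).2 hU)
  obtain ⟨d, ⟨hdθ, hdP, hdP'⟩, hd⟩ := hplace _ _ π _ _ hsat K hK c S hne
  refine ⟨d, fun t ht => ⟨(hd t ht).1, (hd t ht).2.1, (hd t ht).2.2, ?_, ?_⟩⟩
  · rw [hk, hm] at hdP hdP'
    simp only [natCast_zsmul, Function.comp_apply] at hdP hdP'
    by_cases hP : K • c + α t ∈ D.P M
    · obtain ⟨i, hi⟩ := hτ t ⟨ht, hP⟩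
      exact iff_of_true hP (hi ▸ hdP i)
    · obtain ⟨i, hi⟩ := hτ' t ⟨ht, hP⟩
      exact iff_of_false hP (hi ▸ hdP' i)
  · intro q hq
    obtain ⟨i, hi⟩ := hσ' t ht
    have := (hθ _ _ _ _ _).1 (hdθ q.1) (Finset.mem_image_of_mem _ hq) i (Finset.mem_univ _) q.2
      (Finset.mem_image.2 ⟨q, Finset.mem_filter.2 ⟨hq, rfl⟩, rfl⟩)
    simp only [Sum.elim_inl, Sum.elim_inr, helim, hi, hαβ hi] at this
    exact this

/-- The condition `y ∈ P_m` is determined by the conditions on `P_M` and `U_{p,l}` for a multiple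
`M` of `m`. -/
theorem memP_iff_of_multiple (hD : IsRegular D) (hD' : IsRegular D') (M : ℕ) {y : D.G} {y' : D'.G}
    (hU : ∀ (p : Nat.Primes) (j : ℕ), (p : ℕ) ≤ M → j ≤ M →
      (y ∈ D.U p (2 + (j : ℤ)) ↔ y' ∈ D'.U p (2 + (j : ℤ)))) (r : ℕ) :
    ∀ (m M' : ℕ+), (M' : ℕ) = M → r * m = M → (y ∈ D.P M' ↔ y' ∈ D'.P M') →
      (y ∈ D.P m ↔ y' ∈ D'.P m) := by
  induction r using induction_on_primes with
  | zero =>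
    intro m M' hM' h0 _
    rw [zero_mul, ← hM'] at h0
    exact absurd h0.symm M'.ne_zero
  | one =>
    intro m M' hM' h1 h
    rw [one_mul, ← hM'] at h1
    rwa [PNat.eq h1]
  | prime_mul q a hq ih =>
    intro m M' hM' h1 h
    rw [hD.mem_P_iff ⟨q, hq⟩ m y, hD'.mem_P_iff ⟨q, hq⟩ m y']
    have hM0 : M ≠ 0 := hM' ▸ M'.ne_zero
    have hmM : (m : ℕ) ∣ M := ⟨q * a, by rw [← h1, mul_comm]⟩
    refine and_congr (ih _ M' hM' ?_ h) (not_congr (hU _ _ ?_ ?_))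
    · rw [PNat.mul_coe, ← h1, mul_comm q a, mul_assoc]
      rfl
    · exact Nat.le_of_dvd (Nat.pos_of_ne_zero hM0) ⟨a * m, by rw [← h1, mul_assoc]⟩
    · have h2 : padicValNat q m < m := by
        have : Fact q.Prime := ⟨hq⟩
        refine lt_of_lt_of_le (Nat.lt_pow_self hq.one_lt) (Nat.le_of_dvd m.pos pow_padicValNat_dvd)
      exact h2.le.trans (Nat.le_of_dvd (Nat.pos_of_ne_zero hM0) hmM)

/-- If `K c + t = 0` with `K ≠ 0`, then the type of `c` is determined by this equation. -/
theorem agreeOn_of_root (hD : IsRegular D) (hD' : IsRegular D') (hl : IsInvariantLt D)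
    (hl' : IsInvariantLt D') (hs : SameAtoms D D' α β) {K : ℕ} (hK : K ≠ 0) {c : D.G} {d : D'.G}
    {t : F} (hc : K • c + α t = 0) (hd : K • d + β t = 0) (Q : Finset (Nat.Primes × ℤ))
    (M : Finset ℕ+) (k : ℤ) (s : F) :
    AgreeOn (D := D) (D' := D') Q M (k • c + α s) (k • d + β s) := by
  have e : K • (k • c + α s) = α (K • s - k • t) := by
    rw [map_sub, map_nsmul, map_zsmul, smul_add, smul_comm, eq_neg_of_add_eq_zero_left hc, smul_neg]
    abel
  have e' : K • (k • d + β s) = β (K • s - k • t) := by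
    rw [map_sub, map_nsmul, map_zsmul, smul_add, smul_comm, eq_neg_of_add_eq_zero_left hd, smul_neg]
    abel
  refine ⟨⟨fun h => ?_, fun h => ?_⟩, fun q _ => ?_, fun m _ => ?_, ?_⟩
  · rw [h, smul_zero] at e
    exact hD'.torsionFree K _ hK (e'.trans ((hs.eq_iff _).1 e.symm))
  · rw [h, smul_zero] at e'
    exact hD.torsionFree K _ hK (e.trans ((hs.eq_iff _).2 e'.symm))
  · rw [← hD.smul_mem_iff q.1 K hK, ← hD'.smul_mem_iff q.1 K hK, e, e', hs.memU_iff]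
  · rw [← hD.smul_mem_P_iff K (Nat.pos_of_ne_zero hK), ← hD'.smul_mem_P_iff K
      (Nat.pos_of_ne_zero hK), e, e', hs.memP_iff]
  · rw [← hl.smul_iff K _ hK, ← hl'.smul_iff K _ hK, e, e']
    simpa using hs.lt_iff 0 (K • s - k • t)

/-- Passing from an element to a multiple. -/
theorem AgreeOn.of_smul (hD : IsRegular D) (hD' : IsRegular D') (hl : IsInvariantLt D)
    (hl' : IsInvariantLt D') {Q : Finset (Nat.Primes × ℤ)} {M : Finset ℕ+} {y : D.G} {y' : D'.G}
    {r : ℤ} (hr : r ≠ 0) (h0 : r • y = 0 ↔ r • y' = 0)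
    (hU : ∀ q ∈ Q, (r • y ∈ D.U q.1 (q.2 + padicValNat (q.1 : ℕ) r.natAbs) ↔
      r • y' ∈ D'.U q.1 (q.2 + padicValNat (q.1 : ℕ) r.natAbs)))
    (hP : ∀ m ∈ M, (r • y ∈ D.P (⟨r.natAbs, Int.natAbs_pos.2 hr⟩ * m) ↔
      r • y' ∈ D'.P (⟨r.natAbs, Int.natAbs_pos.2 hr⟩ * m)))
    (hlt : D.lt 0 (r • y) ↔ D'.lt 0 (r • y')) (hlt' : D.lt 0 (-(r • y)) ↔ D'.lt 0 (-(r • y'))) :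
    AgreeOn (D := D) (D' := D') Q M y y' := by
  have hr0 : r.natAbs ≠ 0 := Int.natAbs_ne_zero.2 hr
  have key : (∀ x : D.G, r.natAbs • x = r • x) ∧ (∀ x : D'.G, r.natAbs • x = r • x) ∨
      (∀ x : D.G, r.natAbs • x = -(r • x)) ∧ (∀ x : D'.G, r.natAbs • x = -(r • x)) := by
    rcases Int.natAbs_eq r with h | h
    · refine Or.inl ⟨fun x => ?_, fun x => ?_⟩ <;> · conv_rhs => rw [h, natCast_zsmul]
    · refine Or.inr ⟨fun x => ?_, fun x => ?_⟩ <;>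
      · conv_rhs => rw [h, neg_smul, natCast_zsmul, neg_neg]
  refine ⟨⟨fun h => ?_, fun h => ?_⟩, fun q hq => ?_, fun m hm => ?_, ?_⟩
  · have h1 := h0.1 (by rw [h, smul_zero])
    refine hD'.torsionFree _ y' hr0 ?_
    rcases key with ⟨-, h2⟩ | ⟨-, h2⟩ <;> rw [h2, h1]
    rw [neg_zero]
  · have h1 := h0.2 (by rw [h, smul_zero])
    refine hD.torsionFree _ y hr0 ?_
    rcases key with ⟨h2, -⟩ | ⟨h2, -⟩ <;> rw [h2, h1]
    rw [neg_zero]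
  · rw [← hD.smul_mem_iff q.1 _ hr0, ← hD'.smul_mem_iff q.1 _ hr0]
    rcases key with ⟨h2, h3⟩ | ⟨h2, h3⟩ <;> rw [h2, h3]
    · exact hU q hq
    · rw [hD.neg_mem_iff, hD'.neg_mem_iff]
      exact hU q hq
  · rw [← hD.smul_mem_P_iff _ (Int.natAbs_pos.2 hr), ← hD'.smul_mem_P_iff _ (Int.natAbs_pos.2 hr)]
    rcases key with ⟨h2, h3⟩ | ⟨h2, h3⟩ <;> rw [h2, h3]
    · exact hP m hm
    · rw [hD.neg_mem_P, hD'.neg_mem_P]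
      exact hP m hm
  · rw [← hl.smul_iff _ y hr0, ← hl'.smul_iff _ y' hr0]
    rcases key with ⟨h2, h3⟩ | ⟨h2, h3⟩ <;> rw [h2, h3]
    · exact hlt
    · exact hlt'

/-- The one-point extension property, for finitely many linear forms `k x + t` and finitely many
indices of the predicates. -/
theorem exists_agreeOn (hD : IsRegular D) (hD' : IsRegular D') (hl : IsInvariantLt D)
    (hl' : IsInvariantLt D') (hs : SameAtoms D D' α β) (hroot : RootTransfer α β)
    (hloc : LocalTransfer α β) (hplace : PlaceTransfer α β) (c : D.G) (W : Finset (ℤ × F))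
    (Q : Finset (Nat.Primes × ℤ)) (M : Finset ℕ+) :
    ∃ d : D'.G, ∀ w ∈ W, AgreeOn (D := D) (D' := D') Q M (w.1 • c + α w.2) (w.1 • d + β w.2) := by
  classical
  by_cases halg : ∃ w ∈ W, w.1 ≠ 0 ∧ w.1 • c + α w.2 = 0
  · obtain ⟨⟨k, t⟩, -, hk, hkt⟩ := halg
    obtain ⟨K, hK, t', ht'⟩ : ∃ K : ℕ, K ≠ 0 ∧ ∃ t' : F, K • c + α t' = 0 := by
      refine ⟨k.natAbs, Int.natAbs_ne_zero.2 hk, ?_⟩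
      rcases Int.natAbs_eq k with h | h
      · refine ⟨t, ?_⟩
        dsimp only at hkt
        rwa [h, natCast_zsmul] at hkt
      · refine ⟨-t, ?_⟩
        dsimp only at hkt
        rw [h, neg_smul, natCast_zsmul] at hkt
        rw [map_neg, ← neg_eq_zero, ← hkt]
        abel
    obtain ⟨d, hd⟩ := hroot K hK t' ⟨c, ht'⟩
    exact ⟨d, fun w _ => agreeOn_of_root hD hD' hl hl' hs hK ht' hd Q M w.1 w.2⟩
  · push Not at halg
    -- The product `K` of the coefficients is a common coefficient: `r w * w.1 = K`.
    set W₀ := W.filter fun w => w.1 ≠ 0 with hW₀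
    set K : ℕ := ∏ w ∈ W₀, w.1.natAbs with hKdef
    have hK : K ≠ 0 := Finset.prod_ne_zero_iff.2 fun w hw =>
      Int.natAbs_ne_zero.2 (Finset.mem_filter.1 hw).2
    have hr : ∀ w : ℤ × F, ∃ r : ℤ, w ∈ W₀ → r * w.1 = K := by
      intro w
      by_cases hw : w ∈ W₀
      · obtain ⟨r, hr⟩ : w.1 ∣ (K : ℤ) :=
          Int.natAbs_dvd_natAbs.1 (by simpa using Finset.dvd_prod_of_mem _ hw)
        exact ⟨r, fun _ => by rw [hr, mul_comm]⟩
      · exact ⟨0, fun h => absurd h hw⟩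
    choose r hr using hr
    have hr0 : ∀ w ∈ W₀, r w ≠ 0 := by
      intro w hw h0
      have := hr w hw
      rw [h0, zero_mul] at this
      exact hK (by exact_mod_cast this.symm)
    -- All indices `r w * m` divide `N`. The conditions indexed by `Q₂` recover `P_{r w * m}` from
    -- `P_N`, and those indexed by `Q₁` are the conditions from `Q` after multiplication by `r w`.
    set N : ℕ := (∏ w ∈ W₀, (r w).natAbs) * ∏ m ∈ M, (m : ℕ) with hN
    have hN0 : 0 < N := by
      refine Nat.pos_of_ne_zero (mul_ne_zero ?_ ?_)
      · exact Finset.prod_ne_zero_iff.2 fun w hw => Int.natAbs_ne_zero.2 (hr0 w hw)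
      · exact Finset.prod_ne_zero_iff.2 fun m _ => m.ne_zero
    set Q₁ : Finset (Nat.Primes × ℤ) :=
      (W₀ ×ˢ Q).image fun x =>
        (x.2.1, x.2.2 + (padicValNat (x.2.1 : ℕ) (r x.1).natAbs : ℤ)) with hQ₁
    set Q₂ : Finset (Nat.Primes × ℤ) :=
      (((Finset.range (N + 1)).subtype Nat.Prime : Finset Nat.Primes) ×ˢ Finset.range (N + 1)).image
        fun x => (x.1, 2 + (x.2 : ℤ)) with hQ₂
    have hrw : ∀ w ∈ W₀, ∀ (G : Type) [AddCommGroup G] (x : G) (γ : F →+ G),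
        r w • (w.1 • x + γ w.2) = K • x + γ (r w • w.2) := by
      intro w hw G _ x γ
      rw [smul_add, ← mul_smul, hr w hw, natCast_zsmul, map_zsmul]
    obtain ⟨d, hd⟩ := exists_solution_of_common hD hs hloc hplace K hK ⟨N, hN0⟩ c
      (W₀.image fun w => r w • w.2) (Q₁ ∪ Q₂) (fun t ht => by
        obtain ⟨w, hw, rfl⟩ := Finset.mem_image.1 ht
        rw [← hrw w hw]
        intro h0
        refine halg w (Finset.mem_filter.1 hw).1 (Finset.mem_filter.1 hw).2 ?_
        exact hD.eq_zero_of_zsmul (hr0 w hw) h0)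
    refine ⟨d, fun w hw => ?_⟩
    by_cases hw0 : w.1 = 0
    · rw [hw0, zero_smul, zero_smul, zero_add, zero_add]
      exact ⟨hs.eq_iff _, fun q _ => hs.memU_iff _ _ _, fun m _ => hs.memP_iff _ _,
        by simpa using hs.lt_iff 0 w.2⟩
    · have hwW : w ∈ W₀ := Finset.mem_filter.2 ⟨hw, hw0⟩
      obtain ⟨h1, h2, h3, h4, h5⟩ := hd _ (Finset.mem_image_of_mem _ hwW)
      simp only [← hrw w hwW] at h1 h2 h3 h4 h5
      refine AgreeOn.of_smul hD hD' hl hl' (hr0 w hwW) (iff_of_false ?_ h1) (fun q hq => ?_)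
        (fun m hm => ?_) h2 h3
      · intro h0
        refine halg w hw hw0 ?_
        exact hD.eq_zero_of_zsmul (hr0 w hwW) h0
      · exact h5 _ (Finset.mem_union_left _ (Finset.mem_image.2
          ⟨(w, q), Finset.mem_product.2 ⟨hwW, hq⟩, rfl⟩))
      · obtain ⟨a, ha⟩ : (r w).natAbs * (m : ℕ) ∣ N :=
          mul_dvd_mul (Finset.dvd_prod_of_mem (fun w => (r w).natAbs) hwW)
            (Finset.dvd_prod_of_mem (fun m : ℕ+ => (m : ℕ)) hm)
        refine memP_iff_of_multiple hD hD' N (fun p j hp hj => ?_) a _ ⟨N, hN0⟩ rfl ?_ h4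
        · exact h5 (p, 2 + (j : ℤ)) (Finset.mem_union_right _ (Finset.mem_image.2
            ⟨(p, j), Finset.mem_product.2 ⟨Finset.mem_subtype.2 (Finset.mem_range.2
              (Nat.lt_succ_of_le hp)), Finset.mem_range.2 (Nat.lt_succ_of_le hj)⟩, rfl⟩))
        · exact (mul_comm _ _).trans ha.symm

end Core

end SqfQE

namespace SqfQE

open FirstOrder.Language

/-! ### The transfer properties in the three kinds of models -/

section Transfers

variable {D D' : GroupData} {F : Type} [AddCommGroup F] {α : F →+ D.G} {β : F →+ D'.G}

/-- Divisibility by `K` can be tested one prime at a time. -/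
theorem IsBaseZ.exists_eq_smul (h : IsBaseZ D.U D.P) (K : ℕ) : K ≠ 0 → ∀ x : D.G,
    (∀ p : Nat.Primes, x ∈ D.U p (padicValNat (p : ℕ) K)) → ∃ y, x = K • y := by
  induction K using induction_on_primes with
  | zero => exact fun h0 => absurd rfl h0
  | one => exact fun _ x _ => ⟨x, by simp⟩
  | prime_mul q a hq ih =>
    intro hqa x hx
    have ha : a ≠ 0 := fun h0 => hqa (by simp [h0])
    have hV : ∀ p : Nat.Primes, padicValNat (p : ℕ) (q * a) =
        padicValNat (p : ℕ) q + padicValNat (p : ℕ) a := by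
      intro p
      have : Fact (p : ℕ).Prime := ⟨p.2⟩
      exact padicValNat.mul hq.ne_zero ha
    have : Fact q.Prime := ⟨hq⟩
    obtain ⟨y, rfl⟩ := h.isValued.exists_smul ⟨q, hq⟩ _ x (by
      have h1 := hV ⟨q, hq⟩
      have h2 : padicValNat q q = 1 := padicValNat_self
      change padicValNat q (q * a) = padicValNat q q + padicValNat q a at h1
      change (0 : ℤ) < padicValNat q (q * a)
      omega) (hx ⟨q, hq⟩)
    obtain ⟨z, rfl⟩ := ih ha y fun p => by
      have h1 := hx p
      rw [hV, Nat.cast_add, add_comm] at h1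
      exact (h.isValued.smul_mem_iff p q hq.ne_zero _ y).1 h1
    exact ⟨z, by rw [mul_smul]⟩

theorem rootTransfer_Z (h : IsBaseZ D.U D.P) (h' : IsBaseZ D'.U D'.P)
    (hs : SameAtoms D D' α β) : RootTransfer α β := by
  rintro K hK t ⟨c, hc⟩
  obtain ⟨y, hy⟩ := h'.exists_eq_smul K hK (β t) fun p => by
    rw [← hs.memU_iff, eq_neg_of_add_eq_zero_right hc, h.isValued.neg_mem_iff]
    have := h.isValued.smul_mem_iff p K hK 0 c
    rw [zero_add] at this
    rw [this, h.U_nonpos p 0 le_rfl]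
    trivial
  exact ⟨-y, by rw [hy, smul_neg, neg_add_cancel]⟩

/-- Modulo `p^L` every element is congruent to an integer. -/
theorem localTransfer_Z (h : IsBaseZ D.U D.P)
    (hs : SameAtoms D D' α β) : LocalTransfer α β := by
  intro p K _ c S Q
  obtain ⟨L, hL⟩ : ∃ L : ℕ, ∀ l ∈ Q, l ≤ L := by
    obtain ⟨M, hM⟩ := Q.bddAbove
    exact ⟨M.toNat, fun l hl => (hM hl).trans (Int.self_le_toNat M)⟩
  obtain ⟨y, j, hyj⟩ := divMod_of_equiv_int h.elemEquiv ((p : ℕ) ^ L) (pow_pos p.2.pos _) c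
  obtain ⟨e, he, he'⟩ := hs.one
  refine ⟨j • 1, fun t _ l hl => ?_⟩
  have h1 : K • c + α t = (p : ℕ) ^ L • (K • y) + α (K • j • e + t) := by
    rw [hyj, map_add, map_nsmul, map_nsmul, he, smul_add, smul_comm K, add_assoc]
  have h2 : K • j • (1 : D'.G) + β t = β (K • j • e + t) := by
    rw [map_add, map_nsmul, map_nsmul, he']
  rw [h1, h2, ← hs.memU_iff]
  refine h.isValued.add_mem_iff p l (h.isValued.mem_of_le p (hL l hl) ?_)
  exact (h.mem_U_iff p L _).2 ⟨_, by rw [Int.toNat_natCast]⟩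

theorem rootTransfer_Q (h' : IsBaseQ D'.U D'.P) : RootTransfer α β := by
  rintro K hK t -
  obtain ⟨y, hy⟩ := divisible_of_equiv_rat h'.elemEquiv K hK (β t)
  exact ⟨-y, by rw [hy, smul_neg, neg_add_cancel]⟩

/-- The subgroup `U_{p,l}` has infinite index. -/
theorem IsBaseQ.exists_notMem_translates (h : IsBaseQ D.U D.P) (hV : IsValued D) (p : Nat.Primes)
    (l : ℤ) (S : Finset D.G) : ∃ x : D.G, ∀ s ∈ S, x + s ∉ D.U p l := by
  by_contra hcon
  push Not at hcon
  -- Otherwise two of the elements `g i`, which have pairwise distinct values `l - i - 1`, are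
  -- congruent modulo `U_{p,l}`.
  choose g hg hg' using fun i : ℕ => (h.cyclic p (l - i - 1)).1
  choose s hs hsU using fun i : ℕ => hcon (g i)
  obtain ⟨i, j, hij, he⟩ : ∃ i j : ℕ, i < j ∧ s i = s j := by
    obtain ⟨i, j, hij, he⟩ := Finite.exists_ne_map_eq_of_infinite
      fun i : ℕ => (⟨s i, hs i⟩ : S)
    have he' : s i = s j := congrArg Subtype.val he
    rcases lt_or_gt_of_ne hij with h1 | h1
    · exact ⟨i, j, h1, he'⟩
    · exact ⟨j, i, h1, he'.symm⟩
  refine hg' j ?_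
  have h1 : g j = g i + (g j + s j - (g i + s i)) := by rw [he]; abel
  rw [h1]
  refine hV.add_mem p _ _ _ (hV.mem_of_le p (by omega) (hg i))
    (hV.mem_of_le p (by omega) (hV.sub_mem p l (hsU j) (hsU i)))

/-- Let `y = K c`. If some `y + α t` lies in all relevant `U_{p,l}`, then `-β t` does the same as
`y`. If the largest value of the elements `y + α t` is a smaller `l`, attained at `t`, then no
element of `α(F)` has value `l`, since `U_{p,l} / U_{p,l+1}` is cyclic of order `p` and the value of
`y + α t` could be increased; so `u' - β t` does the same as `y`, for any `u'` of value `l`. If no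
`y + α t` lies in any `U_{p,l}`, one uses that the subgroups `U_{p,l}` have infinite index. -/
theorem localTransfer_Q (h : IsBaseQ D.U D.P) (h' : IsBaseQ D'.U D'.P) (hV : IsValued D)
    (hV' : IsValued D') (hs : SameAtoms D D' α β) : LocalTransfer α β := by
  classical
  intro p K hK c S Q
  suffices hy : ∃ y' : D'.G, ∀ t ∈ S, ∀ l ∈ Q, K • c + α t ∈ D.U p l ↔ y' + β t ∈ D'.U p l by
    obtain ⟨y', hy'⟩ := hy
    obtain ⟨d, rfl⟩ := divisible_of_equiv_rat h'.elemEquiv K hK y'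
    exact ⟨d, hy'⟩
  generalize K • c = y
  obtain ⟨L, hL⟩ := Q.bddAbove
  obtain ⟨L', hL'⟩ := Q.bddBelow
  -- For values of `y + α t₀` at least `l`, the two sides can be compared.
  have hcmp : ∀ (t₀ t : F) (l : ℤ) (u' : D'.G), y + α t₀ ∈ D.U p l → u' ∈ D'.U p l →
      (y + α t ∈ D.U p l ↔ (u' - β t₀) + β t ∈ D'.U p l) := by
    intro t₀ t l u' hu hu'
    rw [show y + α t = (y + α t₀) + α (t - t₀) by rw [map_sub]; abel,
      show u' - β t₀ + β t = u' + β (t - t₀) by rw [map_sub]; abel,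
      hV.add_mem_iff p l hu, hV'.add_mem_iff p l hu', hs.memU_iff]
  by_cases hany : ∃ l, ∃ t, y + α t ∈ D.U p l
  · by_cases hfull : ∃ t, y + α t ∈ D.U p L
    · obtain ⟨t₀, ht₀⟩ := hfull
      refine ⟨0 - β t₀, fun t _ l hl => hcmp t₀ t l 0 ?_ (hV'.zero_mem p l)⟩
      exact hV.mem_of_le p (hL hl) ht₀
    · obtain ⟨l₀, ⟨t₀, ht₀⟩, hmax⟩ := Int.exists_greatest_of_bdd
        (P := fun l => ∃ t, y + α t ∈ D.U p l) ⟨L, fun l ⟨t, ht⟩ => by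
          by_contra hlt
          exact hfull ⟨t, hV.mem_of_le p (by omega) ht⟩⟩ hany
      have hsucc : ∀ t, y + α t ∉ D.U p (l₀ + 1) := fun t ht => by
        have := hmax _ ⟨t, ht⟩
        omega
      obtain ⟨u', hu', hu''⟩ := (h'.cyclic p l₀).1
      refine ⟨u' - β t₀, fun t _ l _ => ?_⟩
      rcases le_or_gt l l₀ with hl | hl
      · exact hcmp t₀ t l u' (hV.mem_of_le p hl ht₀) (hV'.mem_of_le p hl hu')
      · refine iff_of_false (fun ht => hsucc t (hV.mem_of_le p (by omega) ht)) fun ht => ?_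
        have ht1 : u' + β (t - t₀) ∈ D'.U p (l₀ + 1) := by
          have h1 := hV'.mem_of_le p (show l₀ + 1 ≤ l by omega) ht
          rwa [show u' - β t₀ + β t = u' + β (t - t₀) by rw [map_sub]; abel] at h1
        have h1 : α (t - t₀) ∈ D.U p l₀ := by
          rw [hs.memU_iff, ← hV'.add_mem_iff p l₀ hu']
          exact hV'.succ_subset p l₀ _ ht1
        have h2 : α (t - t₀) ∉ D.U p (l₀ + 1) := by
          rw [hs.memU_iff]
          intro h2
          refine hu'' ?_
          have := hV'.sub_mem p _ ht1 h2
          rwa [add_sub_cancel_right] at this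
        obtain ⟨j, hj⟩ := (h.cyclic p l₀).2 _ h1 h2 _ ht₀
        refine hsucc (t₀ - j • (t - t₀)) ?_
        rw [map_sub, map_zsmul, ← add_sub_assoc]
        exact hj
  · push Not at hany
    obtain ⟨y', hy'⟩ := h'.exists_notMem_translates hV' p L' (S.image β)
    refine ⟨y', fun t ht l hl => iff_of_false (hany l t) fun hU => ?_⟩
    exact hy' (β t) (Finset.mem_image_of_mem β ht) (hV'.mem_of_le p (hL' hl) hU)

/-- Without an order it suffices to avoid the finitely many zeros of the forms `K x + t`. -/
theorem placeTransfer_of_isGeneric (hV' : IsValued D') (hg : IsGeneric D'.U D'.P)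
    (hlt : ∀ a b, ¬D.lt a b) (hlt' : ∀ a b, ¬D'.lt a b) : PlaceTransfer α β := by
  intro n n' π z z' hsat K hK c S _
  have hfin : (⋃ t ∈ S, {d : D'.G | K • d + β t = 0}).Finite := by
    refine S.finite_toSet.biUnion fun t _ => Set.Subsingleton.finite fun a ha b hb => ?_
    refine hV'.nsmul_inj hK ?_
    have ha' : K • a + β t = 0 := ha
    have hb' : K • b + β t = 0 := hb
    exact add_right_cancel (ha'.trans hb'.symm)
  obtain ⟨d, hd, hd'⟩ := (hg n n' π z z' hsat).exists_notMem_finite hfin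
  refine ⟨d, hd, fun t ht => ⟨fun h0 => hd' (Set.mem_biUnion ht h0), ?_, ?_⟩⟩
  · exact iff_of_false (hlt _ _) (hlt' _ _)
  · exact iff_of_false (hlt _ _) (hlt' _ _)

end Transfers

section Ordered

/-- The relation `<` is a strict total order invariant under translations, with `0 < 1`. -/
structure IsOrderedLt (D : GroupData) : Prop extends IsInvariantLt D where
  irrefl : ∀ a, ¬D.lt a a
  trans : ∀ a b c, D.lt a b → D.lt b c → D.lt a c
  total : ∀ a b, D.lt a b ∨ a = b ∨ D.lt b a
  one_pos : D.lt 0 1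

/-- The group `ℚ` with its order. -/
@[reducible] def ratData : GroupData := ⟨ℚ, fun a b => a < b, fun _ _ => ∅, fun _ => ∅⟩

theorem Def.lt {L : FirstOrder.Language.{0, 0}} [LtLanguage L] {X : Type}
    {f g : ∀ D : GroupData, (X → D.G) → D.G} (hf : TermDef L f) (hg : TermDef L g) :
    Def L fun D v => D.lt (f D v) (g D v) :=
  (QFDef.lt hf hg).def

theorem def_sub_iff : Def L0lt (X := Empty) fun D _ =>
    ∀ a b : D.G, D.lt a b ↔ D.lt 0 (b + -a) :=
  Def.all (R := fun D _ a => ∀ b : D.G, D.lt a b ↔ D.lt 0 (b + -a)) <|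
    Def.all (R := fun D v b => D.lt (v (Sum.inr ())) b ↔ D.lt 0 (b + -v (Sum.inr ()))) <|
      (Def.lt (TermDef.var (Sum.inl (Sum.inr ()))) (TermDef.var _)).iff
        (Def.lt TermDef.zero ((TermDef.var _).add (TermDef.var (Sum.inl (Sum.inr ()))).neg))

theorem def_smul_iff (n : ℕ) : Def L0lt (X := Empty) fun D _ =>
    ∀ a : D.G, D.lt 0 (n • a) ↔ D.lt 0 a :=
  Def.all ((Def.lt TermDef.zero ((TermDef.var _).nsmul n)).iff
    (Def.lt TermDef.zero (TermDef.var _)))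

theorem def_irrefl : Def L0lt (X := Empty) fun D _ => ∀ a : D.G, ¬D.lt a a :=
  Def.all (Def.lt (TermDef.var _) (TermDef.var _)).not

theorem def_trans : Def L0lt (X := Empty) fun D _ =>
    ∀ a b c : D.G, D.lt a b → D.lt b c → D.lt a c :=
  Def.all (R := fun D _ a => ∀ b c : D.G, D.lt a b → D.lt b c → D.lt a c) <|
    Def.all (R := fun D v b => ∀ c : D.G, D.lt (v (Sum.inr ())) b → D.lt b c →
      D.lt (v (Sum.inr ())) c) <|
    Def.all (R := fun D v c => D.lt (v (Sum.inl (Sum.inr ()))) (v (Sum.inr ())) →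
      D.lt (v (Sum.inr ())) c → D.lt (v (Sum.inl (Sum.inr ()))) c) <|
    (Def.lt (TermDef.var (Sum.inl (Sum.inl (Sum.inr ())))) (TermDef.var (Sum.inl (Sum.inr ())))).imp
      ((Def.lt (TermDef.var (Sum.inl (Sum.inr ()))) (TermDef.var _)).imp
        (Def.lt (TermDef.var (Sum.inl (Sum.inl (Sum.inr ())))) (TermDef.var _)))

theorem def_total : Def L0lt (X := Empty) fun D _ =>
    ∀ a b : D.G, ¬D.lt a b → ¬a = b → D.lt b a :=
  Def.all (R := fun D _ a => ∀ b : D.G, ¬D.lt a b → ¬a = b → D.lt b a) <|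
    Def.all (R := fun D v b => ¬D.lt (v (Sum.inr ())) b → ¬v (Sum.inr ()) = b →
      D.lt b (v (Sum.inr ()))) <|
    (Def.lt (TermDef.var (Sum.inl (Sum.inr ()))) (TermDef.var _)).not.imp
      ((Def.eq (TermDef.var (Sum.inl (Sum.inr ()))) (TermDef.var _)).not.imp
        (Def.lt (TermDef.var _) (TermDef.var (Sum.inl (Sum.inr ())))))

theorem def_one_pos : Def L0lt (X := Empty) fun D _ => D.lt 0 1 :=
  Def.lt TermDef.zero TermDef.one

theorem IsBaseQlt.isOrderedLt {D : GroupData} (h : IsBaseQlt D.lt D.U D.P) : IsOrderedLt D := by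
  have key : ∀ {Φ : GroupData → Prop}, Def L0lt (X := Empty) (fun D _ => Φ D) →
      Φ ratData → Φ D := fun hΦ =>
    (Def.iff_of_elementarilyEquivalent hΦ D ratData h.elemEquiv_lt).2
  refine ⟨⟨fun a b => ?_, fun n a hn => ?_⟩, ?_, ?_, fun a b => ?_, ?_⟩
  · rw [sub_eq_add_neg]
    refine key def_sub_iff (fun (a b : ℚ) => ?_) a b
    change a < b ↔ 0 < b + -a
    constructor <;> intro h <;> linarith
  · refine key (def_smul_iff n) (fun (a : ℚ) => ?_) a
    change 0 < n • a ↔ 0 < a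
    rw [nsmul_eq_mul]
    exact mul_pos_iff_of_pos_left (by positivity)
  · exact key def_irrefl fun (a : ℚ) => lt_irrefl a
  · exact key def_trans fun (a b c : ℚ) => lt_trans
  · have := key def_total (fun (a b : ℚ) h1 h2 => lt_of_le_of_ne (not_lt.1 h1) (Ne.symm h2)) a b
    tauto
  · exact key def_one_pos (zero_lt_one : (0 : ℚ) < 1)

variable {D D' : GroupData} {F : Type} [AddCommGroup F] {α : F →+ D.G} {β : F →+ D'.G}

theorem IsOrderedLt.exists_greatest (h : IsOrderedLt D) {S : Finset D.G} (hS : S.Nonempty) :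
    ∃ b ∈ S, ∀ a ∈ S, a = b ∨ D.lt a b := by
  classical
  induction hS using Finset.Nonempty.cons_induction with
  | singleton a => exact ⟨a, by simp⟩
  | cons a s ha hs ih =>
    obtain ⟨b, hb, hmax⟩ := ih
    rcases h.total a b with hab | rfl | hba
    · refine ⟨b, by simp [hb], fun x hx => ?_⟩
      rcases Finset.mem_cons.1 hx with rfl | hx
      · exact Or.inr hab
      · exact hmax x hx
    · exact absurd hb ha
    · refine ⟨a, by simp, fun x hx => ?_⟩
      rcases Finset.mem_cons.1 hx with rfl | hx
      · exact Or.inl rfl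
      · rcases hmax x hx with rfl | hxb
        · exact Or.inr hba
        · exact Or.inr (h.trans _ _ _ hxb hba)

theorem IsOrderedLt.lt_add_one (h : IsOrderedLt D) (a : D.G) : D.lt a (a + 1) := by
  rw [h.sub_iff, add_sub_cancel_left]
  exact h.one_pos

theorem IsOrderedLt.neg_lt_neg_iff (h : IsOrderedLt D) (a b : D.G) : D.lt (-a) (-b) ↔ D.lt b a := by
  rw [h.sub_iff, h.sub_iff b]
  rw [neg_sub_neg]

theorem IsOrderedLt.exists_least (h : IsOrderedLt D) {S : Finset D.G} (hS : S.Nonempty) :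
    ∃ b ∈ S, ∀ a ∈ S, a = b ∨ D.lt b a := by
  classical
  obtain ⟨b, hb, hmax⟩ := h.exists_greatest (hS.image (fun x => -x))
  obtain ⟨x, hx, rfl⟩ := Finset.mem_image.1 hb
  refine ⟨x, hx, fun a ha => ?_⟩
  rcases hmax (-a) (Finset.mem_image_of_mem _ ha) with e | hlt
  · exact Or.inl (neg_injective e)
  · exact Or.inr ((h.neg_lt_neg_iff a x).1 hlt)

/-- Finitely many lower and upper bounds define a set containing an open interval. -/
theorem IsOrderedLt.exists_interval (h : IsOrderedLt D) (A B : Finset D.G)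
    (hAB : ∀ a ∈ A, ∀ b ∈ B, D.lt a b) :
    ∃ x y, D.lt x y ∧ (∀ a ∈ A, ∀ d, D.lt x d → D.lt a d) ∧ ∀ b ∈ B, ∀ d, D.lt d y → D.lt d b := by
  have hup : A.Nonempty → ∃ x ∈ A, ∀ a ∈ A, ∀ d, D.lt x d → D.lt a d := fun hA => by
    obtain ⟨x, hx, hmax⟩ := h.exists_greatest hA
    refine ⟨x, hx, fun a ha d hd => ?_⟩
    rcases hmax a ha with rfl | hlt
    · exact hd
    · exact h.trans _ _ _ hlt hd
  have hdown : B.Nonempty → ∃ y ∈ B, ∀ b ∈ B, ∀ d, D.lt d y → D.lt d b := fun hB => by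
    obtain ⟨y, hy, hmin⟩ := h.exists_least hB
    refine ⟨y, hy, fun b hb d hd => ?_⟩
    rcases hmin b hb with rfl | hlt
    · exact hd
    · exact h.trans _ _ _ hd hlt
  rcases A.eq_empty_or_nonempty with rfl | hA <;> rcases B.eq_empty_or_nonempty with rfl | hB
  · exact ⟨0, 1, h.one_pos, by simp, by simp⟩
  · obtain ⟨y, -, hy⟩ := hdown hB
    exact ⟨y - 1, y, by simpa using h.lt_add_one (y - 1), by simp, hy⟩
  · obtain ⟨x, -, hx⟩ := hup hA
    exact ⟨x, x + 1, h.lt_add_one x, hx, by simp⟩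
  · obtain ⟨x, hxA, hx⟩ := hup hA
    obtain ⟨y, hyB, hy⟩ := hdown hB
    exact ⟨x, y, hAB x hxA y hyB, hx, hy⟩

theorem IsOrderedLt.add_pos (h : IsOrderedLt D) {a b : D.G} (ha : D.lt 0 a) (hb : D.lt 0 b) :
    D.lt 0 (a + b) := by
  refine h.trans _ _ _ ha ((h.sub_iff _ _).2 ?_)
  rwa [add_sub_cancel_left]

theorem IsOrderedLt.not_neg_pos (h : IsOrderedLt D) {a : D.G} (ha : D.lt 0 a) : ¬D.lt 0 (-a) :=
  fun hb => h.irrefl 0 (by simpa using h.add_pos ha hb)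

theorem IsOrderedLt.pos_or_neg (h : IsOrderedLt D) {a : D.G} (ha : a ≠ 0) :
    D.lt 0 a ∨ D.lt 0 (-a) := by
  rcases h.total 0 a with h1 | h1 | h1
  · exact Or.inl h1
  · exact absurd h1.symm ha
  · rw [h.sub_iff, zero_sub] at h1
    exact Or.inr h1

/-- The sign conditions on the forms `K x + t` say that `x` lies between the lower bounds `-t / K`
for the positive values and the upper bounds `-t / K` for the negative ones. -/
theorem placeTransfer_of_isGenericLt (h : IsOrderedLt D) (h' : IsOrderedLt D')
    (hB' : IsBaseQ D'.U D'.P) (hs : SameAtoms D D' α β)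
    (hg : IsGenericLt D'.lt D'.U D'.P) : PlaceTransfer α β := by
  classical
  intro n n' π z z' hsat K hK c S hne
  choose δ hδ using fun t : F => divisible_of_equiv_rat hB'.elemEquiv K hK (-β t)
  have hKδ : ∀ d t, K • (d - δ t) = K • d + β t := fun d t => by
    rw [smul_sub, ← hδ, sub_neg_eq_add]
  obtain ⟨x, y, hxy, hx, hy⟩ := h'.exists_interval
    ((S.filter fun t => D.lt 0 (K • c + α t)).image δ)
    ((S.filter fun t => D.lt 0 (-(K • c + α t))).image δ) (by
      intro a ha b hb
      obtain ⟨t, ht, rfl⟩ := Finset.mem_image.1 ha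
      obtain ⟨s, hs', rfl⟩ := Finset.mem_image.1 hb
      have h1 := h.add_pos (Finset.mem_filter.1 ht).2 (Finset.mem_filter.1 hs').2
      rw [show K • c + α t + -(K • c + α s) = α t - α s by abel, ← h.sub_iff, hs.lt_iff,
        h'.sub_iff] at h1
      rw [h'.sub_iff, ← h'.smul_iff K _ hK, hKδ, ← hδ, neg_add_eq_sub]
      exact h1)
  obtain ⟨d, hxd, hdy, hd⟩ := hg n n' π z z' hsat x y hxy
  have hpos : ∀ t ∈ S, D.lt 0 (K • c + α t) → D'.lt 0 (K • d + β t) := fun t ht hlt => by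
    rw [← hKδ, h'.smul_iff K _ hK, ← h'.sub_iff]
    exact hx _ (Finset.mem_image_of_mem δ (Finset.mem_filter.2 ⟨ht, hlt⟩)) d hxd
  have hneg : ∀ t ∈ S, D.lt 0 (-(K • c + α t)) → D'.lt 0 (-(K • d + β t)) := fun t ht hlt => by
    rw [← hKδ, ← smul_neg, h'.smul_iff K _ hK, neg_sub, ← h'.sub_iff]
    exact hy _ (Finset.mem_image_of_mem δ (Finset.mem_filter.2 ⟨ht, hlt⟩)) d hdy
  refine ⟨d, hd, fun t ht => ?_⟩
  rcases h.pos_or_neg (hne t ht) with h1 | h1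
  · have h2 := hpos t ht h1
    refine ⟨fun h0 => h'.irrefl 0 (h0 ▸ h2), iff_of_true h1 h2,
      iff_of_false (h.not_neg_pos h1) (h'.not_neg_pos h2)⟩
  · have h2 := hneg t ht h1
    refine ⟨fun h0 => h'.irrefl 0 ?_, iff_of_false (fun h3 => h.not_neg_pos h3 h1)
      (fun h3 => h'.not_neg_pos h3 h2), iff_of_true h1 h2⟩
    rwa [h0, neg_zero] at h2

end Ordered

end SqfQE

namespace SqfQE

open FirstOrder.Language FirstOrder.Language.Theory

/-! ### Quantifier elimination -/

section Elimination

variable {X : Type}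

/-- The linear form on which an atomic condition depends; for `w < w'` it is `w' - w`. -/
def Atom.form : Atom X → Form X
  | eq w => w
  | memU _ _ w => w
  | memP _ w => w
  | lt w w' => w' - w

/-- The index of the predicate `U_{p,l}` in an atomic condition. -/
def Atom.indexU : Atom X → Finset (Nat.Primes × ℤ)
  | memU p l _ => {(p, l)}
  | _ => ∅

/-- The index of the predicate `P_m` in an atomic condition. -/
def Atom.indexP : Atom X → Finset ℕ+
  | memP m _ => {m}
  | _ => ∅

theorem Atom.holds_iff_of_agreeOn {D D' : GroupData} (hl : IsInvariantLt D) (hl' : IsInvariantLt D')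
    {Q : Finset (Nat.Primes × ℤ)} {M : Finset ℕ+} (A : Atom X) (hQ : A.indexU ⊆ Q)
    (hM : A.indexP ⊆ M) (v : X → D.G) (v' : X → D'.G)
    (h : AgreeOn (D := D) (D' := D') Q M (D.eval v A.form) (D'.eval v' A.form)) :
    A.Holds D v ↔ A.Holds D' v' := by
  cases A with
  | eq w => exact h.eq_iff
  | memU p l w => exact h.memU_iff (p, l) (hQ (Finset.mem_singleton_self _))
  | memP m w => exact h.memP_iff m (hM (Finset.mem_singleton_self _))
  | lt w w' =>
    have := h.lt_iff
    simp only [Atom.form, map_sub] at this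
    simp only [Atom.Holds]
    rwa [hl.sub_iff, hl'.sub_iff]

theorem exists_finset_atoms_formula {L : FirstOrder.Language.{0, 0}} [LinearLanguage L]
    (φ : L.Formula X) (hφ : BoundedFormula.IsQF φ) :
    ∃ s : Finset (Atom X), ∀ (D D' : GroupData) (v : X → D.G) (v' : X → D'.G),
      (∀ A ∈ s, A.Holds D v ↔ A.Holds D' v') → (D.Sat φ v ↔ D'.Sat φ v') := by
  classical
  obtain ⟨s, hs⟩ := exists_finset_atoms φ hφ
  let σ : X ⊕ Fin 0 → Form X := Sum.elim (fun x => FreeAbelianGroup.of (some x)) fun i => i.elim0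
  refine ⟨s.image (Atom.subst σ), fun D D' v v' h => ?_⟩
  have hσ : ∀ (D : GroupData) (v : X → D.G), (fun y => D.eval v (σ y)) = Sum.elim v default := by
    intro D v
    funext y
    rcases y with x | i
    · simp [σ]
    · exact i.elim0
  refine hs D D' (Sum.elim v default) (Sum.elim v' default) fun A hA => ?_
  have := h _ (Finset.mem_image_of_mem _ hA)
  rwa [Atom.holds_subst, Atom.holds_subst, hσ, hσ] at this

/-- A theory in a linear language has quantifier elimination if its models are given by a class
`𝒦` of `GroupData` in which all atomic conditions are quantifier-free definable and which has the
transfer properties. -/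
theorem hasQE_of_transfer {L : FirstOrder.Language.{0, 0}} [LinearLanguage L] (𝒦 : GroupData → Prop)
    (hatom : ∀ {X : Type} (A : Atom X), ∃ φ : L.Formula X, BoundedFormula.IsQF φ ∧
      ∀ D, 𝒦 D → ∀ v, D.Sat φ v ↔ A.Holds D v)
    (hreg : ∀ D, 𝒦 D → IsRegular D) (hinv : ∀ D, 𝒦 D → IsInvariantLt D)
    (htrans : ∀ D D', 𝒦 D → 𝒦 D' → ∀ {F : Type} [AddCommGroup F] (α : F →+ D.G) (β : F →+ D'.G),
      SameAtoms D D' α β → RootTransfer α β ∧ LocalTransfer α β ∧ PlaceTransfer α β)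
    (T : L.Theory) (hT : ∀ (M : Type) (s : L.Structure M), M ⊨ T →
      ∃ D, 𝒦 D ∧ (⟨M, s⟩ : Σ M : Type, L.Structure M) = ⟨D.G, GroupLanguage.str D⟩) :
    HasQE T := by
  classical
  have main : ∀ (X M N : Type) (sM : L.Structure M) (sN : L.Structure N) (_ : M ⊨ T) (_ : N ⊨ T)
      (v : X → M) (w : X → N),
      (∀ ψ : L.Formula X, BoundedFormula.IsQF ψ → (ψ.Realize v ↔ ψ.Realize w)) →
        ∀ ψ : L.Formula (X ⊕ Unit), BoundedFormula.IsQF ψ → ∀ c : M,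
          ψ.Realize (Sum.elim v fun _ => c) → ∃ d : N, ψ.Realize (Sum.elim w fun _ => d) := by
    intro X M N sM sN hM hN v w hvw ψ hψ c hc
    obtain ⟨D, hD, e⟩ := hT M sM hM
    cases e
    obtain ⟨D', hD', e⟩ := hT N sN hN
    cases e
    have hA : ∀ A : Atom X, A.Holds D v ↔ A.Holds D' w := by
      intro A
      obtain ⟨φ, hφ, h⟩ := hatom A
      rw [← h D hD, ← h D' hD']
      exact hvw φ hφ
    have hs : SameAtoms D D' (D.eval v) (D'.eval w) :=
      ⟨⟨FreeAbelianGroup.of none, by simp, by simp⟩, fun t => hA (Atom.eq t),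
        fun p l t => hA (Atom.memU p l t), fun m t => hA (Atom.memP m t),
        fun s t => hA (Atom.lt s t)⟩
    obtain ⟨h1, h2, h3⟩ := htrans D D' hD hD' _ _ hs
    obtain ⟨s, hsψ⟩ := exists_finset_atoms_formula ψ hψ
    obtain ⟨d, hd⟩ := exists_agreeOn (hreg D hD) (hreg D' hD') (hinv D hD) (hinv D' hD') hs h1 h2 h3
      c (s.image fun A => (Form.coeff A.form, Form.rest A.form)) (s.biUnion Atom.indexU)
      (s.biUnion Atom.indexP)
    refine ⟨d, (hsψ D D' _ _ fun A hAs => ?_).1 hc⟩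
    refine A.holds_iff_of_agreeOn (hinv D hD) (hinv D' hD') (Finset.subset_biUnion_of_mem _ hAs)
      (Finset.subset_biUnion_of_mem _ hAs) _ _ ?_
    rw [D.eval_elim, D'.eval_elim]
    exact hd _ (Finset.mem_image_of_mem _ hAs)
  refine hasQE_of_forall_exists T fun X M N v w hvw ψ hψ c hc => ?_
  exact main X M N M.struc N.struc M.is_model N.is_model v w hvw ψ hψ c hc

theorem exists_isQF_atom_L1star {X : Type} (A : Atom X) :
    ∃ φ : L1star.Formula X, BoundedFormula.IsQF φ ∧
      ∀ D : GroupData, (∀ a b, ¬D.lt a b) → ∀ v, D.Sat φ v ↔ A.Holds D v := by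
  cases A with
  | eq w =>
    obtain ⟨φ, hφ, h⟩ := QFDef.eq (L := L1star) (TermDef.eval w) TermDef.zero
    exact ⟨φ, hφ, fun D _ v => h D v⟩
  | memU p l w =>
    obtain ⟨φ, hφ, h⟩ := QFDef.memU (L := L1star) p l (TermDef.eval w)
    exact ⟨φ, hφ, fun D _ v => h D v⟩
  | memP m w =>
    obtain ⟨φ, hφ, h⟩ := QFDef.memP (L := L1star) m (TermDef.eval w)
    exact ⟨φ, hφ, fun D _ v => h D v⟩
  | lt w w' => exact ⟨⊥, BoundedFormula.isQF_bot, fun D hD v => iff_of_false id (hD _ _)⟩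

theorem exists_isQF_atom_L2star {X : Type} (A : Atom X) : QFDef L2star fun D v => A.Holds D v := by
  cases A with
  | eq w => exact QFDef.eq (TermDef.eval w) TermDef.zero
  | memU p l w => exact QFDef.memU p l (TermDef.eval w)
  | memP m w => exact QFDef.memP m (TermDef.eval w)
  | lt w w' => exact QFDef.lt (TermDef.eval w) (TermDef.eval w')

theorem isInvariantLt_of_forall_not {D : GroupData} (h : ∀ a b, ¬D.lt a b) : IsInvariantLt D :=
  ⟨fun _ _ => iff_of_false (h _ _) (h _ _), fun _ _ _ => iff_of_false (h _ _) (h _ _)⟩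

theorem IsGeneric.hasSolutions {D : GroupData} (h : IsGeneric D.U D.P) : HasSolutions D :=
  fun n n' π c c' hs => (h n n' π c c' hs).nonempty

theorem IsGenericLt.hasSolutions {D : GroupData} (h : IsGenericLt D.lt D.U D.P)
    (hlt : D.lt 0 1) : HasSolutions D := fun n n' π c c' hs => by
  obtain ⟨a, -, -, ha⟩ := h n n' π c c' hs 0 1 hlt
  exact ⟨a, ha⟩

theorem hasQE_genericZ (T : L1star.Theory) (hT : Axiomatizes T GenericZ) : HasQE T := by
  refine hasQE_of_transfer (fun D => (∀ a b, ¬D.lt a b) ∧ IsBaseZ D.U D.P ∧ IsGeneric D.U D.P)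
    (fun A => ?_) (fun D hD => hD.2.1.isRegular) (fun D hD => isInvariantLt_of_forall_not hD.1)
    (fun D D' hD hD' F _ α β hs => ⟨rootTransfer_Z hD.2.1 hD'.2.1 hs, localTransfer_Z hD.2.1 hs,
      placeTransfer_of_isGeneric hD'.2.1.isValued hD'.2.2 hD.1 hD'.1⟩) T fun M s hM => ?_
  · obtain ⟨φ, hφ, h⟩ := exists_isQF_atom_L1star A
    exact ⟨φ, hφ, fun D hD => h D hD.1⟩
  · obtain ⟨_, _, U, P, rfl, hb, hg⟩ := (hT M).1 hM
    exact ⟨⟨M, fun _ _ => False, U, P⟩, ⟨fun _ _ => id, hb, hg⟩, rfl⟩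

theorem hasQE_genericQ (T : L1star.Theory) (hT : Axiomatizes T GenericQ) : HasQE T := by
  refine hasQE_of_transfer (fun D => (∀ a b, ¬D.lt a b) ∧ IsBaseQ D.U D.P ∧ IsGeneric D.U D.P)
    (fun A => ?_) (fun D hD => hD.2.1.isRegular hD.2.2.hasSolutions)
    (fun D hD => isInvariantLt_of_forall_not hD.1)
    (fun D D' hD hD' F _ α β hs => ?_) T fun M s hM => ?_
  · obtain ⟨φ, hφ, h⟩ := exists_isQF_atom_L1star A
    exact ⟨φ, hφ, fun D hD => h D hD.1⟩
  · have hV := hD.2.1.isValued hD.2.2.hasSolutions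
    have hV' := hD'.2.1.isValued hD'.2.2.hasSolutions
    exact ⟨rootTransfer_Q hD'.2.1, localTransfer_Q hD.2.1 hD'.2.1 hV hV' hs,
      placeTransfer_of_isGeneric hV' hD'.2.2 hD.1 hD'.1⟩
  · obtain ⟨_, _, U, P, rfl, hb, hg⟩ := (hT M).1 hM
    exact ⟨⟨M, fun _ _ => False, U, P⟩, ⟨fun _ _ => id, hb, hg⟩, rfl⟩

theorem hasQE_genericQlt (T : L2star.Theory) (hT : Axiomatizes T GenericQlt) : HasQE T := by
  have hsol : ∀ D : GroupData, IsBaseQlt D.lt D.U D.P → IsGenericLt D.lt D.U D.P → HasSolutions D :=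
    fun D hb hg => hg.hasSolutions hb.isOrderedLt.one_pos
  refine hasQE_of_transfer (fun D => IsBaseQlt D.lt D.U D.P ∧ IsGenericLt D.lt D.U D.P)
    (fun A => ?_) (fun D hD => hD.1.base.isRegular (hsol D hD.1 hD.2))
    (fun D hD => hD.1.isOrderedLt.toIsInvariantLt)
    (fun D D' hD hD' F _ α β hs => ?_) T fun M s hM => ?_
  · obtain ⟨φ, hφ, h⟩ := exists_isQF_atom_L2star A
    exact ⟨φ, hφ, fun D _ => h D⟩
  · exact ⟨rootTransfer_Q hD'.1.base, localTransfer_Q hD.1.base hD'.1.base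
      (hD.1.base.isValued (hsol D hD.1 hD.2)) (hD'.1.base.isValued (hsol D' hD'.1 hD'.2)) hs,
      placeTransfer_of_isGenericLt hD.1.isOrderedLt hD'.1.isOrderedLt hD'.1.base hs hD'.2⟩
  · obtain ⟨_, _, lt, U, P, rfl, hb, hg⟩ := (hT M).1 hM
    exact ⟨⟨M, lt, U, P⟩, ⟨hb, hg⟩, rfl⟩

end Elimination

end SqfQE

namespace SqfQE

open FirstOrder.Language FirstOrder.Language.Theory

/-! ### Axiomatizability of the base theories -/

section GroupAxioms

/-- The term `t + s`. -/
def addTerm {X : Type} (t s : L0.Term X) : L0.Term X :=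
  Functions.apply₂ (L := L0) GroupFunc.add t s

/-- The term `-t`. -/
def negTerm {X : Type} (t : L0.Term X) : L0.Term X :=
  Functions.apply₁ (L := L0) GroupFunc.neg t

/-- The term `0`. -/
def zeroTerm {X : Type} : L0.Term X :=
  Term.func (L := L0) GroupFunc.zero Fin.elim0

/-- The `i`-th of three variables. -/
def varTerm (i : Fin 3) : L0.Term (Empty ⊕ Fin 3) :=
  Term.var (Sum.inr i)

/-- The universal closure of an equation in three variables. -/
noncomputable def identity (t s : L0.Term (Empty ⊕ Fin 3)) : L0.Sentence :=
  Formula.iAlls (Fin 3) (t.equal s)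

theorem realize_identity {M : Type} [L0.Structure M] (t s : L0.Term (Empty ⊕ Fin 3)) :
    M ⊨ identity t s ↔ ∀ x : Fin 3 → M,
      t.realize (Sum.elim Empty.elim x) = s.realize (Sum.elim Empty.elim x) := by
  refine (Formula.realize_iAlls (M := M)).trans (forall_congr' fun x => ?_)
  refine (Formula.realize_equal (L := L0) (M := M)).trans ?_
  rw [Subsingleton.elim (default : Empty → M) Empty.elim]

/-- The axioms of abelian groups. -/
noncomputable def abelianGroupAxioms : L0.Theory :=
  {identity (addTerm (addTerm (varTerm 0) (varTerm 1)) (varTerm 2))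
      (addTerm (varTerm 0) (addTerm (varTerm 1) (varTerm 2))),
    identity (addTerm zeroTerm (varTerm 0)) (varTerm 0),
    identity (addTerm (negTerm (varTerm 0)) (varTerm 0)) zeroTerm,
    identity (addTerm (varTerm 0) (varTerm 1)) (addTerm (varTerm 1) (varTerm 0))}

section

variable {M : Type} [L0.Structure M] {X : Type} (v : X → M)

theorem realize_addTerm (t s : L0.Term X) : (addTerm t s).realize v =
    Structure.funMap (L := L0) GroupFunc.add ![t.realize v, s.realize v] :=
  Term.realize_functions_apply₂

theorem realize_negTerm (t : L0.Term X) : (negTerm t).realize v =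
    Structure.funMap (L := L0) GroupFunc.neg ![t.realize v] :=
  Term.realize_functions_apply₁

theorem realize_zeroTerm : (zeroTerm : L0.Term X).realize v =
    Structure.funMap (L := L0) GroupFunc.zero ![] := by
  refine (Term.realize_func v (L := L0) GroupFunc.zero Fin.elim0).trans ?_
  exact congrArg _ (Subsingleton.elim _ _)

/-- The axioms in semantic form. -/
theorem model_abelianGroupAxioms_iff : M ⊨ abelianGroupAxioms ↔
    (∀ x : Fin 3 → M, (addTerm (addTerm (varTerm 0) (varTerm 1)) (varTerm 2)).realize
      (Sum.elim Empty.elim x) = (addTerm (varTerm 0) (addTerm (varTerm 1) (varTerm 2))).realize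
      (Sum.elim Empty.elim x)) ∧
    (∀ x : Fin 3 → M, (addTerm zeroTerm (varTerm 0)).realize (Sum.elim Empty.elim x) =
      (varTerm 0).realize (Sum.elim Empty.elim x)) ∧
    (∀ x : Fin 3 → M, (addTerm (negTerm (varTerm 0)) (varTerm 0)).realize (Sum.elim Empty.elim x) =
      zeroTerm.realize (Sum.elim Empty.elim x)) ∧
    (∀ x : Fin 3 → M, (addTerm (varTerm 0) (varTerm 1)).realize (Sum.elim Empty.elim x) =
      (addTerm (varTerm 1) (varTerm 0)).realize (Sum.elim Empty.elim x)) := by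
  simp only [abelianGroupAxioms, Theory.model_iff, Set.mem_insert_iff, Set.mem_singleton_iff,
    forall_eq_or_imp, forall_eq, realize_identity]

end

theorem model_abelianGroupAxioms (M : Type) [AddCommGroup M] [One M] :
    M ⊨ abelianGroupAxioms := by
  rw [model_abelianGroupAxioms_iff]
  simp only [realize_addTerm, realize_negTerm, realize_zeroTerm]
  exact ⟨fun x => add_assoc _ _ _, fun x => zero_add _, fun x => neg_add_cancel _,
    fun x => add_comm _ _⟩

theorem exists_group_of_model (M : Type) (s : L0.Structure M) (h : M ⊨ abelianGroupAxioms) :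
    ∃ (_ : AddCommGroup M) (_ : One M), s = groupStructure := by
  rw [model_abelianGroupAxioms_iff] at h
  simp only [realize_addTerm, realize_negTerm, realize_zeroTerm] at h
  obtain ⟨h1, h2, h3, h4⟩ := h
  let iz : Zero M := ⟨s.funMap (n := 0) GroupFunc.zero ![]⟩
  let ia : Add M := ⟨fun a b => s.funMap (n := 2) GroupFunc.add ![a, b]⟩
  let inn : Neg M := ⟨fun a => s.funMap (n := 1) GroupFunc.neg ![a]⟩
  let ig : AddGroup M := AddGroup.ofLeftAxioms (fun a b c => h1 ![a, b, c])
    (fun a => h2 ![a, a, a]) (fun a => h3 ![a, a, a])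
  let ic : AddCommGroup M := { ig with add_comm := fun a b => h4 ![a, b, a] }
  let io : One M := ⟨s.funMap (n := 0) GroupFunc.one ![]⟩
  refine ⟨ic, io, ?_⟩
  refine Structure.ext
      (funext fun n => funext fun f => funext fun x => ?_)
    (funext fun n => funext fun r => r.elim)
  cases f with
  | zero => exact congrArg (s.funMap (n := 0) GroupFunc.zero) (Subsingleton.elim _ _)
  | one => exact congrArg (s.funMap (n := 0) GroupFunc.one) (Subsingleton.elim _ _)
  | neg =>
    refine congrArg (s.funMap (n := 1) GroupFunc.neg) (funext fun i => ?_)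
    fin_cases i; rfl
  | add =>
    refine congrArg (s.funMap (n := 2) GroupFunc.add) (funext fun i => ?_)
    fin_cases i <;> rfl

theorem model_reduct {L L' : FirstOrder.Language.{0, 0}} (φ : L →ᴸ L') (T : L.Theory) (M : Type)
    (s : L'.Structure M) (h : M ⊨ φ.onTheory T) : letI := φ.reduct M; M ⊨ T := by
  let := φ.reduct M
  have : φ.IsExpansionOn M := φ.isExpansionOn_reduct M
  exact (LHom.onTheory_model φ T).1 h

/-- The `L₁*`-structures given by a `GroupData` are the models of the axioms of abelian groups. -/
theorem exists_theory_L1star : ∃ T : L1star.Theory, ∀ (M : Type) (s : L1star.Structure M),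
    M ⊨ T ↔ ∃ D : GroupData,
      (⟨M, s⟩ : Σ M : Type, L1star.Structure M) = ⟨D.G, GroupLanguage.str D⟩ := by
  refine ⟨(GroupLanguage.hom (L := L1star)).onTheory abelianGroupAxioms, fun M s =>
    ⟨fun h => ?_, ?_⟩⟩
  · obtain ⟨ic, io, hs₀⟩ := exists_group_of_model M _ (model_reduct _ _ M s h)
    refine ⟨⟨M, fun _ _ => False, fun p l => {x | s.RelMap (symU p l) ![x]},
      fun m => {x | s.RelMap (n := 1) (Sum.inr (PredRel.P m)) ![x]}⟩, ?_⟩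
    refine congrArg (Sigma.mk M) (Structure.ext
      (funext fun n => funext fun f => funext fun x => ?_)
      (funext fun n => funext fun r => funext fun x => ?_))
    · rcases f with f | f
      · exact congrArg (fun t : L0.Structure M => t.funMap f x) hs₀
      · exact f.elim
    · rcases r with r | r
      · exact r.elim
      · cases r with
        | U p l =>
          refine congrArg (s.RelMap (n := 1) (Sum.inr (PredRel.U p l))) (funext fun i => ?_)
          fin_cases i; rfl
        | P m =>
          refine congrArg (s.RelMap (n := 1) (Sum.inr (PredRel.P m))) (funext fun i => ?_)
          fin_cases i; rfl
  · rintro ⟨D, e⟩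
    cases e
    let := structure1 D.U D.P
    have := GroupLanguage.isExpansion (L := L1star) D
    exact (LHom.onTheory_model (GroupLanguage.hom (L := L1star)) _).2 (model_abelianGroupAxioms D.G)

/-- The `L₂*`-structures given by a `GroupData` are those whose `L₁*`-reduct is. -/
theorem exists_theory_L2star : ∃ T : L2star.Theory, ∀ (M : Type) (s : L2star.Structure M),
    M ⊨ T ↔ ∃ D : GroupData,
      (⟨M, s⟩ : Σ M : Type, L2star.Structure M) = ⟨D.G, GroupLanguage.str D⟩ := by
  obtain ⟨T, hT⟩ := exists_theory_L1star
  refine ⟨(PredLanguage.predHom (L := L2star)).onTheory T, fun M s => ⟨fun h => ?_, ?_⟩⟩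
  · obtain ⟨D, e⟩ := (hT M _).1 (model_reduct _ _ M s h)
    obtain ⟨s₁, hs₁⟩ : ∃ s₁, s₁ = (PredLanguage.predHom (L := L2star)).reduct M := ⟨_, rfl⟩
    rw [← hs₁] at e
    cases e
    refine ⟨⟨D.G, fun a b => s.RelMap (n := 2) (Sum.inr LtRel.lt) ![a, b], D.U, D.P⟩, ?_⟩
    refine congrArg (Sigma.mk D.G) (Structure.ext
      (funext fun n => funext fun f => funext fun x => ?_)
      (funext fun n => funext fun r => funext fun x => ?_))
    · rcases f with f | f
      · exact congrArg (fun t : L1star.Structure D.G => t.funMap f x) hs₁.symm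
      · exact f.elim
    · rcases r with r | r
      · exact congrArg (fun t : L1star.Structure D.G => t.RelMap r x) hs₁.symm
      · cases r
        refine congrArg (s.RelMap (n := 2) (Sum.inr LtRel.lt)) (funext fun i => ?_)
        fin_cases i <;> rfl
  · rintro ⟨D, e⟩
    cases e
    let := structure1 D.U D.P
    let := structure2 D.lt D.U D.P
    have := PredLanguage.predIsExpansion (L := L2star) D
    exact (LHom.onTheory_model (PredLanguage.predHom (L := L2star)) _).2 ((hT D.G _).2 ⟨D, rfl⟩)

/-- To axiomatize a class of structures given by an elementary property of `GroupData`, the group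
axioms are added to the sentences expressing the property. -/
theorem exists_axiomatization {L : FirstOrder.Language.{0, 0}} [GroupLanguage L]
    (hL : ∃ T : L.Theory, ∀ (M : Type) (s : L.Structure M), M ⊨ T ↔ ∃ D : GroupData,
      (⟨M, s⟩ : Σ M : Type, L.Structure M) = ⟨D.G, GroupLanguage.str D⟩)
    {Φ : GroupData → Prop} (hΦ : Elementary L Φ) (K : ∀ M : Type, L.Structure M → Prop)
    (hK : ∀ (M : Type) (s : L.Structure M), K M s ↔ ∃ D : GroupData, Φ D ∧
      (⟨M, s⟩ : Σ M : Type, L.Structure M) = ⟨D.G, GroupLanguage.str D⟩) :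
    ∃ T : L.Theory, Axiomatizes T K := by
  obtain ⟨T, hT⟩ := hL
  obtain ⟨T', hT'⟩ := hΦ
  refine ⟨T ∪ T', fun M s => ?_⟩
  rw [hK, Theory.model_union_iff, hT]
  constructor
  · rintro ⟨⟨D, e⟩, h⟩
    cases e
    exact ⟨D, (hT' D).1 h, rfl⟩
  · rintro ⟨D, hD, e⟩
    cases e
    exact ⟨⟨D, rfl⟩, (hT' D).2 hD⟩

end GroupAxioms

section BaseAxioms

variable {L : FirstOrder.Language.{0, 0}} [PredLanguage L]

namespace Def

variable {X : Type} {R S : ∀ D : GroupData, (X → D.G) → Prop}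

theorem memU {f : ∀ D : GroupData, (X → D.G) → D.G} (p : Nat.Primes) (l : ℤ) (hf : TermDef L f) :
    Def L fun D v => f D v ∈ D.U p l :=
  (QFDef.memU p l hf).def

theorem memP {f : ∀ D : GroupData, (X → D.G) → D.G} (m : ℕ+) (hf : TermDef L f) :
    Def L fun D v => f D v ∈ D.P m :=
  (QFDef.memP m hf).def

end Def

theorem Elementary.elementarilyEquivalent (G : Type) [AddCommGroup G] [One G] :
    Elementary L fun D => L0.ElementarilyEquivalent D.G G := by
  refine ⟨(GroupLanguage.hom (L := L)).onTheory (L0.completeTheory G), fun D => ?_⟩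
  let := GroupLanguage.str (L := L) D
  have := GroupLanguage.isExpansion (L := L) D
  rw [LHom.onTheory_model]
  refine ⟨fun h => ElementarilyEquivalent.symm ?_, fun h => ?_⟩
  · rw [elementarilyEquivalent_iff]
    exact fun φ => (realize_iff_of_model_completeTheory G D.G φ).symm
  · exact (ElementarilyEquivalent.theory_model_iff h).2 inferInstance

theorem elementary_isBaseZ : Elementary L fun D => IsBaseZ D.U D.P := by
  have h1 : Elementary L fun D => L0.ElementarilyEquivalent D.G ℤ :=
    Elementary.elementarilyEquivalent ℤ
  have h2 : Elementary L fun D => ∀ (p : Nat.Primes) (l : {l : ℤ // l ≤ 0}),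
      ∀ x : D.G, x ∈ D.U p l :=
    Elementary.forall_index fun p => Elementary.forall_index fun l =>
      Elementary.of_def (Def.all (Def.memU p l (TermDef.var _)))
  have h3 : Elementary L fun D => ∀ (p : Nat.Primes) (l : {l : ℕ // 0 < l}), ∀ x : D.G,
      x ∈ D.U p (l : ℕ) ↔ ∃ a : D.G, x = (p : ℕ) ^ (l : ℕ) • a :=
    Elementary.forall_index fun p => Elementary.forall_index fun l =>
      Elementary.of_def <| Def.all (R := fun D _ x => x ∈ D.U p (l : ℕ) ↔
        ∃ a : D.G, x = (p : ℕ) ^ (l : ℕ) • a) <| (Def.memU p _ (TermDef.var _)).iff <|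
        Def.ex (R := fun _ v a => v (Sum.inr ()) = (p : ℕ) ^ (l : ℕ) • a) <|
          Def.eq (TermDef.var (Sum.inl (Sum.inr ()))) ((TermDef.var _).nsmul _)
  have h4 : Elementary L fun D => (1 : D.G) ∈ D.P 1 :=
    Elementary.of_def (Def.memP 1 TermDef.one)
  have h5 : Elementary L fun D => ∀ a : D.G, -a ∈ D.P 1 ↔ a ∈ D.P 1 :=
    Elementary.of_def (Def.all ((Def.memP 1 (TermDef.var _).neg).iff (Def.memP 1 (TermDef.var _))))
  have h6 : Elementary L fun D => ∀ (p : Nat.Primes), ∀ a : D.G,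
      (p : ℕ) • a ∈ D.P 1 ↔ a ∈ D.P 1 ∧ a ∉ D.U p 1 :=
    Elementary.forall_index fun p => Elementary.of_def <| Def.all <|
      (Def.memP 1 ((TermDef.var _).nsmul _)).iff <|
        (Def.memP 1 (TermDef.var _)).and (Def.memU p 1 (TermDef.var _)).not
  have h7 : Elementary L fun D => ∀ m : ℕ+, ∀ x : D.G, x ∈ D.P m ↔
      ∃ d : {d : Fin (m + 1) // (d : ℕ) ∣ (m : ℕ)}, ∃ a : D.G, a ∈ D.P 1 ∧ x = (d : ℕ) • a :=
    Elementary.forall_index fun m => Elementary.of_def <|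
      Def.all (R := fun D _ x => x ∈ D.P m ↔ ∃ d : {d : Fin (m + 1) // (d : ℕ) ∣ (m : ℕ)},
        ∃ a : D.G, a ∈ D.P 1 ∧ x = (d : ℕ) • a) <|
      (Def.memP m (TermDef.var _)).iff <| Def.exists_finite fun d =>
        Def.ex (R := fun D v a => a ∈ D.P 1 ∧ v (Sum.inr ()) = (d : ℕ) • a) <|
        (Def.memP 1 (TermDef.var _)).and
          (Def.eq (TermDef.var (Sum.inl (Sum.inr ()))) ((TermDef.var _).nsmul _))
  refine (h1.and (h2.and (h3.and (h4.and (h5.and (h6.and h7)))))).congr fun D => ?_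
  constructor
  · rintro ⟨h1, h2, h3, h4, h5, h6, h7⟩
    refine ⟨h1, fun p l hl => Set.eq_univ_of_forall (h2 p ⟨l, hl⟩),
      fun p l hl => Set.ext (h3 p ⟨l, hl⟩), h4, h5, h6, fun m => Set.ext fun x => (h7 m x).trans ?_⟩
    constructor
    · rintro ⟨d, a, ha, e⟩
      exact ⟨d, d.2, a, ha, e⟩
    · rintro ⟨d, hd, a, ha, e⟩
      exact ⟨⟨⟨d, Nat.lt_succ_of_le (Nat.le_of_dvd m.pos hd)⟩, hd⟩, a, ha, e⟩
  · intro h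
    refine ⟨h.elemEquiv, fun p l x => by rw [h.U_nonpos p l l.2]; trivial,
      fun p l x => by rw [h.U_pos p l l.2]; rfl, h.one_mem, h.neg_mem, h.prime_smul_mem,
      fun m x => ?_⟩
    rw [h.P_eq m]
    constructor
    · rintro ⟨d, hd, a, ha, e⟩
      exact ⟨⟨⟨d, Nat.lt_succ_of_le (Nat.le_of_dvd m.pos hd)⟩, hd⟩, a, ha, e⟩
    · rintro ⟨d, a, ha, e⟩
      exact ⟨d, d.2, a, ha, e⟩

/-- A first-order form of the axiom `U_{p,0} / U_{p,1} ≅ ℤ / pℤ`. -/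
def QuotientAxiom (D : GroupData) (p : Nat.Primes) : Prop :=
  (∀ l : Fin 2, (0 : D.G) ∈ D.U p (l : ℕ) ∧ (∀ x y : D.G, x ∈ D.U p (l : ℕ) → y ∈ D.U p (l : ℕ) →
    x + y ∈ D.U p (l : ℕ)) ∧ ∀ x : D.G, x ∈ D.U p (l : ℕ) → -x ∈ D.U p (l : ℕ)) ∧
  (∀ x : D.G, x ∈ D.U p 1 → x ∈ D.U p 0) ∧
  ∃ g : D.G, g ∈ D.U p 0 ∧ ¬g ∈ D.U p 1 ∧ (p : ℕ) • g ∈ D.U p 1 ∧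
    ∀ x : D.G, x ∈ D.U p 0 → ∃ j : Fin p, x + -((j : ℕ) • g) ∈ D.U p 1

theorem elementary_quotientAxiom (p : Nat.Primes) : Elementary L fun D => QuotientAxiom D p := by
  refine Elementary.of_def (Def.and (Def.forall_finite fun l => Def.and ?_ (Def.and ?_ ?_))
    (Def.and ?_ ?_))
  · exact Def.memU p _ TermDef.zero
  · exact Def.all (R := fun D _ x => ∀ y : D.G, x ∈ D.U p (l : ℕ) → y ∈ D.U p (l : ℕ) →
      x + y ∈ D.U p (l : ℕ)) <| Def.all (R := fun D v y => v (Sum.inr ()) ∈ D.U p (l : ℕ) →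
      y ∈ D.U p (l : ℕ) → v (Sum.inr ()) + y ∈ D.U p (l : ℕ)) <|
      (Def.memU p _ (TermDef.var (Sum.inl (Sum.inr ())))).imp <|
      (Def.memU p _ (TermDef.var _)).imp <|
      Def.memU p _ ((TermDef.var (Sum.inl (Sum.inr ()))).add (TermDef.var _))
  · exact Def.all ((Def.memU p _ (TermDef.var _)).imp (Def.memU p _ (TermDef.var _).neg))
  · exact Def.all ((Def.memU p _ (TermDef.var _)).imp (Def.memU p _ (TermDef.var _)))
  · exact Def.ex (R := fun D _ g => g ∈ D.U p 0 ∧ ¬g ∈ D.U p 1 ∧ (p : ℕ) • g ∈ D.U p 1 ∧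
      ∀ x : D.G, x ∈ D.U p 0 → ∃ j : Fin p, x + -((j : ℕ) • g) ∈ D.U p 1) <|
      (Def.memU p _ (TermDef.var _)).and <| (Def.memU p _ (TermDef.var _)).not.and <|
      (Def.memU p _ ((TermDef.var _).nsmul _)).and <|
      Def.all (R := fun D v x => x ∈ D.U p 0 →
        ∃ j : Fin p, x + -((j : ℕ) • v (Sum.inr ())) ∈ D.U p 1) <|
      (Def.memU p _ (TermDef.var _)).imp <| Def.exists_finite fun j =>
      Def.memU p _ ((TermDef.var _).add ((TermDef.var (Sum.inl (Sum.inr ()))).nsmul _).neg)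

theorem quotientAxiom_iff (D : GroupData) (p : Nat.Primes) : QuotientAxiom D p ↔
    ∃ H K : AddSubgroup D.G, (H : Set D.G) = D.U p 0 ∧ (K : Set D.G) = D.U p 1 ∧ K ≤ H ∧
      Nonempty ((H ⧸ K.addSubgroupOf H) ≃+ ZMod (p : ℕ)) := by
  have : Fact (p : ℕ).Prime := ⟨p.2⟩
  constructor
  · rintro ⟨hsub, hle, g, hg0, hg1, hpg, hgen⟩
    let H : AddSubgroup D.G :=
      { carrier := D.U p 0
        zero_mem' := (hsub 0).1
        add_mem' := fun ha hb => (hsub 0).2.1 _ _ ha hb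
        neg_mem' := fun ha => (hsub 0).2.2 _ ha }
    let K : AddSubgroup D.G :=
      { carrier := D.U p 1
        zero_mem' := (hsub 1).1
        add_mem' := fun ha hb => (hsub 1).2.1 _ _ ha hb
        neg_mem' := fun ha => (hsub 1).2.2 _ ha }
    refine ⟨H, K, rfl, rfl, hle, ⟨AddEquiv.symm ?_⟩⟩
    have hmk : ∀ x : H, (QuotientAddGroup.mk x : H ⧸ K.addSubgroupOf H) = 0 ↔ (x : D.G) ∈ K := by
      intro x
      rw [QuotientAddGroup.eq_zero_iff, AddSubgroup.mem_addSubgroupOf]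
    let γ : H := ⟨g, hg0⟩
    let f : ℤ →+ H ⧸ K.addSubgroupOf H := zmultiplesHom _ (QuotientAddGroup.mk γ)
    have hf : ∀ j : ℤ, f j = QuotientAddGroup.mk (j • γ) := fun j => rfl
    have hfp : f ((p : ℕ) : ℤ) = 0 := by
      rw [hf, hmk, natCast_zsmul]
      exact hpg
    refine AddEquiv.ofBijective (ZMod.lift (p : ℕ) ⟨f, hfp⟩) ⟨?_, fun x => ?_⟩
    · rw [ZMod.lift_injective]
      intro m hm
      rw [ZMod.intCast_zmod_eq_zero_iff_dvd]
      by_contra hpm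
      have hcop : IsCoprime m ((p : ℕ) : ℤ) :=
        ((Prime.coprime_iff_not_dvd (Nat.prime_iff_prime_int.1 p.2)).2 hpm).symm
      obtain ⟨a, b, hab⟩ := hcop
      have hm' : m • g ∈ K := (hmk (m • γ)).1 hm
      have hg : g ∈ K := by
        have e : g = a • (m • g) + b • ((p : ℕ) • g) := by
          rw [← natCast_zsmul, ← mul_smul, ← mul_smul, ← add_smul, hab, one_smul]
        rw [e]
        exact K.add_mem (K.zsmul_mem hm' _) (K.zsmul_mem hpg _)
      exact hg1 hg
    · obtain ⟨x, rfl⟩ := QuotientAddGroup.mk_surjective x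
      obtain ⟨j, hj⟩ := hgen x x.2
      refine ⟨((j : ℕ) : ℤ), ?_⟩
      rw [ZMod.lift_coe]
      change f ((j : ℕ) : ℤ) = _
      rw [hf, eq_comm, ← sub_eq_zero, ← QuotientAddGroup.mk_sub, hmk, natCast_zsmul, sub_eq_add_neg]
      exact hj
  · rintro ⟨H, K, hH, hK, hKH, ⟨e⟩⟩
    have hmk : ∀ x : H, e (QuotientAddGroup.mk x) = 0 ↔ (x : D.G) ∈ K := by
      intro x
      rw [map_eq_zero_iff e e.injective, QuotientAddGroup.eq_zero_iff,
        AddSubgroup.mem_addSubgroupOf]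
    obtain ⟨g, hg⟩ := QuotientAddGroup.mk_surjective (e.symm 1)
    have hg' : e (QuotientAddGroup.mk g) = 1 := by rw [hg, AddEquiv.apply_symm_apply]
    refine ⟨fun l => ?_, fun x hx => ?_, g, ?_, ?_, ?_, fun x hx => ?_⟩
    · have : ∃ N : AddSubgroup D.G, (N : Set D.G) = D.U p (l : ℕ) := by
        fin_cases l
        · exact ⟨H, hH⟩
        · exact ⟨K, hK⟩
      obtain ⟨N, hN⟩ := this
      rw [← hN]
      exact ⟨N.zero_mem, fun x y => N.add_mem, fun x => N.neg_mem⟩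
    · rw [← hH]
      rw [← hK] at hx
      exact hKH hx
    · rw [← hH]
      exact g.2
    · rw [← hK]
      intro h
      have := (hmk g).2 h
      rw [hg'] at this
      exact one_ne_zero this
    · rw [← hK]
      refine (hmk ((p : ℕ) • g)).1 ?_
      rw [QuotientAddGroup.mk_nsmul, map_nsmul, hg']
      simp
    · rw [← hH] at hx
      refine ⟨⟨(e (QuotientAddGroup.mk ⟨x, hx⟩)).val, ZMod.val_lt _⟩, ?_⟩
      rw [← hK, ← sub_eq_add_neg]
      refine (hmk ((⟨x, hx⟩ : H) - (e (QuotientAddGroup.mk ⟨x, hx⟩)).val • g)).1 ?_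
      rw [QuotientAddGroup.mk_sub, QuotientAddGroup.mk_nsmul, map_sub, map_nsmul, hg']
      simp

theorem elementary_isBaseQ : Elementary L fun D => IsBaseQ D.U D.P := by
  have h1 : Elementary L fun D => L0.ElementarilyEquivalent D.G ℚ :=
    Elementary.elementarilyEquivalent ℚ
  have h2 : Elementary L fun D => ∀ (p : Nat.Primes), ∀ a : D.G, a ∈ D.U p 0 ↔
      ∃ a₁ a₂ : D.G, (a₁ ∈ D.P 1 ∧ (p : ℕ) ^ 2 • a₁ ∉ D.P 1) ∧
        (a₂ ∈ D.P 1 ∧ (p : ℕ) ^ 2 • a₂ ∉ D.P 1) ∧ a = a₁ + a₂ :=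
    Elementary.forall_index fun p => Elementary.of_def <|
      Def.all (R := fun D _ a => a ∈ D.U p 0 ↔
        ∃ a₁ a₂ : D.G, (a₁ ∈ D.P 1 ∧ (p : ℕ) ^ 2 • a₁ ∉ D.P 1) ∧
          (a₂ ∈ D.P 1 ∧ (p : ℕ) ^ 2 • a₂ ∉ D.P 1) ∧ a = a₁ + a₂) <|
      (Def.memU p _ (TermDef.var _)).iff <|
      Def.ex (R := fun D v a₁ => ∃ a₂ : D.G, (a₁ ∈ D.P 1 ∧ (p : ℕ) ^ 2 • a₁ ∉ D.P 1) ∧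
          (a₂ ∈ D.P 1 ∧ (p : ℕ) ^ 2 • a₂ ∉ D.P 1) ∧ v (Sum.inr ()) = a₁ + a₂) <|
      Def.ex (R := fun D v a₂ => (v (Sum.inr ()) ∈ D.P 1 ∧ (p : ℕ) ^ 2 • v (Sum.inr ()) ∉ D.P 1) ∧
          (a₂ ∈ D.P 1 ∧ (p : ℕ) ^ 2 • a₂ ∉ D.P 1) ∧
          v (Sum.inl (Sum.inr ())) = v (Sum.inr ()) + a₂) <|
      ((Def.memP 1 (TermDef.var (Sum.inl (Sum.inr ())))).and
        (Def.memP 1 ((TermDef.var (Sum.inl (Sum.inr ()))).nsmul _)).not).and <|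
      ((Def.memP 1 (TermDef.var _)).and (Def.memP 1 ((TermDef.var _).nsmul _)).not).and <|
      Def.eq (TermDef.var (Sum.inl (Sum.inl (Sum.inr ()))))
        ((TermDef.var (Sum.inl (Sum.inr ()))).add (TermDef.var _))
  have h3 : Elementary L fun D => ∀ (p : Nat.Primes) (l : {l : ℕ // 0 < l}), ∀ x : D.G,
      (∃ a : D.G, a ∈ D.U p (-((l : ℕ) : ℤ)) ∧ x = (p : ℕ) ^ (l : ℕ) • a) ↔ x ∈ D.U p 0 :=
    Elementary.forall_index fun p => Elementary.forall_index fun l => Elementary.of_def <|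
      Def.all (R := fun D _ x => (∃ a : D.G, a ∈ D.U p (-((l : ℕ) : ℤ)) ∧
        x = (p : ℕ) ^ (l : ℕ) • a) ↔ x ∈ D.U p 0) <| Def.iff
        (Def.ex (R := fun D v a => a ∈ D.U p (-((l : ℕ) : ℤ)) ∧
          v (Sum.inr ()) = (p : ℕ) ^ (l : ℕ) • a) <| (Def.memU p _ (TermDef.var _)).and <|
          Def.eq (TermDef.var (Sum.inl (Sum.inr ()))) ((TermDef.var _).nsmul _))
        (Def.memU p _ (TermDef.var _))
  have h4 : Elementary L fun D => ∀ (p : Nat.Primes) (l : {l : ℕ // 0 < l}), ∀ x : D.G,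
      x ∈ D.U p (l : ℕ) ↔ ∃ a : D.G, a ∈ D.U p 0 ∧ x = (p : ℕ) ^ (l : ℕ) • a :=
    Elementary.forall_index fun p => Elementary.forall_index fun l => Elementary.of_def <|
      Def.all (R := fun D _ x => x ∈ D.U p (l : ℕ) ↔
        ∃ a : D.G, a ∈ D.U p 0 ∧ x = (p : ℕ) ^ (l : ℕ) • a) <|
      (Def.memU p _ (TermDef.var _)).iff <|
      Def.ex (R := fun D v a => a ∈ D.U p 0 ∧ v (Sum.inr ()) = (p : ℕ) ^ (l : ℕ) • a) <|
      (Def.memU p _ (TermDef.var _)).and <|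
      Def.eq (TermDef.var (Sum.inl (Sum.inr ()))) ((TermDef.var _).nsmul _)
  have h5 : Elementary L fun D => ∀ p : Nat.Primes, QuotientAxiom D p :=
    Elementary.forall_index elementary_quotientAxiom
  have h6 : Elementary L fun D => (1 : D.G) ∈ D.P 1 :=
    Elementary.of_def (Def.memP 1 TermDef.one)
  have h7 : Elementary L fun D => ∀ a : D.G, -a ∈ D.P 1 ↔ a ∈ D.P 1 :=
    Elementary.of_def (Def.all ((Def.memP 1 (TermDef.var _).neg).iff (Def.memP 1 (TermDef.var _))))
  have h8 : Elementary L fun D => ∀ (p : Nat.Primes), ∀ a : D.G,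
      (p : ℕ) • a ∈ D.P 1 ↔ a ∈ D.P 1 ∧ a ∉ D.U p 1 :=
    Elementary.forall_index fun p => Elementary.of_def <| Def.all <|
      (Def.memP 1 ((TermDef.var _).nsmul _)).iff <|
        (Def.memP 1 (TermDef.var _)).and (Def.memU p 1 (TermDef.var _)).not
  have h9 : Elementary L fun D => ∀ m : ℕ+, ∀ x : D.G, x ∈ D.P m ↔
      ∃ a : D.G, a ∈ D.P 1 ∧ x = (m : ℕ) • a :=
    Elementary.forall_index fun m => Elementary.of_def <|
      Def.all (R := fun D _ x => x ∈ D.P m ↔ ∃ a : D.G, a ∈ D.P 1 ∧ x = (m : ℕ) • a) <|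
      (Def.memP m (TermDef.var _)).iff <|
      Def.ex (R := fun D v a => a ∈ D.P 1 ∧ v (Sum.inr ()) = (m : ℕ) • a) <|
      (Def.memP 1 (TermDef.var _)).and
        (Def.eq (TermDef.var (Sum.inl (Sum.inr ()))) ((TermDef.var _).nsmul _))
  refine (h1.and (h2.and (h3.and (h4.and (h5.and (h6.and (h7.and (h8.and h9)))))))).congr
    fun D => ?_
  constructor
  · rintro ⟨h1, h2, h3, h4, h5, h6, h7, h8, h9⟩
    exact ⟨h1, fun p => Set.ext (h2 p), fun p l hl => Set.ext (h3 p ⟨l, hl⟩),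
      fun p l hl => Set.ext (h4 p ⟨l, hl⟩), fun p => (quotientAxiom_iff D p).1 (h5 p), h6, h7, h8,
      fun m => Set.ext (h9 m)⟩
  · intro h
    exact ⟨h.elemEquiv, fun p => Set.ext_iff.1 (h.U_zero p),
      fun p l => Set.ext_iff.1 (h.U_neg p l l.2), fun p l => Set.ext_iff.1 (h.U_pos p l l.2),
      fun p => (quotientAxiom_iff D p).2 (h.quotient p), h.one_mem, h.neg_mem, h.prime_smul_mem,
      fun m => Set.ext_iff.1 (h.P_eq m)⟩

end BaseAxioms

end SqfQE

namespace SqfQE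

open FirstOrder.Language FirstOrder.Language.Theory

/-! ### Axiomatizability of genericity -/

section Local

/-- For every prime `p` there is a subgroup between `U_{p,2}` and `G` that some element leaves
while its `p`-th multiple stays inside. -/
def HasLayers (D : GroupData) : Prop :=
  ∀ p : Nat.Primes, ∃ K : AddSubgroup D.G, (∀ x ∈ D.U p 2, x ∈ K) ∧ ∃ g, g ∉ K ∧ (p : ℕ) • g ∈ K

variable {D : GroupData}

theorem IsBaseZ.hasLayers (h : IsBaseZ D.U D.P) : HasLayers D := by
  intro p
  refine ⟨(nsmulAddMonoidHom (α := D.G) (p : ℕ)).range, fun x hx => ?_, 1, ?_, ⟨1, rfl⟩⟩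
  · rw [show (2 : ℤ) = ((2 : ℕ) : ℤ) from rfl, h.U_pos p 2 (by norm_num)] at hx
    obtain ⟨a, rfl⟩ := hx
    exact ⟨(p : ℕ) • a, by simp [pow_two, mul_smul]⟩
  · rintro ⟨a, ha⟩
    exact smul_ne_one_of_equiv_int h.elemEquiv p p.2.one_lt a ha

theorem IsBaseQ.hasLayers (h : IsBaseQ D.U D.P) : HasLayers D := by
  intro p
  obtain ⟨K, hK⟩ := h.exists_addSubgroup p (0 + 1)
  obtain ⟨g, hg, hg'⟩ := (h.cyclic p 0).1
  have hmem : ∀ x, x ∈ K ↔ x ∈ D.U p (0 + 1) := fun x => by rw [← hK]; rfl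
  refine ⟨K, fun x hx => (hmem x).2 (h.succ_subset p _ x ?_), g, fun h' => hg' ((hmem g).1 h'),
    (hmem _).2 ((h.smul_mem_succ p 0 g).2 hg)⟩
  simpa using hx

/-- The condition at `p` can only fail to be satisfiable if `p` is one of finitely many primes,
which depend on the special formula but not on the parameters. -/
theorem HasLayers.exists_isLocalSolution (h : HasLayers D) {n n' : ℕ} (π : ParameterChoice n n')
    (c : Fin n → D.G) (c' : Fin n' → D.G) (p : Nat.Primes) (hθ : π.θ p = ⊤)
    (hp : n + π.k.natAbs + π.m < (p : ℕ)) : ∃ a, π.IsLocalSolution D.U D.P c c' p a := by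
  obtain ⟨K, hK, g, hg, hpg⟩ := h p
  have hm : padicValNat (p : ℕ) (π.m : ℕ) = 0 := padicValNat.eq_zero_of_not_dvd fun hd => by
    have := Nat.le_of_dvd π.m.pos hd
    omega
  have hΘ : ∀ a, π.ThetaHolds D.U D.P c c' p a := by
    intro a
    unfold ParameterChoice.ThetaHolds
    rw [hθ]
    exact fun h => h
  -- Among `n + 1` multiples of `g`, no two can be excluded by the same parameter.
  suffices ∃ j : Fin (n + 1), ∀ i, π.k • ((j : ℕ) • g) + c i ∉ D.U p 2 by
    obtain ⟨j, hj⟩ := this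
    refine ⟨(j : ℕ) • g, hΘ _, fun i => ?_⟩
    rw [hm, Nat.cast_zero, add_zero]
    exact hj i
  by_contra! hcon
  choose f hf using hcon
  obtain ⟨j, j', hne, hjj⟩ := Fintype.exists_ne_map_eq_of_card_lt f (by simp)
  have hmem : (π.k * ((j : ℕ) - (j' : ℕ) : ℤ)) • g ∈ K := by
    have e : (π.k * ((j : ℕ) - (j' : ℕ) : ℤ)) • g =
        (π.k • ((j : ℕ) • g) + c (f j)) - (π.k • ((j' : ℕ) • g) + c (f j')) := by
      rw [hjj, add_sub_add_right_eq_sub, ← smul_sub, mul_smul, sub_smul, natCast_zsmul,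
        natCast_zsmul]
    rw [e]
    exact K.sub_mem (hK _ (hf j)) (hK _ (hf j'))
  have hne' : (j : ℕ) ≠ (j' : ℕ) := fun h => hne (Fin.ext h)
  have hprime := Nat.prime_iff_prime_int.1 p.2
  have hcop : IsCoprime (π.k * ((j : ℕ) - (j' : ℕ) : ℤ)) ((p : ℕ) : ℤ) := by
    refine ((Prime.coprime_iff_not_dvd hprime).2 fun hd => ?_).symm
    have := π.k_ne_zero
    rcases hprime.dvd_or_dvd hd with hd | hd
    · have := Nat.le_of_dvd (by omega) (Int.natCast_dvd.1 hd)
      omega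
    · have := Nat.le_of_dvd (by omega) (Int.natCast_dvd.1 hd)
      omega
  obtain ⟨a, b, hab⟩ := hcop
  refine hg ?_
  have e : g = a • ((π.k * ((j : ℕ) - (j' : ℕ) : ℤ)) • g) + b • ((p : ℕ) • g) := by
    rw [← natCast_zsmul, ← mul_smul, ← mul_smul, ← add_smul, hab, one_smul]
  rw [e]
  exact K.add_mem (K.zsmul_mem hmem _) (K.zsmul_mem hpg _)

/-- The primes at which a special formula may fail to be locally satisfiable. -/
def ParameterChoice.badPrimes {n n' : ℕ} (π : ParameterChoice n n') : Set Nat.Primes :=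
  {p | π.θ p ≠ ⊤} ∪ {p | (p : ℕ) ≤ n + π.k.natAbs + π.m}

instance {n n' : ℕ} (π : ParameterChoice n n') : Finite π.badPrimes :=
  (π.finite_nontrivial.union ((Set.finite_Iic _).preimage
    (Subtype.val_injective.injOn))).to_subtype

theorem HasLayers.isLocallySatisfiableSystem_iff (h : HasLayers D) {n n' : ℕ}
    (π : ParameterChoice n n') (c : Fin n → D.G) (c' : Fin n' → D.G) :
    π.IsLocallySatisfiableSystem D.U D.P c c' ↔ Function.Injective (Sum.elim c c') ∧
      ∀ p : π.badPrimes, ∃ a, π.IsLocalSolution D.U D.P c c' p a := by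
  refine and_congr_right fun _ => ⟨fun hp p => hp p, fun hp p => ?_⟩
  by_cases hb : p ∈ π.badPrimes
  · exact hp ⟨p, hb⟩
  · simp only [ParameterChoice.badPrimes, Set.mem_union, Set.mem_ofPred_eq, not_or, not_not,
      not_le] at hb
    exact h.exists_isLocalSolution π c c' p hb.1 hb.2

end Local

section Definability

variable {L : FirstOrder.Language.{0, 0}} [PredLanguage L] {X : Type} {n n' : ℕ}
  (π : ParameterChoice n n') (x : X) (z : Fin n → X) (z' : Fin n' → X)

namespace Def

theorem thetaHolds (p : Nat.Primes) :
    Def L fun D v => π.ThetaHolds D.U D.P (v ∘ z) (v ∘ z') p (v x) := by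
  refine (Def.of_formula (π.θ p) (Sum.elim (fun _ => x) (Sum.elim z z'))).congr fun D v => ?_
  rw [Sum.comp_elim, Sum.comp_elim]
  rfl

theorem isLocalSolution (p : Nat.Primes) :
    Def L fun D v => π.IsLocalSolution D.U D.P (v ∘ z) (v ∘ z') p (v x) :=
  (Def.thetaHolds π x z z' p).and <| Def.forall_finite fun i =>
    (Def.memU p _ (((TermDef.var x).zsmul π.k).add (TermDef.var (z i)))).not

theorem isSolution : Def L fun D v => π.IsSolution D.U D.P (v ∘ z) (v ∘ z') (v x) := by
  have : Finite {p | π.θ p ≠ ⊤} := π.finite_nontrivial.to_subtype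
  refine ((Def.forall_finite (κ := {p | π.θ p ≠ ⊤}) fun p => Def.thetaHolds π x z z' p).and <|
    (Def.forall_finite fun i => Def.memP π.m
      (((TermDef.var x).zsmul π.k).add (TermDef.var (z i)))).and <|
    Def.forall_finite fun j => (Def.memP π.m
      (((TermDef.var x).zsmul π.k).add (TermDef.var (z' j)))).not).congr fun D v => ?_
  refine and_congr_left fun _ => ⟨fun h p => ?_, fun h p => h p⟩
  by_cases hp : π.θ p = ⊤
  · unfold ParameterChoice.ThetaHolds
    rw [hp]
    exact fun h => h
  · exact h ⟨p, hp⟩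

theorem injective {β : Type} [Finite β] (w : β → X) :
    Def L fun _ v => Function.Injective fun b => v (w b) :=
  (Def.forall_finite fun b => Def.forall_finite fun b' =>
    (Def.eq (TermDef.var (w b)) (TermDef.var (w b'))).imp
      (S := fun _ _ => b = b') (by
        by_cases h : b = b'
        · exact Def.false.not.congr fun _ _ => by simp [h]
        · exact Def.false.congr fun _ _ => by simp [h])).congr fun _ _ => Iff.rfl

end Def

/-- Local satisfiability of a system at the finitely many relevant primes. -/
def ParameterChoice.IsFinitelySatisfiable (D : GroupData) (w : Fin n ⊕ Fin n' → D.G) : Prop :=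
  (Function.Injective fun b => w b) ∧
    ∀ p : π.badPrimes, ∃ a, π.IsLocalSolution D.U D.P (w ∘ Sum.inl) (w ∘ Sum.inr) p a

theorem HasLayers.isFinitelySatisfiable_iff {D : GroupData} (h : HasLayers D)
    (c : Fin n → D.G) (c' : Fin n' → D.G) :
    π.IsFinitelySatisfiable D (Sum.elim c c') ↔ π.IsLocallySatisfiableSystem D.U D.P c c' :=
  (h.isLocallySatisfiableSystem_iff π c c').symm

theorem Def.isFinitelySatisfiable (g : Fin n ⊕ Fin n' → X) :
    Def L fun D v => π.IsFinitelySatisfiable D (v ∘ g) :=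
  (Def.injective g).and <| Def.forall_finite fun p =>
    Def.ex (R := fun D v a => π.IsLocalSolution D.U D.P (v ∘ g ∘ Sum.inl) (v ∘ g ∘ Sum.inr) p a) <|
      Def.isLocalSolution π (Sum.inr ()) (Sum.inl ∘ g ∘ Sum.inl) (Sum.inl ∘ g ∘ Sum.inr) p

/-- Infinitely many solutions are expressed by avoiding every finite tuple. -/
theorem elementary_isGeneric {Φ : GroupData → Prop} (hΦ : Elementary L Φ)
    (hlay : ∀ D, Φ D → HasLayers D) : Elementary L fun D => Φ D ∧ IsGeneric D.U D.P := by
  have h : ∀ (n n' : ℕ) (π : ParameterChoice n n') (N : ℕ), Elementary L fun D =>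
      ∀ w : Fin n ⊕ Fin n' → D.G, π.IsFinitelySatisfiable D w → ∀ u : Fin N → D.G, ∃ a,
        π.IsSolution D.U D.P (w ∘ Sum.inl) (w ∘ Sum.inr) a ∧ ∀ i, ¬a = u i := by
    intro n n' π N
    refine Elementary.of_def <| Def.forall_tuple (R := fun D _ w =>
      π.IsFinitelySatisfiable D w → ∀ u : Fin N → D.G, ∃ a,
        π.IsSolution D.U D.P (w ∘ Sum.inl) (w ∘ Sum.inr) a ∧ ∀ i, ¬a = u i) <|
      (Def.isFinitelySatisfiable π Sum.inr).imp <| Def.forall_tuple (R := fun D v u => ∃ a,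
        π.IsSolution D.U D.P (v ∘ Sum.inr ∘ Sum.inl) (v ∘ Sum.inr ∘ Sum.inr) a ∧
          ∀ i, ¬a = u i) <|
      Def.ex (R := fun D v a => π.IsSolution D.U D.P (v ∘ Sum.inl ∘ Sum.inr ∘ Sum.inl)
        (v ∘ Sum.inl ∘ Sum.inr ∘ Sum.inr) a ∧ ∀ i, ¬a = v (Sum.inr i)) <|
      (Def.isSolution π (Sum.inr ()) (Sum.inl ∘ Sum.inl ∘ Sum.inr ∘ Sum.inl)
        (Sum.inl ∘ Sum.inl ∘ Sum.inr ∘ Sum.inr)).and <| Def.forall_finite fun i =>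
        (Def.eq (TermDef.var _) (TermDef.var (Sum.inl (Sum.inr i)))).not
  refine (hΦ.and (Elementary.forall_index fun n => Elementary.forall_index fun n' =>
    Elementary.forall_index fun π => Elementary.forall_index fun N => h n n' π N)).congr fun D => ?_
  refine and_congr_right fun hD => ⟨fun hg n n' π c c' hs hfin => ?_, fun hg n n' π N w hw u => ?_⟩
  · obtain ⟨N, u, hu⟩ := hfin.fin_param
    obtain ⟨a, ha, hau⟩ := hg n n' π N (Sum.elim c c')
      (((hlay D hD).isFinitelySatisfiable_iff π c c').2 hs) u
    have : a ∈ Set.range u := by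
      rw [hu.2]
      exact ha
    obtain ⟨i, hi⟩ := this
    exact hau i hi.symm
  · rw [← Sum.elim_comp_inl_inr w] at hw
    obtain ⟨a, ha, hau⟩ := (hg n n' π _ _
      (((hlay D hD).isFinitelySatisfiable_iff π _ _).1 hw)).exists_notMem_finite
      (Set.finite_range u)
    exact ⟨a, ha, fun i hi => hau ⟨i, hi.symm⟩⟩

theorem elementary_isGenericLt {Φ : GroupData → Prop} (hΦ : Elementary L2star Φ)
    (hlay : ∀ D, Φ D → HasLayers D) :
    Elementary L2star fun D => Φ D ∧ IsGenericLt D.lt D.U D.P := by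
  have h : ∀ (n n' : ℕ) (π : ParameterChoice n n'), Elementary L2star fun D =>
      ∀ w : Fin n ⊕ Fin n' → D.G, π.IsFinitelySatisfiable D w → ∀ b b' : D.G, D.lt b b' →
        ∃ a, D.lt b a ∧ D.lt a b' ∧ π.IsSolution D.U D.P (w ∘ Sum.inl) (w ∘ Sum.inr) a := by
    intro n n' π
    refine Elementary.of_def <| Def.forall_tuple (R := fun D _ w =>
      π.IsFinitelySatisfiable D w → ∀ b b' : D.G, D.lt b b' →
        ∃ a, D.lt b a ∧ D.lt a b' ∧ π.IsSolution D.U D.P (w ∘ Sum.inl) (w ∘ Sum.inr) a) <|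
      (Def.isFinitelySatisfiable π Sum.inr).imp <| Def.all (R := fun D v b => ∀ b' : D.G,
        D.lt b b' → ∃ a, D.lt b a ∧ D.lt a b' ∧
          π.IsSolution D.U D.P (v ∘ Sum.inr ∘ Sum.inl) (v ∘ Sum.inr ∘ Sum.inr) a) <|
      Def.all (R := fun D v b' => D.lt (v (Sum.inr ())) b' → ∃ a, D.lt (v (Sum.inr ())) a ∧
        D.lt a b' ∧ π.IsSolution D.U D.P (v ∘ Sum.inl ∘ Sum.inr ∘ Sum.inl)
          (v ∘ Sum.inl ∘ Sum.inr ∘ Sum.inr) a) <|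
      (Def.lt (TermDef.var (Sum.inl (Sum.inr ()))) (TermDef.var _)).imp <|
      Def.ex (R := fun D v a => D.lt (v (Sum.inl (Sum.inr ()))) a ∧ D.lt a (v (Sum.inr ())) ∧
        π.IsSolution D.U D.P (v ∘ Sum.inl ∘ Sum.inl ∘ Sum.inr ∘ Sum.inl)
          (v ∘ Sum.inl ∘ Sum.inl ∘ Sum.inr ∘ Sum.inr) a) <|
      (Def.lt (TermDef.var (Sum.inl (Sum.inl (Sum.inr ())))) (TermDef.var _)).and <|
      (Def.lt (TermDef.var _) (TermDef.var (Sum.inl (Sum.inr ())))).and <|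
      Def.isSolution π (Sum.inr ()) (Sum.inl ∘ Sum.inl ∘ Sum.inl ∘ Sum.inr ∘ Sum.inl)
        (Sum.inl ∘ Sum.inl ∘ Sum.inl ∘ Sum.inr ∘ Sum.inr)
  refine (hΦ.and (Elementary.forall_index fun n => Elementary.forall_index fun n' =>
    Elementary.forall_index fun π => h n n' π)).congr fun D => ?_
  refine and_congr_right fun hD => ⟨fun hg n n' π c c' hs => ?_, fun hg n n' π w hw => ?_⟩
  · exact hg n n' π (Sum.elim c c') (((hlay D hD).isFinitelySatisfiable_iff π c c').2 hs)
  · rw [← Sum.elim_comp_inl_inr w] at hw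
    exact hg n n' π _ _ (((hlay D hD).isFinitelySatisfiable_iff π _ _).1 hw)

theorem elementary_isBaseQlt : Elementary L2star fun D => IsBaseQlt D.lt D.U D.P := by
  have h : Elementary L2star fun D =>
      @ElementarilyEquivalent L0lt D.G ℚ (structure0lt D.lt)
        (structure0lt fun a b : ℚ => a < b) := by
    let := structure0lt fun a b : ℚ => a < b
    let φ : L0lt →ᴸ L2star := LHom.sumMap LHom.sumInl (LHom.id LLt)
    refine ⟨φ.onTheory (L0lt.completeTheory ℚ), fun D => ?_⟩
    let := structure0lt D.lt
    let := GroupLanguage.str (L := L2star) D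
    have : φ.IsExpansionOn D.G := ⟨fun {_} f _ => by rcases f with f | f <;> rfl,
      fun {_} r _ => by rcases r with r | r <;> rfl⟩
    refine (LHom.onTheory_model φ _).trans ⟨fun h => ElementarilyEquivalent.symm ?_, fun h => ?_⟩
    · rw [elementarilyEquivalent_iff]
      exact fun φ => (realize_iff_of_model_completeTheory ℚ D.G φ).symm
    · exact (ElementarilyEquivalent.theory_model_iff h).2 inferInstance
  exact (h.and elementary_isBaseQ).congr fun D => ⟨fun h => ⟨h.1, h.2⟩, fun h => ⟨h.1, h.2⟩⟩

end Definability

theorem exists_axiomatization_genericZ : ∃ T : L1star.Theory, Axiomatizes T GenericZ := by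
  refine exists_axiomatization exists_theory_L1star
    (elementary_isGeneric elementary_isBaseZ fun D h => h.hasLayers) GenericZ fun M s => ⟨?_, ?_⟩
  · rintro ⟨_, _, U, P, rfl, hb, hg⟩
    exact ⟨⟨M, fun _ _ => False, U, P⟩, ⟨hb, hg⟩, rfl⟩
  · rintro ⟨D, ⟨hb, hg⟩, e⟩
    cases e
    exact ⟨_, _, D.U, D.P, rfl, hb, hg⟩

theorem exists_axiomatization_genericQ : ∃ T : L1star.Theory, Axiomatizes T GenericQ := by
  refine exists_axiomatization exists_theory_L1star
    (elementary_isGeneric elementary_isBaseQ fun D h => h.hasLayers) GenericQ fun M s => ⟨?_, ?_⟩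
  · rintro ⟨_, _, U, P, rfl, hb, hg⟩
    exact ⟨⟨M, fun _ _ => False, U, P⟩, ⟨hb, hg⟩, rfl⟩
  · rintro ⟨D, ⟨hb, hg⟩, e⟩
    cases e
    exact ⟨_, _, D.U, D.P, rfl, hb, hg⟩

theorem exists_axiomatization_genericQlt : ∃ T : L2star.Theory, Axiomatizes T GenericQlt := by
  refine exists_axiomatization exists_theory_L2star
    (elementary_isGenericLt elementary_isBaseQlt fun D h => h.base.hasLayers) GenericQlt
    fun M s => ⟨?_, ?_⟩
  · rintro ⟨_, _, lt, U, P, rfl, hb, hg⟩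
    exact ⟨⟨M, lt, U, P⟩, ⟨hb, hg⟩, rfl⟩
  · rintro ⟨D, ⟨hb, hg⟩, e⟩
    cases e
    exact ⟨_, _, D.lt, D.U, D.P, rfl, hb, hg⟩

end SqfQE

theorem mainTheorem6 :
    ((∃ T : SqfQE.L1star.Theory, SqfQE.Axiomatizes T SqfQE.GenericZ) ∧
      ∀ T : SqfQE.L1star.Theory, SqfQE.Axiomatizes T SqfQE.GenericZ → SqfQE.HasQE T) ∧
    ((∃ T : SqfQE.L1star.Theory, SqfQE.Axiomatizes T SqfQE.GenericQ) ∧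
      ∀ T : SqfQE.L1star.Theory, SqfQE.Axiomatizes T SqfQE.GenericQ → SqfQE.HasQE T) ∧
    ((∃ T : SqfQE.L2star.Theory, SqfQE.Axiomatizes T SqfQE.GenericQlt) ∧
      ∀ T : SqfQE.L2star.Theory, SqfQE.Axiomatizes T SqfQE.GenericQlt → SqfQE.HasQE T) :=
  ⟨⟨SqfQE.exists_axiomatization_genericZ, SqfQE.hasQE_genericZ⟩,
    ⟨SqfQE.exists_axiomatization_genericQ, SqfQE.hasQE_genericQ⟩,
    SqfQE.exists_axiomatization_genericQlt, SqfQE.hasQE_genericQlt⟩
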